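/- Let $(X,\Omega,J)$ be a Kähler manifold, and let $D$ be an effective normal crossings divisor in $X$ with compact support (automatic if $X$ is compact); that is, near every point of $D$ there are holomorphic coordinates $z_1,\dots,z_n$, centred at that point, in which $D$ is the divisor of a monomial $z_1^{\alpha_1}\cdots z_n^{\alpha_n}$ with integers $\alpha_i\ge 0$. Then for every open neighbourhood $U$ of $D$ in $X$ there exist a Kähler form $\widetilde\Omega$ for the complex manifold $(X,J)$ and a symplectic embedding \[ \psi:\bigl(X\smallsetminus D,\ \Omega|_{X\smallsetminus D}\bigr)\hookrightarrow\bigl(X\smallsetminus D,\ \widetilde\Omega|_{X\smallsetminus D}\bigr) \] such that: 1. $\psi(X\smallsetminus D)\subset X\smallsetminus N(D)$ for some open neighbourhood $N(D)$ of $D$ in $X$; 2. $\psi(x)=x$ for every $x\in X\smallsetminus D$ with $x\notin U$. Here a Kähler form for $(X,J)$ is a smooth closed real $2$-form $\omega$ with $\omega(Jv,Jw)=\omega(v,w)$ and $\omega(v,Jv)>0$ for all tangent vectors $v\neq 0$, and a symplectic embedding $\psi$ is a smooth embedding with $\psi^*\widetilde\Omega=\Omega$. -/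

import Mathlib

open scoped Manifold ContDiff Topology

noncomputable section

/-- The model space `ℂⁿ` of an `n`-dimensional complex manifold. -/
abbrev CSpace (n : ℕ) : Type := EuclideanSpace ℂ (Fin n)

/-! ### Real two-forms on a complex manifold -/

section Forms

variable {n : ℕ} {X : Type*} [TopologicalSpace X] [ChartedSpace (CSpace n) X]

variable (n X) in
/-- A (not necessarily continuous) field of real alternating 2-forms on the real tangent spaces of
the manifold `X`. -/
def TwoForm : Type _ :=
  (x : X) → (TangentSpace 𝓘(ℝ, CSpace n) x) [⋀^Fin 2]→L[ℝ] ℝ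

variable (n) in
/-- The almost complex structure `J` of the complex manifold `X`: multiplication by `i` on each
tangent space. -/
def complexStructure (x : X) :
    TangentSpace 𝓘(ℝ, CSpace n) x →L[ℝ] TangentSpace 𝓘(ℝ, CSpace n) x :=
  (Complex.I • ContinuousLinearMap.id ℝ (CSpace n) : CSpace n →L[ℝ] CSpace n)

namespace TwoForm

/-- The expression of a two-form in a chart `e`: its pull-back under `e.symm`. It is meaningful on
`e.target`. -/
def inChart (Ω : TwoForm n X) (e : OpenPartialHomeomorph X (CSpace n)) :
    CSpace n → (CSpace n) [⋀^Fin 2]→L[ℝ] ℝ :=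
  fun y => (Ω (e.symm y)).compContinuousLinearMap
    (mfderiv 𝓘(ℝ, CSpace n) 𝓘(ℝ, CSpace n) e.symm y)

/-- The two-form is (real) smooth. -/
def IsSmooth (Ω : TwoForm n X) : Prop :=
  ∀ e ∈ atlas (CSpace n) X, ContDiffOn ℝ ∞ (Ω.inChart e) e.target

/-- The two-form is closed, `dΩ = 0`. -/
def IsClosed (Ω : TwoForm n X) : Prop :=
  ∀ e ∈ atlas (CSpace n) X, ∀ y ∈ e.target, extDeriv (Ω.inChart e) y = 0

/-- `Ω` is a Kähler form for the complex manifold `(X, J)`: a smooth closed real two-form, invariant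
under `J`, such that `Ω(v, J v) > 0` for every nonzero tangent vector `v`. -/
structure IsKaehler (Ω : TwoForm n X) : Prop where
  smooth : Ω.IsSmooth
  closed : Ω.IsClosed
  invariant : ∀ (x : X) (v w : TangentSpace 𝓘(ℝ, CSpace n) x),
    Ω x ![complexStructure n x v, complexStructure n x w] = Ω x ![v, w]
  pos : ∀ (x : X) (v : TangentSpace 𝓘(ℝ, CSpace n) x), v ≠ 0 →
    0 < Ω x ![v, complexStructure n x v]

end TwoForm

/-- For open subsets `U`, `V` of `X`, the map `ψ` (of which only the values on `U` matter) is a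
symplectic embedding `(U, Ω|_U) ↪ (V, Ω'|_V)`: a smooth map from `U` to `V`, a homeomorphism onto
its image, with `ψ^* Ω' = Ω` on `U`. -/
structure IsSymplecticEmbedding (Ω Ω' : TwoForm n X) (U V : Set X) (ψ : X → X) : Prop where
  smooth : ContMDiffOn 𝓘(ℝ, CSpace n) 𝓘(ℝ, CSpace n) ∞ ψ U
  mapsTo : Set.MapsTo ψ U V
  isEmbedding : Topology.IsEmbedding (U.domRestrict ψ)
  pullback : ∀ x ∈ U, ∀ v w : TangentSpace 𝓘(ℝ, CSpace n) x,
    Ω' (ψ x) ![mfderiv 𝓘(ℝ, CSpace n) 𝓘(ℝ, CSpace n) ψ x v,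
      mfderiv 𝓘(ℝ, CSpace n) 𝓘(ℝ, CSpace n) ψ x w] = Ω x ![v, w]

end Forms

/-! ### Effective divisors with normal crossings -/

section Divisors

/-- An effective (Cartier) divisor on a complex manifold `X`, given by local equations: around every
point `p` a holomorphic function `eqn p` on an open set `dom p`, which vanishes identically on no
nonempty open set, such that any two of these functions differ, where both are defined, by a nowhere
vanishing holomorphic factor. -/
structure EffectiveDivisor (n : ℕ) (X : Type*) [TopologicalSpace X]
    [ChartedSpace (CSpace n) X] where
  dom : X → Set X
  eqn : X → X → ℂ
  isOpen_dom : ∀ p, IsOpen (dom p)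
  mem_dom : ∀ p, p ∈ dom p
  holomorphic : ∀ p, ContMDiffOn 𝓘(ℂ, CSpace n) 𝓘(ℂ) ω (eqn p) (dom p)
  nonzero : ∀ p, interior {x ∈ dom p | eqn p x = 0} = ∅
  compatible : ∀ p q, ∃ g : X → ℂ, ContMDiffOn 𝓘(ℂ, CSpace n) 𝓘(ℂ) ω g (dom p ∩ dom q) ∧
    ∀ x ∈ dom p ∩ dom q, g x ≠ 0 ∧ eqn p x = g x * eqn q x

namespace EffectiveDivisor

variable {n : ℕ} {X : Type*} [TopologicalSpace X] [ChartedSpace (CSpace n) X]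

/-- The support of the divisor: the common zero set of the local equations. -/
def support (D : EffectiveDivisor n X) : Set X :=
  {x | D.eqn x x = 0}

/-- Any local equation that is defined at `x` detects whether `x` lies in the support. -/
theorem mem_support_iff (D : EffectiveDivisor n X) {p x : X} (hx : x ∈ D.dom p) :
    x ∈ D.support ↔ D.eqn p x = 0 := by
  obtain ⟨g, -, hg⟩ := D.compatible p x
  obtain ⟨h0, h1⟩ := hg x ⟨hx, D.mem_dom x⟩
  simp [support, h1, h0]

/-- The divisor has normal crossings: around every point `p` of the support there are holomorphic
coordinates `z₁, …, zₙ` centred at `p` in which the divisor is that of a monomial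
`z₁ ^ α₁ ⋯ zₙ ^ αₙ`, that is, the local equation is this monomial times a holomorphic unit. -/
def IsNormalCrossings (D : EffectiveDivisor n X) : Prop :=
  ∀ p ∈ D.support, ∃ z ∈ IsManifold.maximalAtlas 𝓘(ℂ, CSpace n) ω X, p ∈ z.source ∧ z p = 0 ∧
    ∃ (α : Fin n → ℕ) (u : X → ℂ), ContMDiffAt 𝓘(ℂ, CSpace n) 𝓘(ℂ) ω u p ∧ u p ≠ 0 ∧
      ∀ᶠ x in 𝓝 p, D.eqn p x = u x * ∏ k, (z x k) ^ (α k)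

end EffectiveDivisor

end Divisors

end

/-! The embedding is the time-one map of a Moser flow driven by a potential with logarithmic poles
along the divisor. Glue the functions `-log |f_p|`, with `f_p` the local equations, by a partition
of unity supported near the support of the divisor. The result `P` is smooth off the support,
vanishes off a compact set inside `U`, and near the support equals a smooth function `s` minus `∑
α_k log |z_k|`, by the normal crossings condition (`IsNormalCrossings.hasLogPoles`).

Since `log |z_k|` is pluriharmonic, `dd^c P = dd^c s` off the poles, so `dd^c P` extends to a smooth
closed J-invariant form `β` on all of X (`exists_ddc_form`). It has compact support, so after
rescaling `P` by a small constant all forms `Ω + tβ`, for t in an open interval around [0,1], tame J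
(`HasLogPoles.exists_moserData`). The new Kähler form is `Ω + β`.

Define `W_t` by `(Ω + tβ)(W_t, ·) = dP ∘ J = -d^c P`. As `β = d(d^c P)` off the poles, Moser's
computation shows that the flow pulls `Ω + tβ` back to `Ω`. Moreover `W_t` is minus the gradient of
`P` for the metric of `Ω + tβ`, so `P` decreases along flow lines. As `P` tends to +∞ at the poles,
flow lines stay in compact sets away from them and exist up to time one (`MoserData.exists_flow`).

Points must also be pushed a definite distance away. Near the poles the gradient grows like the
inverse of the smallest coordinate, whereas `P` grows only logarithmically, hence `|dP|² ≥ c P²`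
(`exists_steep_direction`). Along a flow line this gives `P' ≤ -c P²`, so `1/P` grows at rate at
least c and `P` is bounded at time one, uniformly in the starting point
(`HasLogPoles.exists_flow_bound`). The region where `P` exceeds the bound, together with the poles,
is the required neighbourhood.

Smoothness of the flow in its initial point is proved by the implicit function theorem in a Banach
space of curves. -/

noncomputable section

/-! ### Smooth dependence of flows on initial conditions -/

section Flow

open Set unitInterval

universe u

variable {G : Type u} [NormedAddCommGroup G] [NormedSpace ℝ G]

/-- Pointwise evaluation of a curve of linear maps on a curve of vectors. -/
def applyCurveCLM (G H : Type*) [NormedAddCommGroup G] [NormedSpace ℝ G] [NormedAddCommGroup H]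
    [NormedSpace ℝ H] : C(I, G →L[ℝ] H) →L[ℝ] C(I, G) →L[ℝ] C(I, H) :=
  LinearMap.mkContinuous₂
    (LinearMap.mk₂ ℝ (fun (A : C(I, G →L[ℝ] H)) (g : C(I, G)) =>
      (⟨fun t => A t (g t), by fun_prop⟩ : C(I, H)))
      (fun _ _ _ => by ext; simp) (fun _ _ _ => by ext; simp)
      (fun _ _ _ => by ext; simp) (fun _ _ _ => by ext; simp)) 1
    (fun A g => by
      refine (ContinuousMap.norm_le _ (by positivity)).2 fun t => ?_
      simp only [LinearMap.mk₂_apply, ContinuousMap.coe_mk, one_mul]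
      exact (ContinuousLinearMap.le_opNorm _ _).trans
        (mul_le_mul (A.norm_coe_le_norm t) (g.norm_coe_le_norm t) (norm_nonneg _) (norm_nonneg A)))

/-- Mean value inequality for `F - F'(x)`. The modulus does not depend on the base point, so the
estimate can be used at all points of a curve simultaneously. -/
theorem norm_taylor_le_of_fderiv_uniform {H : Type*} [NormedAddCommGroup H] [NormedSpace ℝ H]
    {F : G → H} (hF : Differentiable ℝ F) {ε δ : ℝ}
    (h : ∀ x y, dist x y < δ → dist (fderiv ℝ F x) (fderiv ℝ F y) < ε) {x y : G}
    (hxy : dist y x < δ) : ‖F y - F x - fderiv ℝ F x (y - x)‖ ≤ ε * ‖y - x‖ := by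
  have key := Convex.norm_image_sub_le_of_norm_hasFDerivWithin_le (𝕜 := ℝ)
    (f := fun z => F z - fderiv ℝ F x z) (f' := fun z => fderiv ℝ F z - fderiv ℝ F x) (C := ε)
    (s := Metric.ball x δ) (x := x) (y := y)
    (fun z _ => ((hF z).hasFDerivAt.sub (fderiv ℝ F x).hasFDerivAt).hasFDerivWithinAt)
    (fun z hz => by
      rw [← dist_eq_norm]
      exact (h z x hz).le)
    (convex_ball _ _) (Metric.mem_ball_self (dist_nonneg.trans_lt hxy)) hxy
  convert key using 2
  simp only [map_sub]
  abel

/-- The derivative of composition with `F` at `γ` is pointwise application of `F' ∘ γ`. Compact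
support makes `F'` uniformly continuous, so the Taylor remainders are small in the sup norm. -/
theorem hasFDerivAt_comp_curve {H : Type*} [NormedAddCommGroup H] [NormedSpace ℝ H] {F : G → H}
    (hF : ContDiff ℝ ∞ F) (hc : HasCompactSupport F) (γ : C(I, G)) :
    HasFDerivAt (fun γ : C(I, G) => (⟨F, hF.continuous⟩ : C(G, H)).comp γ)
      (applyCurveCLM G H ((⟨fderiv ℝ F, hF.continuous_fderiv (by simp)⟩ :
        C(G, G →L[ℝ] H)).comp γ)) γ := by
  have huc : UniformContinuous (fderiv ℝ F) :=
    (hc.fderiv (𝕜 := ℝ)).uniformContinuous_of_continuous (hF.continuous_fderiv (by simp))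
  rw [Metric.uniformContinuous_iff] at huc
  rw [hasFDerivAt_iff_isLittleO_nhds_zero, Asymptotics.isLittleO_iff]
  intro ε hε
  obtain ⟨δ, hδ, h⟩ := huc ε hε
  filter_upwards [Metric.ball_mem_nhds (0 : C(I, G)) hδ] with g hg
  refine (ContinuousMap.norm_le _ (by positivity)).2 fun t => ?_
  have h1 : dist (γ t + g t) (γ t) < δ := by
    rw [dist_eq_norm, add_sub_cancel_left]
    exact (g.norm_coe_le_norm t).trans_lt (by simpa using hg)
  have := norm_taylor_le_of_fderiv_uniform (hF.differentiable (by simp)) (fun x y => @h x y) h1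
  rw [add_sub_cancel_left] at this
  exact this.trans (mul_le_mul_of_nonneg_left (g.norm_coe_le_norm t) hε.le)

/-- By `hasFDerivAt_comp_curve` the derivative is a bounded linear map applied to composition with
`F'`. The induction therefore runs over all target spaces at once, as it passes from `H` to `G →L[ℝ]
H`. -/
theorem contDiff_comp_curve_nat (k : ℕ) : ∀ {H : Type u} [NormedAddCommGroup H] [NormedSpace ℝ H]
    {F : G → H} (hF : ContDiff ℝ ∞ F) (_ : HasCompactSupport F),
    ContDiff ℝ k (fun γ : C(I, G) => (⟨F, hF.continuous⟩ : C(G, H)).comp γ) := by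
  induction k with
  | zero =>
    intro H _ _ F hF hc
    exact contDiff_zero.2 (ContinuousMap.continuous_postcomp _)
  | succ k ih =>
    intro H _ _ F hF hc
    have hd := hasFDerivAt_comp_curve hF hc
    rw [Nat.cast_add, Nat.cast_one, contDiff_succ_iff_fderiv]
    refine ⟨fun γ => (hd γ).differentiableAt, by simp, ?_⟩
    rw [funext fun γ => (hd γ).fderiv]
    exact (ContinuousLinearMap.contDiff (E := C(I, G →L[ℝ] H))
      (F := C(I, G) →L[ℝ] C(I, H)) (applyCurveCLM G H)).comp
      (ih (contDiff_infty_iff_fderiv.1 hF).2 (hc.fderiv (𝕜 := ℝ)))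

theorem contDiff_comp_curve {H : Type u} [NormedAddCommGroup H] [NormedSpace ℝ H]
    {F : G → H} (hF : ContDiff ℝ ∞ F) (hc : HasCompactSupport F) :
    ContDiff ℝ ∞ (fun γ : C(I, G) => (⟨F, hF.continuous⟩ : C(G, H)).comp γ) :=
  contDiff_infty.2 fun k => contDiff_comp_curve_nat k hF hc

theorem continuous_curve_projIcc {G : Type*} [NormedAddCommGroup G] (γ : C(I, G)) :
    Continuous fun s : ℝ => γ (projIcc 0 1 zero_le_one s) :=
  γ.continuous.comp continuous_projIcc

variable (G) in
/-- The primitive, vanishing at `0`, of a curve. -/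
def primitiveCurveCLM [CompleteSpace G] : C(I, G) →L[ℝ] C(I, G) :=
  LinearMap.mkContinuous
    { toFun := fun γ => ⟨fun t => ∫ s in (0 : ℝ)..t, γ (projIcc 0 1 zero_le_one s),
        (intervalIntegral.continuous_primitive
          (fun _ _ => (continuous_curve_projIcc γ).intervalIntegrable _ _) 0).comp
          continuous_subtype_val⟩
      map_add' := fun γ γ' => by
        ext t
        exact intervalIntegral.integral_add ((continuous_curve_projIcc γ).intervalIntegrable _ _)
          ((continuous_curve_projIcc γ').intervalIntegrable _ _)
      map_smul' := fun c γ => by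
        ext t
        exact intervalIntegral.integral_smul c _ } 1
    (fun γ => by
      refine (ContinuousMap.norm_le _ (by positivity)).2 fun t => ?_
      have := intervalIntegral.norm_integral_le_of_norm_le_const (a := 0) (b := (t : ℝ))
        (C := ‖γ‖) (f := fun s => γ (projIcc 0 1 zero_le_one s))
        (fun s _ => γ.norm_coe_le_norm _)
      refine this.trans ?_
      rw [one_mul, sub_zero, abs_of_nonneg t.2.1]
      exact mul_le_of_le_one_right (norm_nonneg _) t.2.2)

theorem primitiveCurveCLM_apply [CompleteSpace G] (γ : C(I, G)) (t : I) :
    primitiveCurveCLM G γ t = ∫ s in (0 : ℝ)..t, γ (projIcc 0 1 zero_le_one s) := rfl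

variable (G) in
/-- Constant curves. -/
def constCurveCLM : G →L[ℝ] C(I, G) :=
  LinearMap.mkContinuous
    { toFun := fun x => ContinuousMap.const I x
      map_add' := fun _ _ => by ext; simp
      map_smul' := fun _ _ => by ext; simp } 1
    (fun x => by
      refine (ContinuousMap.norm_le _ (by positivity)).2 fun t => ?_
      simp)

@[simp] theorem constCurveCLM_apply (x : G) (t : I) : constCurveCLM G x t = x := rfl

/-- A smooth family of solutions of `γ' = s F(γ)`, `γ 0 = x` on the unit interval, for `s` near `0`
and `x` near `x₀`, in integral form. -/
theorem exists_smooth_integral_solution [CompleteSpace G] {F : G → G} (hF : ContDiff ℝ ∞ F)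
    (hc : HasCompactSupport F) (x₀ : G) :
    ∃ Γ : ℝ × G → C(I, G), ContDiffAt ℝ ∞ Γ (0, x₀) ∧
      ∀ᶠ p in 𝓝 ((0 : ℝ), x₀), ∀ t : I,
        Γ p t = p.2 + p.1 • ∫ s in (0 : ℝ)..t, F (Γ p (projIcc 0 1 zero_le_one s)) := by
  set N : C(I, G) → C(I, G) := fun γ => (⟨F, hF.continuous⟩ : C(G, G)).comp γ with hN
  have hNs : ContDiff ℝ ∞ N := contDiff_comp_curve hF hc
  set f : (ℝ × G) × C(I, G) → C(I, G) :=
    fun v => v.2 - constCurveCLM G v.1.2 - v.1.1 • primitiveCurveCLM G (N v.2) with hf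
  have hfs : ContDiff ℝ ∞ f := by
    refine (contDiff_snd.sub ((constCurveCLM G).contDiff.comp contDiff_fst.snd)).sub ?_
    exact contDiff_fst.fst.smul ((primitiveCurveCLM G).contDiff.comp (hNs.comp contDiff_snd))
  set u : (ℝ × G) × C(I, G) := ((0, x₀), constCurveCLM G x₀) with hu
  have hfu : f u = 0 := by simp [hf, hu]
  -- At `s = 0` the integral term drops out, so the partial derivative in the curve is the identity
  -- and the implicit function theorem applies.
  have hinr : fderiv ℝ f u ∘L .inr ℝ (ℝ × G) C(I, G) = ContinuousLinearMap.id ℝ _ := by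
    have h1 : HasFDerivAt (fun γ : C(I, G) => f ((0, x₀), γ))
        (fderiv ℝ f u ∘L .inr ℝ (ℝ × G) C(I, G)) (constCurveCLM G x₀) := by
      have hd : HasFDerivAt f (fderiv ℝ f u) ((0, x₀), constCurveCLM G x₀) :=
        (hfs.differentiable (by simp) u).hasFDerivAt
      exact hd.comp _ (hasFDerivAt_prodMk_right (0, x₀) (constCurveCLM G x₀))
    have h2 : HasFDerivAt (fun γ : C(I, G) => f ((0, x₀), γ))
        (ContinuousLinearMap.id ℝ _) (constCurveCLM G x₀) := by
      have : (fun γ : C(I, G) => f ((0, x₀), γ)) = fun γ => γ - constCurveCLM G x₀ := by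
        funext γ; simp [hf]
      rw [this]
      exact (hasFDerivAt_id _).sub_const _
    exact h1.unique h2
  have hinv : (fderiv ℝ f u ∘L .inr ℝ (ℝ × G) C(I, G)).IsInvertible := by
    rw [hinr]; exact ⟨ContinuousLinearEquiv.refl ℝ _, rfl⟩
  have hfa : ContDiffAt ℝ ∞ f u := hfs.contDiffAt
  refine ⟨hfa.implicitFunction (by simp) hinv, hfa.contDiffAt_implicitFunction _ hinv, ?_⟩
  filter_upwards [hfa.eventually_apply_implicitFunction (by simp) hinv] with p hp t
  rw [hfu] at hp
  have := congrArg (fun γ : C(I, G) => γ t) hp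
  simp only [hf, ContinuousMap.sub_apply, ContinuousMap.smul_apply, constCurveCLM_apply,
    ContinuousMap.zero_apply, primitiveCurveCLM_apply] at this
  rw [sub_sub, sub_eq_zero] at this
  exact this

/-- **Smooth dependence on initial conditions**: the local flow of a compactly supported smooth
vector field is smooth. -/
theorem exists_smooth_flow_of_hasCompactSupport [CompleteSpace G] {F : G → G}
    (hF : ContDiff ℝ ∞ F) (hc : HasCompactSupport F) (x₀ : G) :
    ∃ α : G × ℝ → G, ContDiffAt ℝ ∞ α (x₀, 0) ∧ ∀ᶠ p in 𝓝 (x₀, (0 : ℝ)),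
      α (p.1, 0) = p.1 ∧ HasDerivAt (fun t => α (p.1, t)) (F (α p)) p.2 := by
  obtain ⟨α, hα⟩ := (hF.contDiffAt (x := x₀)).of_le (m := 1) (by simp)
    |>.exists_eventually_eq_hasDerivAt 0
  rw [← nhds_prod_eq] at hα
  refine ⟨fun p => α p.1 p.2, ?_, hα⟩
  obtain ⟨Γ, hΓs, hΓ⟩ := exists_smooth_integral_solution hF hc x₀
  obtain ⟨C, hC⟩ := hF.lipschitzWith_of_hasCompactSupport hc (by simp)
  have hsm : ContDiffAt ℝ ∞ (fun p : G × ℝ => Γ (p.2, p.1) 1) (x₀, 0) := by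
    have h1 : ContDiffAt ℝ ∞ (fun p : G × ℝ => Γ (p.2, p.1)) (x₀, 0) :=
      ContDiffAt.comp (g := Γ) (x₀, 0) hΓs (contDiff_snd.prodMk contDiff_fst).contDiffAt
    exact (ContinuousMap.evalCLM ℝ (1 : I)).contDiff.contDiffAt.comp _ h1
  refine hsm.congr_of_eventuallyEq ?_
  have hΓ' : ∀ᶠ p in 𝓝 (x₀, (0 : ℝ)), ∀ t : I,
      Γ (p.2, p.1) t = p.1 + p.2 • ∫ s in (0 : ℝ)..t, F (Γ (p.2, p.1) (projIcc 0 1 zero_le_one s)) :=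
    (continuous_swap.tendsto (x₀, (0 : ℝ))).eventually hΓ
  obtain ⟨δ, hδ, hball⟩ := Metric.eventually_nhds_iff_ball.1 hα
  filter_upwards [hΓ', Metric.ball_mem_nhds _ hδ] with p hp hpδ
  have hpr : ∀ τ ∈ Icc (0 : ℝ) 1, (p.1, p.2 * τ) ∈ Metric.ball (x₀, (0 : ℝ)) δ := by
    intro τ hτ
    rw [Metric.mem_ball, Prod.dist_eq, max_lt_iff] at hpδ ⊢
    refine ⟨hpδ.1, ?_⟩
    have h2 := hpδ.2
    simp only [Real.dist_eq, sub_zero, abs_mul, abs_of_nonneg hτ.1] at h2 ⊢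
    exact (mul_le_of_le_one_right (abs_nonneg _) hτ.2).trans_lt h2
  have hcont : Continuous fun s : ℝ => F (Γ (p.2, p.1) (projIcc 0 1 zero_le_one s)) :=
    hF.continuous.comp (continuous_curve_projIcc _)
  -- the two curves solve the same equation
  have hderg : ∀ τ : ℝ, HasDerivAt
      (fun τ : ℝ => p.1 + p.2 • ∫ s in (0 : ℝ)..τ, F (Γ (p.2, p.1) (projIcc 0 1 zero_le_one s)))
      (p.2 • F (Γ (p.2, p.1) (projIcc 0 1 zero_le_one τ))) τ := fun τ =>
    ((intervalIntegral.integral_hasDerivAt_right (hcont.intervalIntegrable _ _)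
      (hcont.stronglyMeasurableAtFilter _ _) hcont.continuousAt).const_smul p.2).const_add p.1
  -- Rescaling time turns the flow line up to time `p.2` into a solution of `γ' = p.2 F(γ)` on the
  -- unit interval, the equation solved by `Γ`. Uniqueness then identifies `α` with the smooth map
  -- `Γ` evaluated at `1`.
  have hderf : ∀ τ ∈ Icc (0 : ℝ) 1, HasDerivAt (fun τ : ℝ => α p.1 (p.2 * τ))
      (p.2 • F (α p.1 (p.2 * τ))) τ := by
    intro τ hτ
    have h1 := (hball _ (hpr τ hτ)).2
    have h2 : HasDerivAt (fun τ : ℝ => p.2 * τ) p.2 τ := by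
      simpa using (hasDerivAt_id τ).const_mul p.2
    exact h1.scomp τ h2
  have huniq := ODE_solution_unique (v := fun _ x => p.2 • F x) (K := ‖p.2‖₊ * C)
    (f := fun τ : ℝ => α p.1 (p.2 * τ)) (a := 0) (b := 1)
    (g := fun τ : ℝ => p.1 + p.2 • ∫ s in (0 : ℝ)..τ, F (Γ (p.2, p.1) (projIcc 0 1 zero_le_one s)))
    (fun _ => (lipschitzWith_smul p.2).comp hC)
    (fun τ hτ => (hderf τ hτ).continuousAt.continuousWithinAt)
    (fun τ hτ => (hderf τ ⟨hτ.1, hτ.2.le⟩).hasDerivWithinAt)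
    (fun τ _ => (hderg τ).continuousAt.continuousWithinAt)
    (fun τ hτ => by
      have h1 := hp ⟨τ, hτ.1, hτ.2.le⟩
      rw [← h1]
      convert (hderg τ).hasDerivWithinAt using 3
      exact congrArg _ (projIcc_of_mem zero_le_one ⟨hτ.1, hτ.2.le⟩).symm)
    (by
      have := (hball _ (hpr 0 (by simp))).1
      simpa using this)
  have := huniq (by simp : (1 : ℝ) ∈ Icc (0 : ℝ) 1)
  simp only [mul_one] at this
  rw [this]
  exact (hp 1).symm

end Flow

/-! ### Time-dependent flows and Moser's computation in a vector space -/

section TimeDependentFlow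

open Set

universe u

variable {E : Type u} [NormedAddCommGroup E] [NormedSpace ℝ E]

/-- Local flow, of class `C^m`, of a smooth time-dependent vector field, with arbitrary initial
time `s` near `t₀`. -/
theorem exists_local_flow_timeDependent [FiniteDimensional ℝ E] {O : Set (ℝ × E)}
    (hO : IsOpen O) {W : ℝ × E → E} (hW : ContDiffOn ℝ ∞ W O) {t₀ : ℝ} {y₀ : E} (h₀ : (t₀, y₀) ∈ O) (m : ℕ) :
    ∃ δ > 0, ∃ Φ : ℝ × ℝ × E → E, ∀ s ∈ Metric.ball t₀ δ, ∀ t ∈ Metric.ball t₀ δ,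
      ∀ y ∈ Metric.ball y₀ δ, ContDiffAt ℝ m Φ (s, t, y) ∧ (t, Φ (s, t, y)) ∈ O ∧
        Φ (s, s, y) = y ∧ HasDerivAt (fun t => Φ (s, t, y)) (W (t, Φ (s, t, y))) t := by
  obtain ⟨r, hr, hrO⟩ := Metric.isOpen_iff.1 hO _ h₀
  let χ : ContDiffBump (t₀, y₀) := ⟨r / 4, r / 2, by linarith, by linarith⟩
  have hsub : tsupport χ ⊆ O := by
    rw [χ.tsupport_eq]
    exact (Metric.closedBall_subset_ball (by simp [χ]; linarith)).trans hrO
  -- The field is made autonomous by adding time as a coordinate, and cut off to have compact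
  -- support; near the base point the cut-off is `1`.
  set F : ℝ × E → ℝ × E := fun p => χ p • ((1 : ℝ), W p) with hF
  have hFs : ContDiff ℝ ∞ F := by
    rw [contDiff_iff_contDiffAt]
    intro p
    by_cases hp : p ∈ O
    · exact χ.contDiff.contDiffAt.smul
        (contDiffAt_const.prodMk (hW.contDiffAt (hO.mem_nhds hp)))
    · have : F =ᶠ[𝓝 p] fun _ => 0 := by
        filter_upwards [(isClosed_tsupport χ).isOpen_compl.mem_nhds fun h => hp (hsub h)] with q hq
        simp [hF, image_eq_zero_of_notMem_tsupport hq]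
      exact contDiffAt_const.congr_of_eventuallyEq this
  have hFc : HasCompactSupport F := χ.hasCompactSupport.smul_right
  obtain ⟨α, hαs, hα⟩ := exists_smooth_flow_of_hasCompactSupport hFs hFc (t₀, y₀)
  have hα0 : α ((t₀, y₀), 0) = (t₀, y₀) := hα.self_of_nhds.1
  have hαO : ∀ᶠ p in 𝓝 ((t₀, y₀), (0 : ℝ)), α p ∈ O ∧ χ (α p) = 1 := by
    have : ∀ᶠ q in 𝓝 (α ((t₀, y₀), 0)), q ∈ O ∧ χ q = 1 := by
      rw [hα0]
      exact Filter.Eventually.and (hO.mem_nhds h₀) χ.eventuallyEq_one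
    exact hαs.continuousAt.eventually this
  -- Smoothness at one point yields class `C^m` on a neighbourhood that may depend on `m`; this is
  -- why `m` is fixed in the statement.
  have hαm : ∀ᶠ p in 𝓝 ((t₀, y₀), (0 : ℝ)), ContDiffAt ℝ m α p :=
    (hαs.of_le (by exact_mod_cast le_top)).eventually (by simp)
  obtain ⟨ρ, hρ, hball⟩ := Metric.eventually_nhds_iff_ball.1 (hα.and (hαO.and hαm))
  refine ⟨ρ / 2, by linarith, fun q => (α ((q.1, q.2.2), q.2.1 - q.1)).2, ?_⟩
  intro s hs t ht y hy
  have hmem : ∀ τ ∈ Metric.ball (0 : ℝ) ρ, ((s, y), τ) ∈ Metric.ball ((t₀, y₀), (0 : ℝ)) ρ := by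
    intro τ hτ
    simp only [Metric.mem_ball, Prod.dist_eq, max_lt_iff] at hs hy hτ ⊢
    exact ⟨⟨by linarith, by linarith⟩, hτ⟩
  have hts : t - s ∈ Metric.ball (0 : ℝ) ρ := by
    simp only [Metric.mem_ball, Real.dist_eq, sub_zero, abs_lt] at hs ht ⊢
    constructor <;> linarith [hs.1, hs.2, ht.1, ht.2]
  have hz : (0 : ℝ) ∈ Metric.ball (0 : ℝ) ρ := Metric.mem_ball_self hρ
  have hder : ∀ τ ∈ Metric.ball (0 : ℝ) ρ,
      HasDerivAt (fun τ => α ((s, y), τ)) ((1 : ℝ), W (α ((s, y), τ))) τ := by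
    intro τ hτ
    have h := hball _ (hmem τ hτ)
    have h1 := h.1.2
    simp only [hF, h.2.1.2, one_smul] at h1
    exact h1
  -- The time coordinate has speed one, so the flow at parameter `t - s` sits at time `t`.
  have hfst : ∀ τ ∈ Metric.ball (0 : ℝ) ρ, (α ((s, y), τ)).1 = s + τ := by
    intro τ hτ
    have hd : ∀ x ∈ Metric.ball (0 : ℝ) ρ,
        HasDerivAt (fun τ => (α ((s, y), τ)).1 - τ) 0 x := fun x hx => by
      have h1 : HasDerivAt (fun τ => (α ((s, y), τ)).1) 1 x :=
        (hder x hx).fst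
      simpa using h1.fun_sub (hasDerivAt_id' x)
    have := (convex_ball (0 : ℝ) ρ).is_const_of_fderivWithin_eq_zero (𝕜 := ℝ)
      (fun x hx => (hd x hx).differentiableAt.differentiableWithinAt)
      (fun x hx => by
        rw [fderivWithin_of_isOpen Metric.isOpen_ball hx]
        simpa using (hd x hx).hasFDerivAt.fderiv) hτ hz
    have h0 := (hball _ (hmem 0 hz)).1.1
    simp only at h0
    rw [h0] at this
    simp only [sub_zero] at this
    linarith
  have hαt : α ((s, y), t - s) = (t, (α ((s, y), t - s)).2) := by
    refine Prod.ext ?_ rfl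
    simp [hfst _ hts]
  have hb := hball _ (hmem _ hts)
  refine ⟨?_, ?_, ?_, ?_⟩
  · have h1 : ContDiffAt ℝ m (fun q : ℝ × ℝ × E => (((q.1, q.2.2), q.2.1 - q.1) : (ℝ × E) × ℝ))
        (s, t, y) := by
      fun_prop
    exact contDiffAt_snd.comp _ (ContDiffAt.comp (g := α) (s, t, y) hb.2.2 h1)
  · rw [← hαt]; exact hb.2.1.1
  · have := (hball _ (hmem 0 hz)).1.1
    simp only [sub_self]
    rw [this]
  · have h1 : HasDerivAt (fun τ => (α ((s, y), τ)).2) (W (α ((s, y), t - s))) (t - s) :=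
      (hder _ hts).snd
    rw [hαt] at h1
    exact h1.comp_sub_const t s

theorem hasDerivAt_id_smul {V : Type*} [NormedAddCommGroup V] [NormedSpace ℝ V] {f : ℝ → V}
    {f' : V} {t : ℝ} (h : HasDerivAt f f' t) :
    HasDerivAt (fun t => t • f t) (t • f' + f t) t := by
  simpa using (hasDerivAt_id' t).fun_smul h

theorem hasFDerivAt_add_const_smul {V G : Type*} [NormedAddCommGroup V] [NormedSpace ℝ V]
    [NormedAddCommGroup G] [NormedSpace ℝ G] {f g : G → V} {f' g' : G →L[ℝ] V} {x : G}
    (hf : HasFDerivAt f f' x) (hg : HasFDerivAt g g' x) (t : ℝ) :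
    HasFDerivAt (fun x => f x + t • g x) (f' + t • g') x :=
  hf.fun_add (hg.fun_const_smul t)

/-- **Moser's computation**: if `ω_t = A + t B` is a smooth family of closed two-forms, where
`B = dη` and `ω_t(W_t, ·) = -η`, then the flow of `W` preserves `ω_t`. -/
theorem hasDerivAt_moser_pullback {A B : E → E →L[ℝ] E →L[ℝ] ℝ} {η : E → E →L[ℝ] ℝ}
    {W : ℝ × E → E} {φ : ℝ × E → E} {t : ℝ} {y : E}
    (hφ : ContDiffAt ℝ 2 φ (t, y))
    (hφW : ∀ᶠ p in 𝓝 (t, y), HasDerivAt (fun t => φ (t, p.2)) (W (p.1, φ p)) p.1)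
    (hA : DifferentiableAt ℝ A (φ (t, y))) (hB : DifferentiableAt ℝ B (φ (t, y)))
    (hη : DifferentiableAt ℝ η (φ (t, y)))
    (hW : DifferentiableAt ℝ W (t, φ (t, y)))
    (hanti : ∀ z u v, A z u v = - A z v u) (hantiB : ∀ z u v, B z u v = - B z v u)
    (hAc : ∀ u v w, fderiv ℝ A (φ (t, y)) u v w - fderiv ℝ A (φ (t, y)) v u w
      + fderiv ℝ A (φ (t, y)) w u v = 0)
    (hBc : ∀ u v w, fderiv ℝ B (φ (t, y)) u v w - fderiv ℝ B (φ (t, y)) v u w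
      + fderiv ℝ B (φ (t, y)) w u v = 0)
    (hBη : ∀ u v, B (φ (t, y)) u v
      = fderiv ℝ η (φ (t, y)) u v - fderiv ℝ η (φ (t, y)) v u)
    (hWη : ∀ᶠ z in 𝓝 (φ (t, y)), ∀ v, (A z + t • B z) (W (t, z)) v = - η z v) (u v : E) :
    HasDerivAt (fun t => (A (φ (t, y)) + t • B (φ (t, y)))
      (fderiv ℝ (fun y => φ (t, y)) y u) (fderiv ℝ (fun y => φ (t, y)) y v)) 0 t := by
  set z := φ (t, y) with hz
  set X := W (t, z) with hX
  have hφd : DifferentiableAt ℝ φ (t, y) := hφ.differentiableAt (by simp)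
  have hφ1 : ∀ᶠ p in 𝓝 (t, y), DifferentiableAt ℝ φ p :=
    (hφ.eventually (by simp)).mono fun p hp => hp.differentiableAt (by simp)
  have hDφ : DifferentiableAt ℝ (fderiv ℝ φ) (t, y) :=
    (hφ.fderiv_right (m := 1) (by norm_num)).differentiableAt (by simp)
  have hsymm : IsSymmSndFDerivAt ℝ φ (t, y) := hφ.isSymmSndFDerivAt (by simp)
  have hpart : ∀ p : ℝ × E, DifferentiableAt ℝ φ p → ∀ w : E,
      fderiv ℝ (fun y => φ (p.1, y)) p.2 w = fderiv ℝ φ p (0, w) := fun p hp w => by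
    have h1 : HasFDerivAt (fun y => φ (p.1, y)) (fderiv ℝ φ p ∘L .inr ℝ ℝ E) p.2 :=
      HasFDerivAt.comp (g := φ) p.2 hp.hasFDerivAt (hasFDerivAt_prodMk_right p.1 p.2)
    rw [h1.fderiv]; simp
  have htime : ∀ᶠ p in 𝓝 (t, y), fderiv ℝ φ p (1, 0) = W (p.1, φ p) := by
    filter_upwards [hφ1, hφW] with p hp hpW
    have h1 : HasDerivAt (fun t => φ (t, p.2)) (fderiv ℝ φ p (1, 0)) p.1 := by
      have h2 : HasFDerivAt (fun t => φ (t, p.2)) (fderiv ℝ φ p ∘L .inl ℝ ℝ E) p.1 :=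
        HasFDerivAt.comp (g := φ) p.1 hp.hasFDerivAt (hasFDerivAt_prodMk_left p.1 p.2)
      simpa using h2.hasDerivAt
    exact h1.unique hpW
  set DW : E →L[ℝ] E := fderiv ℝ W (t, z) ∘L .inr ℝ ℝ E with hDW
  set Dy : E → E := fun w => fderiv ℝ φ (t, y) (0, w) with hDy
  -- variational equation
  have hvar : ∀ w : E, HasDerivAt (fun t => fderiv ℝ (fun y => φ (t, y)) y w) (DW (Dy w)) t := by
    intro w
    have hc : HasDerivAt (fun t : ℝ => (t, y)) ((1 : ℝ), (0 : E)) t :=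
      (hasDerivAt_id' t).prodMk (hasDerivAt_const t y)
    have h1 : HasDerivAt (fun t => fderiv ℝ φ (t, y) (0, w))
        (fderiv ℝ (fderiv ℝ φ) (t, y) (1, 0) (0, w)) t := by
      have h2 : HasDerivAt (fun t => fderiv ℝ φ (t, y))
          (fderiv ℝ (fderiv ℝ φ) (t, y) (1, 0)) t :=
        HasFDerivAt.comp_hasDerivAt (l := fderiv ℝ φ) t hDφ.hasFDerivAt hc
      simpa using h2.clm_apply (hasDerivAt_const t ((0 : ℝ), w))
    -- Symmetry of the second derivative exchanges the time and space derivatives, and the time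
    -- derivative of the flow is `W`.
    have h3 : fderiv ℝ (fderiv ℝ φ) (t, y) (1, 0) (0, w) = DW (Dy w) := by
      rw [hsymm.eq]
      have h4 : HasFDerivAt (fun p => fderiv ℝ φ p (1, 0))
          ((fderiv ℝ (fderiv ℝ φ) (t, y)).flip (1, 0)) (t, y) := by
        simpa using hDφ.hasFDerivAt.clm_apply (hasFDerivAt_const ((1 : ℝ), (0 : E)) (t, y))
      have h5 : HasFDerivAt (fun p : ℝ × E => W (p.1, φ p))
          (fderiv ℝ W (t, z) ∘L ((ContinuousLinearMap.fst ℝ ℝ E).prod (fderiv ℝ φ (t, y))))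
          (t, y) :=
        HasFDerivAt.comp (g := W) (t, y) hW.hasFDerivAt
          (hasFDerivAt_fst.prodMk hφd.hasFDerivAt)
      have h6 := (h4.congr_of_eventuallyEq (htime.mono fun _ h => h.symm)).unique h5
      have h7 := congrArg (fun L => L (0, w)) h6
      simpa [hDW, hDy] using h7
    rw [← h3]
    refine h1.congr_of_eventuallyEq ?_
    have hct : ContinuousAt (fun t : ℝ => (t, y)) t := by fun_prop
    filter_upwards [hct.eventually hφ1] with t' ht'
    exact hpart (t', y) ht' w
  have hcurve : HasDerivAt (fun t => φ (t, y)) X t := hφW.self_of_nhds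
  have hform : HasDerivAt (fun t => A (φ (t, y)) + t • B (φ (t, y)))
      (fderiv ℝ A z X + (t • fderiv ℝ B z X + B z)) t := by
    have h1 := HasFDerivAt.comp_hasDerivAt (l := A) t hA.hasFDerivAt hcurve
    have h2 := HasFDerivAt.comp_hasDerivAt (l := B) t hB.hasFDerivAt hcurve
    exact h1.fun_add (hasDerivAt_id_smul (V := E →L[ℝ] E →L[ℝ] ℝ) h2)
  have htot := (hform.clm_apply (hvar u)).clm_apply (hvar v)
  -- differentiate the defining equation of the field
  have hdiff : ∀ a b : E, (fderiv ℝ A z a + t • fderiv ℝ B z a) X b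
      + (A z + t • B z) (DW a) b = - fderiv ℝ η z a b := by
    intro a b
    have hWz : HasFDerivAt (fun z' => W (t, z')) DW z :=
      HasFDerivAt.comp (g := W) z hW.hasFDerivAt (hasFDerivAt_prodMk_right t z)
    have h0 : HasFDerivAt (fun z' => A z' + t • B z') (fderiv ℝ A z + t • fderiv ℝ B z) z :=
      hasFDerivAt_add_const_smul (V := E →L[ℝ] E →L[ℝ] ℝ) hA.hasFDerivAt hB.hasFDerivAt t
    have h1 := (h0.clm_apply hWz).clm_apply (hasFDerivAt_const b z)
    have h2 := (hη.hasFDerivAt.clm_apply (hasFDerivAt_const b z)).neg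
    have h3 := (h1.congr_of_eventuallyEq (hWη.mono fun z' h => (h b).symm)).unique h2
    have h4 := congrArg (fun L => L a) h3
    simpa [add_comm] using h4
  have hu := hpart (t, y) hφd u
  have hv := hpart (t, y) hφd v
  simp only at hu hv
  refine htot.congr_deriv ?_
  rw [hu, hv]
  have e1 := hdiff (Dy u) (Dy v)
  have e2 := hdiff (Dy v) (Dy u)
  have e3 := hAc X (Dy u) (Dy v)
  have e4 := hBc X (Dy u) (Dy v)
  have e5 := hBη (Dy u) (Dy v)
  have e6 := hanti z (Dy u) (DW (Dy v))
  have e7 := hantiB z (Dy u) (DW (Dy v))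
  simp only [hDy, _root_.add_apply, _root_.smul_apply, smul_eq_mul]
    at e1 e2 e3 e4 e5 e6 e7 ⊢
  rw [e6, e7, e5]
  -- Cartan's formula by hand: `e1 - e2` replaces the terms in `DW` by `-dη` and derivatives of the
  -- forms, `dη = B` cancels the time derivative, and closedness of `A` and `B` cancels the rest.
  linear_combination e1 - e2 + e3 + t * e4

end TimeDependentFlow

/-! ### Two-forms and the operator `dd^c` on a vector space -/

section VectorSpaceForms

open Set ContinuousAlternatingMap

variable {E : Type*} [NormedAddCommGroup E] [NormedSpace ℝ E]

variable (E) in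
/-- A two-form as a bilinear map. -/
def bilinCLM : (E [⋀^Fin 2]→L[ℝ] ℝ) →L[ℝ] (E →L[ℝ] E →L[ℝ] ℝ) :=
  (ContinuousLinearMap.compL ℝ E (E [×1]→L[ℝ] ℝ) (E →L[ℝ] ℝ)
    (continuousMultilinearCurryFin1 ℝ E ℝ).toContinuousLinearEquiv.toContinuousLinearMap) ∘L
  (continuousMultilinearCurryLeftEquiv ℝ (fun _ : Fin 2 => E)
    ℝ).toContinuousLinearEquiv.toContinuousLinearMap ∘L
  (ContinuousAlternatingMap.toContinuousMultilinearMapCLM ℝ)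

@[simp] theorem bilinCLM_apply (σ : E [⋀^Fin 2]→L[ℝ] ℝ) (u v : E) :
    bilinCLM E σ u v = σ ![u, v] := by
  simp only [bilinCLM, ContinuousLinearMap.coe_comp, Function.comp_apply,
    ContinuousLinearMap.compL_apply]
  change σ _ = σ _
  congr 1
  ext i
  fin_cases i <;> rfl

theorem map_vec2_swap (σ : E [⋀^Fin 2]→L[ℝ] ℝ) (u v : E) : σ ![u, v] = - σ ![v, u] := by
  have := σ.toAlternatingMap.map_swap ![v, u] (i := 0) (j := 1) (by simp)
  rw [← show (![v, u] ∘ Equiv.swap (0 : Fin 2) 1 : Fin 2 → E) = ![u, v] by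
    ext i; fin_cases i <;> simp]
  exact this

theorem extDeriv_vec3 (σ : E → E [⋀^Fin 2]→L[ℝ] ℝ) (y u v w : E) :
    extDeriv σ y ![u, v, w] = fderiv ℝ σ y u ![v, w] - fderiv ℝ σ y v ![u, w]
      + fderiv ℝ σ y w ![u, v] := by
  rw [extDeriv, alternatizeUncurryFin_apply, Fin.sum_univ_three]
  have h0 : (0 : Fin 3).removeNth ![u, v, w] = ![v, w] := by ext i; fin_cases i <;> rfl
  have h1 : (1 : Fin 3).removeNth ![u, v, w] = ![u, w] := by ext i; fin_cases i <;> rfl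
  have h2 : (2 : Fin 3).removeNth ![u, v, w] = ![u, v] := by ext i; fin_cases i <;> rfl
  rw [h0, h1, h2]
  simp [sub_eq_add_neg]

theorem hasFDerivAt_clm_comp {G V V' : Type*} [NormedAddCommGroup G] [NormedSpace ℝ G]
    [NormedAddCommGroup V] [NormedSpace ℝ V] [NormedAddCommGroup V'] [NormedSpace ℝ V']
    (L : V →L[ℝ] V') {f : G → V} {f' : G →L[ℝ] V} {x : G} (h : HasFDerivAt f f' x) :
    HasFDerivAt (fun x => L (f x)) (L ∘L f') x :=
  L.hasFDerivAt.comp x h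

theorem contDiffAt_clm_comp {G V V' : Type*} [NormedAddCommGroup G] [NormedSpace ℝ G]
    [NormedAddCommGroup V] [NormedSpace ℝ V] [NormedAddCommGroup V'] [NormedSpace ℝ V']
    (L : V →L[ℝ] V') {f : G → V} {x : G} {k : WithTop ℕ∞} (h : ContDiffAt ℝ k f x) :
    ContDiffAt ℝ k (fun x => L (f x)) x :=
  L.contDiff.contDiffAt.comp x h

theorem fderiv_bilinCLM_comp {G : Type*} [NormedAddCommGroup G] [NormedSpace ℝ G]
    {σ : G → E [⋀^Fin 2]→L[ℝ] ℝ} {y : G} (h : DifferentiableAt ℝ σ y) (u : G) (v w : E) :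
    fderiv ℝ (fun y => bilinCLM E (σ y)) y u v w = fderiv ℝ σ y u ![v, w] := by
  have : HasFDerivAt (fun y => bilinCLM E (σ y)) (bilinCLM E ∘L fderiv ℝ σ y) y :=
    hasFDerivAt_clm_comp (V := E [⋀^Fin 2]→L[ℝ] ℝ) (V' := E →L[ℝ] E →L[ℝ] ℝ) (bilinCLM E)
      h.hasFDerivAt
  rw [this.fderiv]
  simp

variable (E) in
/-- Covectors as one-forms. -/
def oneFormLIE : (E →L[ℝ] ℝ) ≃ₗᵢ[ℝ] (E [⋀^Fin 1]→L[ℝ] ℝ) := ofSubsingletonLIE (𝕜 := ℝ) (0 : Fin 1)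

theorem extDeriv_ofSubsingleton_apply {η : E → E →L[ℝ] ℝ} {y : E} (h : DifferentiableAt ℝ η y)
    (u v : E) : extDeriv (fun y => ofSubsingleton ℝ E ℝ (0 : Fin 1) (η y)) y ![u, v]
      = fderiv ℝ η y u v - fderiv ℝ η y v u := by
  have hd : HasFDerivAt (fun y => ofSubsingleton ℝ E ℝ (0 : Fin 1) (η y))
      ((oneFormLIE E).toContinuousLinearEquiv.toContinuousLinearMap ∘L
        fderiv ℝ η y) y :=
    (oneFormLIE E).toContinuousLinearEquiv.hasFDerivAt.comp y h.hasFDerivAt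
  rw [extDeriv, hd.fderiv, alternatizeUncurryFin_apply, Fin.sum_univ_two]
  have key : ∀ (L : E →L[ℝ] ℝ) (x : Fin 1 → E), oneFormLIE E L x = L (x 0) := fun _ _ => rfl
  simp [sub_eq_add_neg, key, Fin.removeNth]

/-- The one-form `d^c f = - df ∘ J`. -/
def dcForm (J : E →L[ℝ] E) (f : E → ℝ) (y : E) : E →L[ℝ] ℝ := -(fderiv ℝ f y ∘L J)

/-- The two-form `dd^c f`. -/
def ddc (J : E →L[ℝ] E) (f : E → ℝ) : E → E [⋀^Fin 2]→L[ℝ] ℝ :=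
  extDeriv fun y => ofSubsingleton ℝ E ℝ (0 : Fin 1) (dcForm J f y)

variable {J : E →L[ℝ] E} {f g : E → ℝ} {y : E}

theorem dcForm_congr (h : f =ᶠ[𝓝 y] g) : dcForm J f =ᶠ[𝓝 y] dcForm J g := by
  filter_upwards [h.fderiv (𝕜 := ℝ)] with z hz
  simp [dcForm, hz]

theorem ddc_congr (h : f =ᶠ[𝓝 y] g) : ddc J f y = ddc J g y :=
  Filter.EventuallyEq.extDeriv_eq ((dcForm_congr h).fun_comp _)

theorem ContDiffAt.dcForm {m k : WithTop ℕ∞} (hf : ContDiffAt ℝ m f y) (h : k + 1 ≤ m) :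
    ContDiffAt ℝ k (dcForm J f) y := by
  have h1 : ContDiffAt ℝ k (fderiv ℝ f) y := hf.fderiv_right h
  exact (h1.clm_comp contDiffAt_const).neg

theorem ContDiffAt.ofSubsingleton_dcForm {m k : WithTop ℕ∞} (hf : ContDiffAt ℝ m f y)
    (h : k + 1 ≤ m) :
    ContDiffAt ℝ k (fun y => ofSubsingleton ℝ E ℝ (0 : Fin 1) (_root_.dcForm J f y)) y :=
  (oneFormLIE E).toContinuousLinearEquiv.contDiff.contDiffAt.comp y
    (hf.dcForm h)

theorem ddc_eq_of_dcForm (hf : ContDiffAt ℝ 2 f y) (u v : E) :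
    ddc J f y ![u, v] = fderiv ℝ (dcForm J f) y u v - fderiv ℝ (dcForm J f) y v u :=
  extDeriv_ofSubsingleton_apply
    ((hf.dcForm (k := 1) (by norm_num)).differentiableAt (by simp)) u v

theorem fderiv_dcForm_apply (hf : ContDiffAt ℝ 2 f y) (u v : E) :
    fderiv ℝ (dcForm J f) y u v = - fderiv ℝ (fderiv ℝ f) y u (J v) := by
  have h1 : DifferentiableAt ℝ (fderiv ℝ f) y :=
    (hf.fderiv_right (m := 1) (by norm_num)).differentiableAt (by simp)
  have h2 : HasFDerivAt (dcForm J f)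
      (-((ContinuousLinearMap.compL ℝ E E ℝ).flip J ∘L fderiv ℝ (fderiv ℝ f) y)) y :=
    (((ContinuousLinearMap.compL ℝ E E ℝ).flip J).hasFDerivAt.comp y h1.hasFDerivAt).neg
  rw [h2.fderiv]
  simp

theorem ddc_apply (hf : ContDiffAt ℝ 2 f y) (u v : E) :
    ddc J f y ![u, v]
      = fderiv ℝ (fderiv ℝ f) y v (J u) - fderiv ℝ (fderiv ℝ f) y u (J v) := by
  rw [ddc_eq_of_dcForm hf, fderiv_dcForm_apply hf, fderiv_dcForm_apply hf]
  ring

/-- By symmetry of the Hessian and `J² = -1`, applying `J` to both arguments merely interchanges the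
two terms of `ddc_apply`. -/
theorem ddc_map_J (hJ : ∀ v, J (J v) = -v) (hf : ContDiffAt ℝ 2 f y) (u v : E) :
    ddc J f y ![J u, J v] = ddc J f y ![u, v] := by
  have hs : IsSymmSndFDerivAt ℝ f y := hf.isSymmSndFDerivAt (by simp)
  rw [ddc_apply hf, ddc_apply hf, hJ, hJ, map_neg, map_neg, hs.eq (J v) u, hs.eq (J u) v]
  ring

theorem ContDiffAt.ddc (hf : ContDiffAt ℝ ∞ f y) : ContDiffAt ℝ ∞ (ddc J f) y := by
  have h1 := (hf.ofSubsingleton_dcForm (J := J) (k := ∞) (by simp)).fderiv_right (m := ∞) (by simp)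
  exact (alternatizeUncurryFinCLM ℝ E ℝ).contDiff.contDiffAt.comp y h1

theorem two_le_infty : (2 : WithTop ℕ∞) ≤ ∞ :=
  WithTop.coe_le_coe.2 (le_top : (2 : ℕ∞) ≤ ⊤)

theorem extDeriv_ddc (hf : ContDiffAt ℝ ∞ f y) : extDeriv (ddc J f) y = 0 :=
  extDeriv_extDeriv_apply (hf.ofSubsingleton_dcForm (J := J) (k := ∞) (by simp))
    (by simpa using two_le_infty)

/-- A map whose differential commutes with the complex structures pulls `d^c f` back to `d^c (f ∘
τ)`, and `d` commutes with pull-back. -/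
theorem ddc_comp {E' : Type*} [NormedAddCommGroup E'] [NormedSpace ℝ E'] {J' : E' →L[ℝ] E'}
    {f : E' → ℝ} {τ : E → E'} {y : E} (hf : ContDiffAt ℝ 2 f (τ y)) (hτ : ContDiffAt ℝ 2 τ y)
    (hJ : ∀ᶠ z in 𝓝 y, ∀ v, fderiv ℝ τ z (J v) = J' (fderiv ℝ τ z v)) :
    ddc J (fun z => f (τ z)) y = (ddc J' f (τ y)).compContinuousLinearMap (fderiv ℝ τ y) := by
  have h1 : (fun z => ofSubsingleton ℝ E ℝ (0 : Fin 1) (dcForm J (fun z => f (τ z)) z)) =ᶠ[𝓝 y]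
      fun z => (ofSubsingleton ℝ E' ℝ (0 : Fin 1) (dcForm J' f (τ z))).compContinuousLinearMap
        (fderiv ℝ τ z) := by
    have hf' := hτ.continuousAt.eventually (hf.eventually (by simp))
    filter_upwards [hf', hτ.eventually (by simp), hJ] with z hfz hτz hJz
    have h2 : HasFDerivAt (fun z => f (τ z)) (fderiv ℝ f (τ z) ∘L fderiv ℝ τ z) z :=
      (hfz.differentiableAt (by simp)).hasFDerivAt.comp z
        (hτz.differentiableAt (by simp)).hasFDerivAt
    ext v
    simp [dcForm, h2.fderiv, hJz]
  rw [ddc, h1.extDeriv_eq]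
  exact extDeriv_pullback ((hf.ofSubsingleton_dcForm (k := 1) (by norm_num)).differentiableAt
    (by simp)) hτ (by simp)

theorem ddc_sub (hf : ContDiffAt ℝ 2 f y) (hg : ContDiffAt ℝ 2 g y) :
    ddc J (fun z => f z - g z) y = ddc J f y - ddc J g y := by
  have h1 : (fun z => ofSubsingleton ℝ E ℝ (0 : Fin 1) (dcForm J (fun z => f z - g z) z)) =ᶠ[𝓝 y]
      (fun z => ofSubsingleton ℝ E ℝ (0 : Fin 1) (dcForm J f z)) -
        fun z => ofSubsingleton ℝ E ℝ (0 : Fin 1) (dcForm J g z) := by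
    filter_upwards [hf.eventually (by simp), hg.eventually (by simp)] with z hfz hgz
    ext v
    simp [dcForm, fderiv_fun_sub (hfz.differentiableAt (by simp)) (hgz.differentiableAt (by simp))]
    ring
  rw [ddc, h1.extDeriv_eq, sub_eq_add_neg, extDeriv_add, ← neg_one_smul ℝ, extDeriv_smul]
  · simp [ddc, sub_eq_add_neg]
  · exact (hf.ofSubsingleton_dcForm (k := 1) (by norm_num)).differentiableAt (by simp)
  · exact ((hg.ofSubsingleton_dcForm (k := 1) (by norm_num)).differentiableAt (by simp)).neg

theorem ddc_const_mul (c : ℝ) (hf : ContDiffAt ℝ 2 f y) :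
    ddc J (fun z => c * f z) y = c • ddc J f y := by
  have h1 : (fun z => ofSubsingleton ℝ E ℝ (0 : Fin 1) (dcForm J (fun z => c * f z) z)) =ᶠ[𝓝 y]
      c • fun z => ofSubsingleton ℝ E ℝ (0 : Fin 1) (dcForm J f z) := by
    filter_upwards [hf.eventually (by simp)] with z hfz
    ext v
    simp [dcForm, fderiv_const_mul (hfz.differentiableAt (by simp))]
  rw [ddc, h1.extDeriv_eq, extDeriv_smul]
  rfl

/-! ### The Moser vector field -/

/-- The vector field `W` with `(a + t b)(W, u) = dp (J u)`. -/
def moserField (J : E →L[ℝ] E) (a b : E → E [⋀^Fin 2]→L[ℝ] ℝ) (p : E → ℝ) (q : ℝ × E) : E :=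
  (bilinCLM E (a q.2 + q.1 • b q.2)).inverse (fderiv ℝ p q.2 ∘L J)

/-- Forms that tame `J`. -/
def IsTame (J : E →L[ℝ] E) (σ : E [⋀^Fin 2]→L[ℝ] ℝ) : Prop := ∀ v, v ≠ 0 → 0 < σ ![v, J v]

/-- A taming form is non-degenerate: if `σ(v, ·) = 0` then `σ(v, Jv) = 0`, so `v = 0`. Equality of
dimensions does the rest. -/
theorem IsTame.isInvertible [FiniteDimensional ℝ E] {σ : E [⋀^Fin 2]→L[ℝ] ℝ} (h : IsTame J σ) :
    (bilinCLM E σ).IsInvertible := by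
  have hinj : Function.Injective (bilinCLM E σ : E →ₗ[ℝ] E →L[ℝ] ℝ) := by
    refine (injective_iff_map_eq_zero _).2 fun v hv => ?_
    by_contra hne
    have h1 := h v hne
    have h2 := congrArg (fun L : E →L[ℝ] ℝ => L (J v)) hv
    simp only [ContinuousLinearMap.coe_coe, bilinCLM_apply] at h2
    rw [h2] at h1
    simp at h1
  have hdim : Module.finrank ℝ E = Module.finrank ℝ (E →L[ℝ] ℝ) := by
    rw [← (LinearMap.toContinuousLinearMap (𝕜 := ℝ) (E := E) (F' := ℝ)).finrank_eq]
    exact (Subspace.dual_finrank_eq (K := ℝ) (V := E)).symm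
  refine ⟨(LinearMap.linearEquivOfInjective _ hinj hdim).toContinuousLinearEquiv, ?_⟩
  ext
  rfl

end VectorSpaceForms

/-! ### The Moser field: gradient estimate, smoothness, invariance of the path of forms -/

section MoserField

open Set ContinuousAlternatingMap

variable {E : Type*} [NormedAddCommGroup E] [NormedSpace ℝ E] {J : E →L[ℝ] E}

theorem IsTame.eq_of_forall {σ : E [⋀^Fin 2]→L[ℝ] ℝ} (h : IsTame J σ) {c c' : E}
    (hc : ∀ u, σ ![c, u] = σ ![c', u]) : c = c' := by
  by_contra hne
  have h1 := h (c - c') (sub_ne_zero.2 hne)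
  rw [← bilinCLM_apply, map_sub, _root_.sub_apply, bilinCLM_apply, bilinCLM_apply,
    hc, sub_self] at h1
  exact lt_irrefl _ h1

theorem IsTame.nonneg {σ : E [⋀^Fin 2]→L[ℝ] ℝ} (h : IsTame J σ) (v : E) : 0 ≤ σ ![v, J v] := by
  rcases eq_or_ne v 0 with rfl | hv
  · rw [← bilinCLM_apply]; simp
  · exact (h v hv).le

/-- Cauchy–Schwarz estimate for the Hamiltonian-type field `W` with `σ(W, u) = l (J u)`. -/
theorem IsTame.sq_le {σ : E [⋀^Fin 2]→L[ℝ] ℝ} (h : IsTame J σ) (hJ : ∀ v, J (J v) = -v)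
    (hinv : ∀ u v, σ ![J u, J v] = σ ![u, v]) {l : E →L[ℝ] ℝ} {W : E}
    (hW : ∀ u, σ ![W, u] = l (J u)) (X : E) : l X ^ 2 ≤ (- l W) * σ ![X, J X] := by
  -- Expand `σ(W + rX, J(W + rX)) ≥ 0` as a quadratic polynomial in `r`; its discriminant is at most
  -- zero.
  have h1 : ∀ r : ℝ, 0 ≤ σ ![X, J X] * (r * r) + (-2 * l X) * r + (- l W) := by
    intro r
    have h2 := h.nonneg (W + r • X)
    have e1 : σ ![W, J W] = - l W := by rw [hW, hJ, map_neg]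
    have e2 : σ ![W, J X] = - l X := by rw [hW, hJ, map_neg]
    have e3 : σ ![X, J W] = - l X := by
      rw [← hinv, hJ, map_vec2_swap, ← bilinCLM_apply, map_neg, _root_.neg_apply,
        bilinCLM_apply, e2, neg_neg]
    rw [← bilinCLM_apply] at h2 e1 e2 e3
    simp only [map_add, map_smul, _root_.add_apply, _root_.smul_apply,
      smul_eq_mul] at h2
    rw [← bilinCLM_apply]
    rw [e1, e2, e3] at h2
    linarith
  have h3 := discrim_le_zero h1
  rw [discrim] at h3
  nlinarith

variable [FiniteDimensional ℝ E] {a b : E → E [⋀^Fin 2]→L[ℝ] ℝ} {p : E → ℝ}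

theorem moserField_spec {t : ℝ} {y : E} (h : IsTame J (a y + t • b y)) (u : E) :
    (a y + t • b y) ![moserField J a b p (t, y), u] = fderiv ℝ p y (J u) := by
  obtain ⟨e, he⟩ := h.isInvertible
  rw [← bilinCLM_apply, moserField]
  simp only
  rw [← he, ContinuousLinearMap.inverse_equiv]
  simp

/-- Non-degeneracy makes the defining equation characterise the field; this is what makes the field
independent of the chart. -/
theorem moserField_eq {t : ℝ} {y : E} (h : IsTame J (a y + t • b y)) {c : E}
    (hc : ∀ u, (a y + t • b y) ![c, u] = fderiv ℝ p y (J u)) : c = moserField J a b p (t, y) :=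
  h.eq_of_forall fun u => by rw [hc, moserField_spec h]

/-- Inversion of linear maps is smooth at invertible ones, and tameness provides invertibility. -/
theorem contDiffAt_moserField {t : ℝ} {y : E} (h : IsTame J (a y + t • b y))
    (ha : ContDiffAt ℝ ∞ a y) (hb : ContDiffAt ℝ ∞ b y) (hp : ContDiffAt ℝ ∞ p y) :
    ContDiffAt ℝ ∞ (moserField J a b p) (t, y) := by
  obtain ⟨e, he⟩ := h.isInvertible
  have h0 : ContDiffAt ℝ ∞ (fun q : ℝ × E => a q.2 + q.1 • b q.2) (t, y) :=
    (ContDiffAt.comp (g := a) (t, y) ha contDiffAt_snd).add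
      (contDiffAt_fst.smul (ContDiffAt.comp (g := b) (t, y) hb contDiffAt_snd))
  have h1 := contDiffAt_clm_comp (V' := E →L[ℝ] E →L[ℝ] ℝ) (bilinCLM E) h0
  have h2 : ContDiffAt ℝ ∞ ContinuousLinearMap.inverse (bilinCLM E (a y + t • b y)) := by
    rw [← he]; exact contDiffAt_map_inverse e
  have h3 := ContDiffAt.comp (g := ContinuousLinearMap.inverse (R := ℝ) (M := E) (M₂ := E →L[ℝ] ℝ))
    (t, y) h2 h1
  have h4 : ContDiffAt ℝ ∞ (fun q : ℝ × E => fderiv ℝ p q.2 ∘L J) (t, y) :=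
    (ContDiffAt.comp (g := fderiv ℝ p) (t, y) (hp.fderiv_right (m := ∞) (by simp))
      contDiffAt_snd).clm_comp contDiffAt_const
  exact h3.clm_apply h4

/-- The flow of the Moser field preserves the forms `a + t b`. -/
theorem hasDerivAt_pullback_moserField {I : Set ℝ} {O : Set E} (hO : IsOpen O)
    (ha : ContDiffOn ℝ ∞ a O) (hb : ContDiffOn ℝ ∞ b O) (hp : ContDiffOn ℝ ∞ p O)
    (hac : ∀ y ∈ O, extDeriv a y = 0) (hbp : ∀ y ∈ O, b y = ddc J p y)
    (htame : ∀ t ∈ I, ∀ y ∈ O, IsTame J (a y + t • b y))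
    {φ : ℝ × E → E} {t : ℝ} {y : E} (ht : t ∈ I) (hy : φ (t, y) ∈ O)
    (hφ : ContDiffAt ℝ 2 φ (t, y))
    (hφW : ∀ᶠ q in 𝓝 (t, y),
      HasDerivAt (fun t => φ (t, q.2)) (moserField J a b p (q.1, φ q)) q.1) (u v : E) :
    HasDerivAt (fun t => (a (φ (t, y)) + t • b (φ (t, y)))
      ![fderiv ℝ (fun y => φ (t, y)) y u, fderiv ℝ (fun y => φ (t, y)) y v]) 0 t := by
  have hOn := hO.mem_nhds hy
  have ha' := ha.contDiffAt hOn
  have hb' := hb.contDiffAt hOn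
  have hp' := hp.contDiffAt hOn
  have had := ha'.differentiableAt (by simp)
  have hbd := hb'.differentiableAt (by simp)
  have hbE : b =ᶠ[𝓝 (φ (t, y))] ddc J p := Filter.eventually_of_mem hOn hbp
  have hcl : ∀ σ : E → E [⋀^Fin 2]→L[ℝ] ℝ, DifferentiableAt ℝ σ (φ (t, y)) →
      extDeriv σ (φ (t, y)) = 0 → ∀ u v w,
        fderiv ℝ (fun y => bilinCLM E (σ y)) (φ (t, y)) u v w
        - fderiv ℝ (fun y => bilinCLM E (σ y)) (φ (t, y)) v u w
        + fderiv ℝ (fun y => bilinCLM E (σ y)) (φ (t, y)) w u v = 0 := by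
    intro σ hσ h0 u v w
    rw [fderiv_bilinCLM_comp hσ, fderiv_bilinCLM_comp hσ, fderiv_bilinCLM_comp hσ,
      ← extDeriv_vec3, h0]
    rfl
  have hp2 : ContDiffAt ℝ 2 p (φ (t, y)) := hp'.of_le two_le_infty
  have key := hasDerivAt_moser_pullback (A := fun y => bilinCLM E (a y))
    (B := fun y => bilinCLM E (b y)) (η := dcForm J p) (W := moserField J a b p) (φ := φ) (t := t)
    (y := y) hφ hφW
    (hasFDerivAt_clm_comp (V' := E →L[ℝ] E →L[ℝ] ℝ) (bilinCLM E) had.hasFDerivAt).differentiableAt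
    (hasFDerivAt_clm_comp (V' := E →L[ℝ] E →L[ℝ] ℝ) (bilinCLM E) hbd.hasFDerivAt).differentiableAt
    ((hp'.dcForm (k := ∞) (by simp)).differentiableAt (by simp))
    ((contDiffAt_moserField (htame t ht _ hy) ha' hb' hp').differentiableAt (by simp))
    (fun z u v => by simp only [bilinCLM_apply]; exact map_vec2_swap _ _ _)
    (fun z u v => by simp only [bilinCLM_apply]; exact map_vec2_swap _ _ _)
    (hcl a had (hac _ hy))
    (hcl b hbd (by rw [hbE.extDeriv_eq]; exact extDeriv_ddc hp'))
    (fun u v => by rw [bilinCLM_apply, hbp _ hy, ddc_eq_of_dcForm hp2])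
    (by
      filter_upwards [hOn] with z hz v
      have := moserField_spec (p := p) (htame t ht z hz) v
      rw [← bilinCLM_apply, map_add, map_smul] at this
      rw [this]
      simp [dcForm]) u v
  refine key.congr_of_eventuallyEq (Filter.Eventually.of_forall fun t => ?_)
  simp

end MoserField

/-! ### Pluriharmonicity of the logarithm of a coordinate -/

section CoordinateLogarithm

variable {n : ℕ}

/-- Multiplication by `i` on `ℂⁿ`. -/
def stdJ (n : ℕ) : CSpace n →L[ℝ] CSpace n := Complex.I • ContinuousLinearMap.id ℝ (CSpace n)

@[simp] theorem stdJ_apply (v : CSpace n) : stdJ n v = Complex.I • v := rfl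

theorem stdJ_stdJ (v : CSpace n) : stdJ n (stdJ n v) = -v := by
  simp [smul_smul]

/-- On the slit plane `log |z|` is the real part of the principal logarithm. Elsewhere `-z` lies in
the slit plane, and the norm does not see the sign. -/
theorem hasFDerivAt_log_norm {z : ℂ} (hz : z ≠ 0) :
    HasFDerivAt (fun z : ℂ => Real.log ‖z‖) (Complex.reCLM ∘L
      ((1 : ℂ →L[ℂ] ℂ).smulRight z⁻¹).restrictScalars ℝ) z := by
  have main : ∀ w : ℂ, w ∈ Complex.slitPlane → HasFDerivAt (fun z : ℂ => Real.log ‖z‖)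
      (Complex.reCLM ∘L ((1 : ℂ →L[ℂ] ℂ).smulRight w⁻¹).restrictScalars ℝ) w := by
    intro w hw
    have h1 := (Complex.hasDerivAt_log hw).hasFDerivAt.restrictScalars ℝ
    have h2 := Complex.reCLM.hasFDerivAt.comp w h1
    refine (h2.congr_of_eventuallyEq ?_)
    exact Filter.Eventually.of_forall fun z => (Complex.log_re z).symm
  by_cases hw : z ∈ Complex.slitPlane
  · exact main z hw
  · have hw' : -z ∈ Complex.slitPlane := by
      rw [Complex.mem_slitPlane_iff, not_or, not_lt, not_not] at hw
      rw [Complex.mem_slitPlane_iff, Complex.neg_re, neg_pos]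
      refine Or.inl (lt_of_le_of_ne hw.1 fun h => hz (Complex.ext h hw.2))
    have h1 := (main (-z) hw').comp z (hasFDerivAt_id z).neg
    have h2 : (fun z : ℂ => Real.log ‖z‖) = (fun z : ℂ => Real.log ‖z‖) ∘ (-id) := by
      funext z; simp
    rw [h2]
    refine h1.congr_fderiv ?_
    ext v
    simp [inv_neg]

/-- The coordinate projection as a real linear map. -/
def coordCLM (n : ℕ) (k : Fin n) : CSpace n →L[ℝ] ℂ :=
  (EuclideanSpace.proj (𝕜 := ℂ) k : CSpace n →L[ℂ] ℂ).restrictScalars ℝ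

@[simp] theorem coordCLM_apply (k : Fin n) (v : CSpace n) : coordCLM n k v = v k := rfl

theorem fderiv_log_coord {k : Fin n} {y : CSpace n} (hy : y k ≠ 0) (u : CSpace n) :
    fderiv ℝ (fun y : CSpace n => Real.log ‖y k‖) y u = (u k * (y k)⁻¹).re := by
  have h := (hasFDerivAt_log_norm hy).comp y (coordCLM n k).hasFDerivAt
  rw [show (fun y : CSpace n => Real.log ‖y k‖) = (fun z : ℂ => Real.log ‖z‖) ∘ coordCLM n k from
    rfl, h.fderiv]
  simp

theorem contDiffAt_log_coord {k : Fin n} {y : CSpace n} (hy : y k ≠ 0) :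
    ContDiffAt ℝ ∞ (fun y : CSpace n => Real.log ‖y k‖) y :=
  ((coordCLM n k).contDiff.contDiffAt.norm ℝ hy).log (norm_ne_zero_iff.2 hy)

/-- Here `d^c log |y_k|` sends `v` to `Im (v_k / y_k)`. Its derivative in the direction `u` is `-Im
(v_k u_k / y_k²)`, symmetric in `u` and `v`, so the exterior derivative vanishes. -/
theorem ddc_log_coord {k : Fin n} {y : CSpace n} (hy : y k ≠ 0) :
    ddc (stdJ n) (fun y : CSpace n => Real.log ‖y k‖) y = 0 := by
  have hs := (contDiffAt_log_coord hy).of_le two_le_infty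
  have hev : ∀ᶠ z : CSpace n in 𝓝 y, z k ≠ 0 :=
    (coordCLM n k).continuous.continuousAt.eventually_ne hy
  have hd : ∀ u v : CSpace n,
      fderiv ℝ (dcForm (stdJ n) (fun y : CSpace n => Real.log ‖y k‖)) y u v
        = -(v k * u k * ((y k)⁻¹ ^ 2)).im := by
    intro u v
    have h1 : DifferentiableAt ℝ (dcForm (stdJ n) (fun y : CSpace n => Real.log ‖y k‖)) y :=
      (hs.dcForm (k := 1) (by norm_num)).differentiableAt (by simp)
    have h2 : HasFDerivAt (fun z => dcForm (stdJ n) (fun y : CSpace n => Real.log ‖y k‖) z v)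
        ((fderiv ℝ (dcForm (stdJ n) (fun y : CSpace n => Real.log ‖y k‖)) y).flip v) y := by
      simpa using h1.hasFDerivAt.clm_apply (hasFDerivAt_const v y)
    have h3 : (fun z => dcForm (stdJ n) (fun y : CSpace n => Real.log ‖y k‖) z v) =ᶠ[𝓝 y]
        fun z => (v k * (z k)⁻¹).im := by
      filter_upwards [hev] with z hz
      simp only [dcForm, _root_.neg_apply, ContinuousLinearMap.comp_apply]
      rw [fderiv_log_coord hz]
      simp [mul_assoc]
    have h4 : HasFDerivAt (fun z : CSpace n => (v k * (z k)⁻¹).im)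
        (Complex.imCLM ∘L ((v k • (1 : ℂ →L[ℂ] ℂ).smulRight (-(y k ^ 2)⁻¹)).restrictScalars ℝ ∘L
          coordCLM n k)) y := by
      have h5 : HasFDerivAt (fun z : ℂ => v k * z⁻¹)
          (v k • (1 : ℂ →L[ℂ] ℂ).smulRight (-(y k ^ 2)⁻¹)) (y k) :=
        (hasDerivAt_inv hy).hasFDerivAt.const_mul (v k)
      exact Complex.imCLM.hasFDerivAt.comp y
        ((h5.restrictScalars ℝ).comp y (coordCLM n k).hasFDerivAt)
    have h6 := congrArg (fun L => L u) ((h2.congr_of_eventuallyEq h3.symm).unique h4)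
    simp only [ContinuousLinearMap.flip_apply] at h6
    rw [h6]
    simp only [ContinuousLinearMap.comp_apply, ContinuousLinearMap.coe_restrictScalars',
      coordCLM_apply, _root_.smul_apply, ContinuousLinearMap.smulRight_apply,
      one_apply_eq_self, smul_eq_mul, Complex.imCLM_apply]
    rw [← Complex.neg_im]
    congr 1
    ring
  ext x
  have hx : x = ![x 0, x 1] := by ext i; fin_cases i <;> rfl
  rw [hx, ddc_eq_of_dcForm hs, hd, hd, mul_comm (x 1 k)]
  simp

end CoordinateLogarithm

/-! ### Restriction of scalars from `ℂ` to `ℝ` on manifolds -/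

section RestrictScalars

variable {E F : Type*} [NormedAddCommGroup E] [NormedSpace ℂ E] [NormedSpace ℝ E]
  [IsScalarTower ℝ ℂ E] [NormedAddCommGroup F] [NormedSpace ℂ F] [NormedSpace ℝ F]
  [IsScalarTower ℝ ℂ F] {X Y : Type*} [TopologicalSpace X] [ChartedSpace E X]
  [TopologicalSpace Y] [ChartedSpace F Y] {f : X → Y} {x : X}

theorem ContMDiffAt.restrictScalars_real {m : WithTop ℕ∞}
    (h : ContMDiffAt 𝓘(ℂ, E) 𝓘(ℂ, F) m f x) : ContMDiffAt 𝓘(ℝ, E) 𝓘(ℝ, F) m f x := by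
  rw [contMDiffAt_iff] at h ⊢
  exact ⟨h.1, h.2.restrict_scalars ℝ⟩

/-- The real differential of a map between manifolds, as a map between the model spaces. -/
def realDeriv (E F : Type*) [NormedAddCommGroup E] [NormedSpace ℝ E] [NormedAddCommGroup F]
    [NormedSpace ℝ F] {X Y : Type*} [TopologicalSpace X] [ChartedSpace E X]
    [TopologicalSpace Y] [ChartedSpace F Y] (f : X → Y) (x : X) : E →L[ℝ] F :=
  mfderiv 𝓘(ℝ, E) 𝓘(ℝ, F) f x

theorem MDifferentiableAt.realDeriv_smul (h : MDifferentiableAt 𝓘(ℂ, E) 𝓘(ℂ, F) f x)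
    (c : ℂ) (v : E) : realDeriv E F f x (c • v) = c • realDeriv E F f x v := by
  obtain ⟨f', hf'⟩ : ∃ f' : E →L[ℂ] F, HasMFDerivAt 𝓘(ℂ, E) 𝓘(ℂ, F) f x f' :=
    ⟨_, h.hasMFDerivAt⟩
  have h1 : HasMFDerivAt 𝓘(ℝ, E) 𝓘(ℝ, F) f x (f'.restrictScalars ℝ : E →L[ℝ] F) :=
    ⟨hf'.1, HasFDerivWithinAt.restrictScalars ℝ (f' := f') hf'.2⟩
  have h2 : realDeriv E F f x = f'.restrictScalars ℝ := h1.mfderiv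
  rw [h2]
  exact f'.map_smul c v

end RestrictScalars

/-! ### Holomorphic charts -/

section HolomorphicCharts

open Set

variable {n : ℕ} {X : Type*} [TopologicalSpace X] [ChartedSpace (CSpace n) X]

variable (n X) in
/-- The holomorphic charts of a complex manifold. -/
abbrev holAtlas : Set (OpenPartialHomeomorph X (CSpace n)) :=
  IsManifold.maximalAtlas 𝓘(ℂ, CSpace n) ω X

variable {e e' : OpenPartialHomeomorph X (CSpace n)}

theorem contMDiffAt_holChart (he : e ∈ holAtlas n X) {x : X} (hx : x ∈ e.source) :
    ContMDiffAt 𝓘(ℝ, CSpace n) 𝓘(ℝ, CSpace n) ∞ e x :=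
  (contMDiffAt_of_mem_maximalAtlas he hx).restrictScalars_real.of_le le_top

theorem contMDiffAt_holChart_symm (he : e ∈ holAtlas n X) {y : CSpace n} (hy : y ∈ e.target) :
    ContMDiffAt 𝓘(ℝ, CSpace n) 𝓘(ℝ, CSpace n) ∞ e.symm y :=
  (contMDiffAt_symm_of_mem_maximalAtlas he hy).restrictScalars_real.of_le le_top

theorem mfderiv_holChart_symm_smul (he : e ∈ holAtlas n X) {y : CSpace n} (hy : y ∈ e.target)
    (c : ℂ) (v : CSpace n) :
    realDeriv (CSpace n) (CSpace n) e.symm y (c • v)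
      = c • realDeriv (CSpace n) (CSpace n) e.symm y v :=
  ((contMDiffAt_symm_of_mem_maximalAtlas he hy).mdifferentiableAt
    (by simp)).realDeriv_smul c v

theorem isOpen_transition_source {X : Type*} [TopologicalSpace X]
    (e e' : OpenPartialHomeomorph X (CSpace n)) :
    IsOpen (e.symm.trans e').source := (e.symm.trans e').open_source

theorem mem_transition_source {X : Type*} [TopologicalSpace X]
    {e e' : OpenPartialHomeomorph X (CSpace n)} {y : CSpace n} :
    y ∈ (e.symm.trans e').source ↔ y ∈ e.target ∧ e.symm y ∈ e'.source := by
  simp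

theorem contMDiffAt_transition (he : e ∈ holAtlas n X) (he' : e' ∈ holAtlas n X) {y : CSpace n}
    (hy : y ∈ e.target) (hy' : e.symm y ∈ e'.source) :
    ContMDiffAt 𝓘(ℂ, CSpace n) 𝓘(ℂ, CSpace n) ω (fun y => e' (e.symm y)) y :=
  (contMDiffAt_of_mem_maximalAtlas he' hy').comp y (contMDiffAt_symm_of_mem_maximalAtlas he hy)

theorem contDiffAt_transition (he : e ∈ holAtlas n X) (he' : e' ∈ holAtlas n X) {y : CSpace n}
    (hy : y ∈ e.target) (hy' : e.symm y ∈ e'.source) :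
    ContDiffAt ℝ ∞ (fun y => e' (e.symm y)) y :=
  ((contMDiffAt_transition he he' hy hy').restrictScalars_real.of_le le_top).contDiffAt

theorem fderiv_transition_stdJ (he : e ∈ holAtlas n X) (he' : e' ∈ holAtlas n X) {y : CSpace n}
    (hy : y ∈ e.target) (hy' : e.symm y ∈ e'.source) (v : CSpace n) :
    fderiv ℝ (fun y => e' (e.symm y)) y (stdJ n v)
      = stdJ n (fderiv ℝ (fun y => e' (e.symm y)) y v) := by
  have h := ((contMDiffAt_transition he he' hy hy').mdifferentiableAt
    (by simp)).realDeriv_smul Complex.I v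
  have h2 : realDeriv (CSpace n) (CSpace n) (fun y => e' (e.symm y)) y
      = fderiv ℝ (fun y => e' (e.symm y)) y := mfderiv_eq_fderiv
  rwa [h2] at h

/-- Chain rule for changes of holomorphic charts. -/
theorem mfderiv_symm_eq_comp (he : e ∈ holAtlas n X) (he' : e' ∈ holAtlas n X) {y : CSpace n}
    (hy : y ∈ e.target) (hy' : e.symm y ∈ e'.source) (v : CSpace n) :
    realDeriv (CSpace n) (CSpace n) e.symm y v
      = realDeriv (CSpace n) (CSpace n) e'.symm (e' (e.symm y))
        (fderiv ℝ (fun y => e' (e.symm y)) y v) := by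
  have hτ := contDiffAt_transition he he' hy hy'
  have h1 : HasMFDerivAt 𝓘(ℝ, CSpace n) 𝓘(ℝ, CSpace n) (fun y => e' (e.symm y)) y
      (fderiv ℝ (fun y => e' (e.symm y)) y) :=
    (hτ.differentiableAt (by simp)).hasFDerivAt.hasMFDerivAt
  have h2 := ((contMDiffAt_holChart_symm he' (e'.map_source hy')).mdifferentiableAt
    (by simp)).hasMFDerivAt
  have h3 := HasMFDerivAt.comp y h2 h1
  have h4 : (e'.symm ∘ fun y => e' (e.symm y)) =ᶠ[𝓝 y] e.symm := by
    filter_upwards [(isOpen_transition_source e e').mem_nhds (mem_transition_source.2 ⟨hy, hy'⟩)]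
      with z hz
    exact e'.left_inv (mem_transition_source.1 hz).2
  have h5 : realDeriv (CSpace n) (CSpace n) e.symm y
      = realDeriv (CSpace n) (CSpace n) e'.symm (e' (e.symm y)) ∘L
        fderiv ℝ (fun y => e' (e.symm y)) y := (h3.congr_of_eventuallyEq h4.symm).mfderiv
  rw [h5]
  rfl

namespace TwoForm

theorem inChart_apply (Ω : TwoForm n X) (e : OpenPartialHomeomorph X (CSpace n)) (y : CSpace n)
    (u v : CSpace n) : Ω.inChart e y ![u, v] = Ω (e.symm y)
      ![realDeriv (CSpace n) (CSpace n) e.symm y u,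
        realDeriv (CSpace n) (CSpace n) e.symm y v] := by
  rw [inChart]
  change Ω (e.symm y) _ = Ω (e.symm y) _
  congr 1
  ext i : 1
  fin_cases i <;> rfl

theorem inChart_transition (Ω : TwoForm n X) (he : e ∈ holAtlas n X) (he' : e' ∈ holAtlas n X)
    {y : CSpace n} (hy : y ∈ e.target) (hy' : e.symm y ∈ e'.source) (u v : CSpace n) :
    Ω.inChart e y ![u, v] = Ω.inChart e' (e' (e.symm y))
      ![fderiv ℝ (fun y => e' (e.symm y)) y u, fderiv ℝ (fun y => e' (e.symm y)) y v] := by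
  rw [inChart_apply, inChart_apply]
  rw [mfderiv_symm_eq_comp he he' hy hy' u, mfderiv_symm_eq_comp he he' hy hy' v]
  rw [e'.left_inv hy']

end TwoForm

theorem contDiffAt_comp_symm {f : X → ℝ} (he : e ∈ holAtlas n X) {y : CSpace n}
    (hy : y ∈ e.target) (hf : ContMDiffAt 𝓘(ℝ, CSpace n) 𝓘(ℝ) ∞ f (e.symm y)) :
    ContDiffAt ℝ ∞ (fun y => f (e.symm y)) y :=
  (hf.comp y (contMDiffAt_holChart_symm he hy)).contDiffAt

variable [IsManifold 𝓘(ℂ, CSpace n) ω X]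

variable (n X) in
theorem isManifold_real : IsManifold 𝓘(ℝ, CSpace n) ∞ X := by
  refine isManifold_of_contDiffOn _ _ _ fun e e' he he' => ?_
  intro y hy
  have hy0 : y ∈ (e.symm.trans e').source := by simpa using hy
  obtain ⟨h1, h2⟩ := mem_transition_source.1 hy0
  exact (contDiffAt_transition (IsManifold.subset_maximalAtlas he)
    (IsManifold.subset_maximalAtlas he') h1 h2).contDiffWithinAt

end HolomorphicCharts

/-! ### Kähler forms and `dd^c` in holomorphic charts -/

section KaehlerCharts

open Set

variable {n : ℕ} {X : Type*} [TopologicalSpace X] [ChartedSpace (CSpace n) X]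
  {e e' : OpenPartialHomeomorph X (CSpace n)}

theorem realDeriv_apply_symm (he : e ∈ holAtlas n X) {y : CSpace n} (hy : y ∈ e.target)
    (v : CSpace n) : realDeriv (CSpace n) (CSpace n) e (e.symm y)
      (realDeriv (CSpace n) (CSpace n) e.symm y v) = v := by
  have h1 := ((contMDiffAt_holChart_symm he hy).mdifferentiableAt (by simp)).hasMFDerivAt
  have h2 := ((contMDiffAt_holChart he (e.map_target hy)).mdifferentiableAt
    (by simp)).hasMFDerivAt
  have h3 := HasMFDerivAt.comp y h2 h1
  have h4 : (e ∘ e.symm) =ᶠ[𝓝 y] id := by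
    filter_upwards [e.open_target.mem_nhds hy] with z hz
    exact e.right_inv hz
  have h5 : realDeriv (CSpace n) (CSpace n) e (e.symm y) ∘L
      realDeriv (CSpace n) (CSpace n) e.symm y = ContinuousLinearMap.id ℝ (CSpace n) :=
    hasMFDerivAt_unique (h3.congr_of_eventuallyEq h4.symm) (hasMFDerivAt_id y)
  exact congrArg (fun L => L v) h5

theorem realDeriv_symm_apply (he : e ∈ holAtlas n X) {x : X} (hx : x ∈ e.source)
    (v : CSpace n) : realDeriv (CSpace n) (CSpace n) e.symm (e x)
      (realDeriv (CSpace n) (CSpace n) e x v) = v := by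
  have h1 := ((contMDiffAt_holChart_symm he (e.map_source hx)).mdifferentiableAt
    (by simp)).hasMFDerivAt
  have h2 := ((contMDiffAt_holChart he hx).mdifferentiableAt (by simp)).hasMFDerivAt
  have h3 := HasMFDerivAt.comp x h1 h2
  have h4 : (e.symm ∘ e) =ᶠ[𝓝 x] id := by
    filter_upwards [e.open_source.mem_nhds hx] with z hz
    exact e.left_inv hz
  have h5 : realDeriv (CSpace n) (CSpace n) e.symm (e x) ∘L
      realDeriv (CSpace n) (CSpace n) e x = ContinuousLinearMap.id ℝ (CSpace n) :=
    hasMFDerivAt_unique (h3.congr_of_eventuallyEq h4.symm) (hasMFDerivAt_id x)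
  exact congrArg (fun L => L v) h5

theorem realDeriv_apply_comp_symm (he : e ∈ holAtlas n X) (he' : e' ∈ holAtlas n X)
    {y : CSpace n} (hy : y ∈ e.target) (hy' : e.symm y ∈ e'.source) (v : CSpace n) :
    realDeriv (CSpace n) (CSpace n) e' (e.symm y) (realDeriv (CSpace n) (CSpace n) e.symm y v)
      = fderiv ℝ (fun y => e' (e.symm y)) y v := by
  have h := realDeriv_apply_symm he' (e'.map_source hy') (fderiv ℝ (fun y => e' (e.symm y)) y v)
  rw [← mfderiv_symm_eq_comp he he' hy hy', e'.left_inv hy'] at h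
  exact h

/-- `ddc` of a function is compatible with changes of holomorphic charts. -/
theorem ddc_transition (he : e ∈ holAtlas n X) (he' : e' ∈ holAtlas n X) {f : X → ℝ}
    {y : CSpace n} (hy : y ∈ e.target) (hy' : e.symm y ∈ e'.source)
    (hf : ContMDiffAt 𝓘(ℝ, CSpace n) 𝓘(ℝ) ∞ f (e.symm y)) :
    ddc (stdJ n) (fun y => f (e.symm y)) y
      = (ddc (stdJ n) (fun y => f (e'.symm y)) (e' (e.symm y))).compContinuousLinearMap
        (fderiv ℝ (fun y => e' (e.symm y)) y) := by
  have hev := (isOpen_transition_source e e').mem_nhds (mem_transition_source.2 ⟨hy, hy'⟩)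
  have hf' : ContDiffAt ℝ ∞ (fun y => f (e'.symm y)) (e' (e.symm y)) :=
    contDiffAt_comp_symm he' (e'.map_source hy') (by rwa [e'.left_inv hy'])
  rw [← ddc_comp (τ := fun y => e' (e.symm y)) (hf'.of_le two_le_infty)
    ((contDiffAt_transition he he' hy hy').of_le two_le_infty)]
  · refine ddc_congr ?_
    filter_upwards [hev] with z hz
    rw [e'.left_inv (mem_transition_source.1 hz).2]
  · filter_upwards [hev] with z hz v
    obtain ⟨h1, h2⟩ := mem_transition_source.1 hz
    exact fderiv_transition_stdJ he he' h1 h2 v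

theorem compContinuousLinearMap_vec2 {E F : Type*} [NormedAddCommGroup E] [NormedSpace ℝ E]
    [NormedAddCommGroup F] [NormedSpace ℝ F] (σ : F [⋀^Fin 2]→L[ℝ] ℝ) (L : E →L[ℝ] F) (u v : E) :
    σ.compContinuousLinearMap L ![u, v] = σ ![L u, L v] := by
  change σ _ = σ _
  congr 1
  ext i : 1
  fin_cases i <;> rfl

theorem alternating_ext_vec2 {E : Type*} [NormedAddCommGroup E] [NormedSpace ℝ E]
    {σ σ' : E [⋀^Fin 2]→L[ℝ] ℝ} (h : ∀ u v, σ ![u, v] = σ' ![u, v]) : σ = σ' := by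
  ext x
  have hx : x = ![x 0, x 1] := by ext i : 1; fin_cases i <;> rfl
  rw [hx, h]

/-- A function with, near every point, a smooth function with the same `dd^c` off `D`. -/
def HasLocalPotentials (D : Set X) (P : X → ℝ) : Prop :=
  ∀ q : X, ∃ W : Set X, IsOpen W ∧ q ∈ W ∧ ∃ f : X → ℝ,
    ContMDiffOn 𝓘(ℝ, CSpace n) 𝓘(ℝ) ∞ f W ∧ ∀ e ∈ holAtlas n X, ∀ y ∈ e.target,
      e.symm y ∈ W → e.symm y ∉ D →
        ddc (stdJ n) (fun y => P (e.symm y)) y = ddc (stdJ n) (fun y => f (e.symm y)) y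

/-- Both sides are continuous near `y`, and the points outside `D` are dense. Hence two local
potentials that agree modulo the kernel of `dd^c` off `D` define the same form on `D` too. -/
theorem ddc_eq_of_dense {D : Set X} (hD : Dense Dᶜ) (he : e ∈ holAtlas n X) {f g : X → ℝ}
    {W : Set X} (hW : IsOpen W) (hf : ContMDiffOn 𝓘(ℝ, CSpace n) 𝓘(ℝ) ∞ f W)
    (hg : ContMDiffOn 𝓘(ℝ, CSpace n) 𝓘(ℝ) ∞ g W)
    (h : ∀ y ∈ e.target, e.symm y ∈ W → e.symm y ∉ D →
      ddc (stdJ n) (fun y => f (e.symm y)) y = ddc (stdJ n) (fun y => g (e.symm y)) y)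
    {y : CSpace n} (hy : y ∈ e.target) (hyW : e.symm y ∈ W) :
    ddc (stdJ n) (fun y => f (e.symm y)) y = ddc (stdJ n) (fun y => g (e.symm y)) y := by
  have hc := e.continuousAt_symm hy
  have hne : ∃ᶠ z in 𝓝 y, e.symm z ∉ D := by
    rw [Filter.frequently_iff]
    intro V hV
    have hV' : e.symm '' (V ∩ e.target) ∈ 𝓝 (e.symm y) := by
      rw [← e.symm.map_nhds_eq (by simpa using hy)]
      exact Filter.image_mem_map (Filter.inter_mem hV (e.open_target.mem_nhds hy))
    obtain ⟨x, ⟨z, hz, rfl⟩, hxD⟩ := mem_closure_iff_nhds.1 (hD (e.symm y)) _ hV'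
    exact ⟨z, hz.1, hxD⟩
  have hsm : ∀ f : X → ℝ, ContMDiffOn 𝓘(ℝ, CSpace n) 𝓘(ℝ) ∞ f W →
      ContinuousAt (ddc (stdJ n) (fun y => f (e.symm y))) y := fun f hf =>
    (contDiffAt_comp_symm he hy (hf.contMDiffAt (hW.mem_nhds hyW))).ddc.continuousAt
  have hev : ∀ᶠ z in 𝓝 y, z ∈ e.target ∧ e.symm z ∈ W :=
    Filter.Eventually.and (e.open_target.mem_nhds hy) (hc.eventually (hW.mem_nhds hyW))
  have : (𝓝 y ⊓ Filter.principal {z | e.symm z ∉ D}).NeBot :=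
    Filter.frequently_mem_iff_neBot.1 hne
  refine tendsto_nhds_unique_of_eventuallyEq (l := 𝓝 y ⊓ Filter.principal {z | e.symm z ∉ D})
    ((hsm f hf).tendsto.mono_left inf_le_left) ((hsm g hg).tendsto.mono_left inf_le_left) ?_
  have h2 : ∀ᶠ z in 𝓝 y ⊓ Filter.principal {z | e.symm z ∉ D}, z ∈ {z | e.symm z ∉ D} :=
    Filter.mem_inf_of_right (Filter.mem_principal_self _)
  filter_upwards [Filter.Eventually.filter_mono inf_le_left hev, h2] with z hz hzD
  exact h z hz.1 hz.2 hzD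

/-- Forms that are locally `dd^c` of smooth functions. -/
def TwoForm.IsLocallyDdc (β : TwoForm n X) : Prop :=
  ∀ q : X, ∃ W : Set X, IsOpen W ∧ q ∈ W ∧ ∃ f : X → ℝ,
    ContMDiffOn 𝓘(ℝ, CSpace n) 𝓘(ℝ) ∞ f W ∧ ∀ e ∈ holAtlas n X, ∀ y ∈ e.target,
      e.symm y ∈ W → β.inChart e y = ddc (stdJ n) (fun y => f (e.symm y)) y

/-- The form `dd^c P`, extended over `D` with the help of local potentials. -/
theorem exists_ddc_form [IsManifold 𝓘(ℂ, CSpace n) ω X] {D : Set X} (hD : Dense Dᶜ) {P : X → ℝ}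
    (hP : HasLocalPotentials (n := n) D P) :
    ∃ β : TwoForm n X, β.IsLocallyDdc ∧
      ∀ e ∈ holAtlas n X, ∀ y ∈ e.target, e.symm y ∉ D →
        β.inChart e y = ddc (stdJ n) (fun y => P (e.symm y)) y := by
  choose W hWo hqW f hf hfP using hP
  let c : X → OpenPartialHomeomorph X (CSpace n) := fun x => chartAt (CSpace n) x
  have hcm : ∀ x, c x ∈ holAtlas n X := fun x => IsManifold.chart_mem_maximalAtlas x
  have hcs : ∀ x, x ∈ (c x).source := fun x => mem_chart_source _ x
  -- At each point the form is computed from the chosen potential and the preferred chart there;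
  -- `hβ0` removes the dependence on the chart and `hβ` that on the potential.
  let β : TwoForm n X := fun x =>
    ((ddc (stdJ n) (fun y => f x ((c x).symm y)) (c x x)).compContinuousLinearMap
      (realDeriv (CSpace n) (CSpace n) (c x) x) : (CSpace n) [⋀^Fin 2]→L[ℝ] ℝ)
  have hβ0 : ∀ e ∈ holAtlas n X, ∀ y ∈ e.target,
      β.inChart e y = ddc (stdJ n) (fun z => f (e.symm y) (e.symm z)) y := by
    intro e he y hy
    refine alternating_ext_vec2 fun u v => ?_
    rw [TwoForm.inChart_apply, ddc_transition he (hcm (e.symm y)) hy (hcs _)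
      ((hf _).contMDiffAt ((hWo _).mem_nhds (hqW _))), compContinuousLinearMap_vec2,
      ← realDeriv_apply_comp_symm he (hcm _) hy (hcs _),
      ← realDeriv_apply_comp_symm he (hcm _) hy (hcs _)]
    exact compContinuousLinearMap_vec2 _ _ _ _
  have hβ : ∀ q : X, ∀ e ∈ holAtlas n X, ∀ y ∈ e.target, e.symm y ∈ W q →
      β.inChart e y = ddc (stdJ n) (fun y => f q (e.symm y)) y := by
    intro q e he y hy hyq
    rw [hβ0 e he y hy]
    refine ddc_eq_of_dense (W := W (e.symm y) ∩ W q) hD he ((hWo _).inter (hWo _))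
      ((hf _).mono inter_subset_left) ((hf _).mono inter_subset_right) ?_ hy ⟨hqW _, hyq⟩
    intro z hz hzW hzD
    rw [← hfP _ e he z hz hzW.1 hzD, ← hfP _ e he z hz hzW.2 hzD]
  refine ⟨β, fun q => ⟨W q, hWo q, hqW q, f q, hf q, hβ q⟩, fun e he y hy hyD => ?_⟩
  rw [hβ (e.symm y) e he y hy (hqW _), hfP _ e he y hy (hqW _) hyD]

namespace TwoForm.IsLocallyDdc

variable {β : TwoForm n X}

theorem eventually_inChart (hβ : β.IsLocallyDdc) (he : e ∈ holAtlas n X) {y : CSpace n}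
    (hy : y ∈ e.target) : ∃ f : CSpace n → ℝ, ContDiffAt ℝ ∞ f y ∧
      β.inChart e =ᶠ[𝓝 y] ddc (stdJ n) f := by
  obtain ⟨W, hW, hyW, f, hf, h⟩ := hβ (e.symm y)
  refine ⟨fun y => f (e.symm y), contDiffAt_comp_symm he hy (hf.contMDiffAt (hW.mem_nhds hyW)), ?_⟩
  filter_upwards [e.open_target.mem_nhds hy,
    (e.continuousAt_symm hy).eventually (hW.mem_nhds hyW)] with z hz hzW
  exact h e he z hz hzW

theorem contDiffAt (hβ : β.IsLocallyDdc) (he : e ∈ holAtlas n X) {y : CSpace n}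
    (hy : y ∈ e.target) : ContDiffAt ℝ ∞ (β.inChart e) y := by
  obtain ⟨f, hf, h⟩ := hβ.eventually_inChart he hy
  exact hf.ddc.congr_of_eventuallyEq h

theorem extDeriv_eq_zero (hβ : β.IsLocallyDdc) (he : e ∈ holAtlas n X) {y : CSpace n}
    (hy : y ∈ e.target) : extDeriv (β.inChart e) y = 0 := by
  obtain ⟨f, hf, h⟩ := hβ.eventually_inChart he hy
  rw [h.extDeriv_eq, extDeriv_ddc hf]

theorem map_stdJ (hβ : β.IsLocallyDdc) (he : e ∈ holAtlas n X) {y : CSpace n}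
    (hy : y ∈ e.target) (u v : CSpace n) :
    β.inChart e y ![stdJ n u, stdJ n v] = β.inChart e y ![u, v] := by
  obtain ⟨f, hf, h⟩ := hβ.eventually_inChart he hy
  rw [h.self_of_nhds, ddc_map_J stdJ_stdJ (hf.of_le two_le_infty)]

end TwoForm.IsLocallyDdc

namespace TwoForm.IsKaehler

variable {Ω : TwoForm n X}

theorem isTame_inChart (hΩ : Ω.IsKaehler) (he : e ∈ holAtlas n X) {y : CSpace n}
    (hy : y ∈ e.target) : IsTame (stdJ n) (Ω.inChart e y) := by
  intro v hv
  rw [inChart_apply, stdJ_apply, mfderiv_holChart_symm_smul he hy]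
  refine hΩ.pos (e.symm y) _ fun h0 => hv ?_
  have h0' : realDeriv (CSpace n) (CSpace n) e.symm y v = 0 := h0
  rw [← realDeriv_apply_symm he hy v, h0', map_zero]

theorem map_stdJ (hΩ : Ω.IsKaehler) (he : e ∈ holAtlas n X) {y : CSpace n}
    (hy : y ∈ e.target) (u v : CSpace n) :
    Ω.inChart e y ![stdJ n u, stdJ n v] = Ω.inChart e y ![u, v] := by
  rw [inChart_apply, inChart_apply, stdJ_apply, stdJ_apply, mfderiv_holChart_symm_smul he hy,
    mfderiv_holChart_symm_smul he hy]
  exact hΩ.invariant (e.symm y) _ _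

end TwoForm.IsKaehler

/-- The Kähler condition can be checked in charts. -/
theorem TwoForm.isKaehler_of_inChart [IsManifold 𝓘(ℂ, CSpace n) ω X] {Ω : TwoForm n X}
    (hs : ∀ e ∈ atlas (CSpace n) X, ∀ y ∈ e.target, ContDiffAt ℝ ∞ (Ω.inChart e) y)
    (hc : ∀ e ∈ atlas (CSpace n) X, ∀ y ∈ e.target, extDeriv (Ω.inChart e) y = 0)
    (hi : ∀ e ∈ holAtlas n X, ∀ y ∈ e.target, ∀ u v,
      Ω.inChart e y ![stdJ n u, stdJ n v] = Ω.inChart e y ![u, v])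
    (ht : ∀ e ∈ holAtlas n X, ∀ y ∈ e.target, IsTame (stdJ n) (Ω.inChart e y)) :
    Ω.IsKaehler := by
  have hsurj : ∀ x : X, ∃ e ∈ holAtlas n X, ∃ y ∈ e.target, e.symm y = x :=
    fun x => ⟨chartAt _ x, IsManifold.chart_mem_maximalAtlas x, chartAt (CSpace n) x x,
      mem_chart_target _ x, (chartAt (CSpace n) x).left_inv (mem_chart_source _ x)⟩
  have hvec : ∀ e ∈ holAtlas n X, ∀ y ∈ e.target, ∀ v : CSpace n,
      ∃ w, realDeriv (CSpace n) (CSpace n) e.symm y w = v := by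
    intro e he y hy v
    have := realDeriv_symm_apply he (e.map_target hy) v
    rw [e.right_inv hy] at this
    exact ⟨_, this⟩
  refine ⟨fun e he y hy => (hs e he y hy).contDiffWithinAt, hc,
    ?_, ?_⟩
  · intro x v w
    obtain ⟨e, he, y, hy, rfl⟩ := hsurj x
    obtain ⟨v, rfl⟩ := hvec e he y hy v
    obtain ⟨w, rfl⟩ := hvec e he y hy w
    have h := hi e he y hy v w
    rw [inChart_apply, inChart_apply, stdJ_apply, stdJ_apply, mfderiv_holChart_symm_smul he hy,
      mfderiv_holChart_symm_smul he hy] at h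
    exact h
  · intro x v hv
    obtain ⟨e, he, y, hy, rfl⟩ := hsurj x
    obtain ⟨v, rfl⟩ := hvec e he y hy v
    have h := ht e he y hy v (by rintro rfl; exact hv (map_zero _))
    rw [inChart_apply, stdJ_apply, mfderiv_holChart_symm_smul he hy] at h
    exact h

end KaehlerCharts

/-! ### Flow lines of the Moser field -/

section FlowLines

open Set

variable {n : ℕ} {X : Type*} [TopologicalSpace X] [ChartedSpace (CSpace n) X]

/-- The path `Ω + t β` of two-forms. -/
def TwoForm.path (Ω β : TwoForm n X) (t : ℝ) : TwoForm n X :=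
  fun x => (Ω x : (CSpace n) [⋀^Fin 2]→L[ℝ] ℝ) + t • (β x : (CSpace n) [⋀^Fin 2]→L[ℝ] ℝ)

theorem TwoForm.inChart_path (Ω β : TwoForm n X) (t : ℝ)
    (e : OpenPartialHomeomorph X (CSpace n)) (y : CSpace n) :
    (Ω.path β t).inChart e y = Ω.inChart e y + t • β.inChart e y := by
  ext v
  rfl

theorem TwoForm.inChart_path_eq (Ω β : TwoForm n X) (t : ℝ)
    (e : OpenPartialHomeomorph X (CSpace n)) :
    (Ω.path β t).inChart e = Ω.inChart e + t • β.inChart e :=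
  funext fun y => Ω.inChart_path β t e y

/-- The data of the Moser argument: a path of Kähler forms `Ω + t β`, where `β = dd^c P` away from
the closed set `D`. -/
structure MoserData (Ω β : TwoForm n X) (D : Set X) (P : X → ℝ) : Prop where
  isClosed : IsClosed D
  smooth : ContMDiffOn 𝓘(ℝ, CSpace n) 𝓘(ℝ) ∞ P Dᶜ
  kaehler : Ω.IsKaehler
  locallyDdc : β.IsLocallyDdc
  eq_ddc : ∀ e ∈ holAtlas n X, ∀ y ∈ e.target, e.symm y ∉ D →
    β.inChart e y = ddc (stdJ n) (fun y => P (e.symm y)) y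
  tame : ∀ t ∈ Ioo (-1 : ℝ) 2, ∀ e ∈ holAtlas n X, ∀ y ∈ e.target,
    IsTame (stdJ n) (Ω.inChart e y + t • β.inChart e y)

/-- The Moser field in the chart `e`. -/
def chartField (Ω β : TwoForm n X) (P : X → ℝ) (e : OpenPartialHomeomorph X (CSpace n)) :
    ℝ × CSpace n → CSpace n :=
  moserField (stdJ n) (Ω.inChart e) (β.inChart e) fun y => P (e.symm y)

/-- Integral curves of the Moser field on the interval `[s, t]`. -/
structure IsFlowLine (Ω β : TwoForm n X) (D : Set X) (P : X → ℝ) (γ : ℝ → X) (s t : ℝ) :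
    Prop where
  continuousOn : ContinuousOn γ (Icc s t)
  notMem : ∀ r ∈ Icc s t, γ r ∉ D
  hasDerivWithinAt : ∀ r ∈ Icc s t, ∀ e ∈ atlas (CSpace n) X, γ r ∈ e.source →
    HasDerivWithinAt (fun r => e (γ r)) (chartField Ω β P e (r, e (γ r))) (Icc s t) r

/-- `φ` pulls `Θ'` back to `Θ` at the point `x`. -/
def PullsBackAt (Θ Θ' : TwoForm n X) (φ : X → X) (x : X) : Prop :=
  ∀ u v : CSpace n, Θ' (φ x) ![realDeriv (CSpace n) (CSpace n) φ x u,
    realDeriv (CSpace n) (CSpace n) φ x v] = Θ x ![u, v]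

variable {Ω β : TwoForm n X} {D : Set X} {P : X → ℝ} {e e' : OpenPartialHomeomorph X (CSpace n)}

/-- The part of a chart over the complement of `D`, times the time interval. -/
def flowDomain (D : Set X) (e : OpenPartialHomeomorph X (CSpace n)) : Set (ℝ × CSpace n) :=
  Ioo (-1 : ℝ) 2 ×ˢ (e.target ∩ e.symm ⁻¹' Dᶜ)

namespace MoserData

theorem isOpen_chart_compl (h : MoserData Ω β D P) (e : OpenPartialHomeomorph X (CSpace n)) :
    IsOpen (e.target ∩ e.symm ⁻¹' Dᶜ) :=
  e.isOpen_inter_preimage_symm h.isClosed.isOpen_compl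

theorem isOpen_flowDomain (h : MoserData Ω β D P) (e : OpenPartialHomeomorph X (CSpace n)) :
    IsOpen (flowDomain D e) :=
  isOpen_Ioo.prod (h.isOpen_chart_compl e)

theorem contDiffAt_form (h : MoserData Ω β D P) (he : e ∈ atlas (CSpace n) X) {y : CSpace n}
    (hy : y ∈ e.target) : ContDiffAt ℝ ∞ (Ω.inChart e) y :=
  (h.kaehler.smooth e he).contDiffAt (e.open_target.mem_nhds hy)

theorem contDiffAt_potential (h : MoserData Ω β D P) (he : e ∈ holAtlas n X) {y : CSpace n}
    (hy : y ∈ e.target) (hyD : e.symm y ∉ D) : ContDiffAt ℝ ∞ (fun y => P (e.symm y)) y :=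
  contDiffAt_comp_symm he hy (h.smooth.contMDiffAt (h.isClosed.isOpen_compl.mem_nhds hyD))

theorem contDiffOn_chartField [IsManifold 𝓘(ℂ, CSpace n) ω X] (h : MoserData Ω β D P)
    (he : e ∈ atlas (CSpace n) X) : ContDiffOn ℝ ∞ (chartField Ω β P e) (flowDomain D e) := by
  rintro ⟨t, y⟩ ⟨ht, hy, hyD⟩
  have he' : e ∈ holAtlas n X := IsManifold.subset_maximalAtlas he
  exact (contDiffAt_moserField (h.tame t ht e he' y hy) (h.contDiffAt_form he hy)
    (h.locallyDdc.contDiffAt he' hy) (h.contDiffAt_potential he' hy hyD)).contDiffWithinAt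

theorem chartField_spec (h : MoserData Ω β D P) (he : e ∈ holAtlas n X) {t : ℝ}
    (ht : t ∈ Ioo (-1 : ℝ) 2) {y : CSpace n} (hy : y ∈ e.target) (u : CSpace n) :
    (Ω.inChart e y + t • β.inChart e y) ![chartField Ω β P e (t, y), u]
      = fderiv ℝ (fun y => P (e.symm y)) y (stdJ n u) :=
  moserField_spec (p := fun y => P (e.symm y)) (h.tame t ht e he y hy) u

/-- The push-forward of the field satisfies the equation that defines the field in the second chart,
because the path of forms, `P` and `J` are all compatible with holomorphic changes of charts.
Uniqueness concludes. -/
theorem chartField_transition (h : MoserData Ω β D P) (he : e ∈ holAtlas n X)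
    (he' : e' ∈ holAtlas n X) {t : ℝ} (ht : t ∈ Ioo (-1 : ℝ) 2) {y : CSpace n} (hy : y ∈ e.target)
    (hy' : e.symm y ∈ e'.source) (hyD : e.symm y ∉ D) :
    fderiv ℝ (fun y => e' (e.symm y)) y (chartField Ω β P e (t, y))
      = chartField Ω β P e' (t, e' (e.symm y)) := by
  have hz := e'.map_source hy'
  refine moserField_eq (p := fun y => P (e'.symm y)) (h.tame t ht e' he' _ hz) fun u => ?_
  -- The differential of the transition map is onto, so testing on its image is enough.
  obtain ⟨u, rfl⟩ : ∃ w, fderiv ℝ (fun y => e' (e.symm y)) y w = u := by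
    refine ⟨realDeriv (CSpace n) (CSpace n) e (e.symm y)
      (realDeriv (CSpace n) (CSpace n) e'.symm (e' (e.symm y)) u), ?_⟩
    rw [← realDeriv_apply_comp_symm he he' hy hy']
    have h1 := realDeriv_symm_apply he (e.map_target hy)
      (realDeriv (CSpace n) (CSpace n) e'.symm (e' (e.symm y)) u)
    rw [e.right_inv hy] at h1
    rw [h1]
    have h2 := realDeriv_apply_symm he' hz u
    rwa [e'.left_inv hy'] at h2
  have h1 := h.chartField_spec he ht hy u
  rw [← TwoForm.inChart_path, (Ω.path β t).inChart_transition he he' hy hy',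
    TwoForm.inChart_path] at h1
  rw [h1, ← fderiv_transition_stdJ he he' hy hy']
  have h2 : HasFDerivAt (fun y => P (e.symm y))
      (fderiv ℝ (fun y => P (e'.symm y)) (e' (e.symm y)) ∘L
        fderiv ℝ (fun y => e' (e.symm y)) y) y := by
    have h3 : ContDiffAt ℝ ∞ (fun y => P (e'.symm y)) (e' (e.symm y)) :=
      h.contDiffAt_potential he' hz (by rwa [e'.left_inv hy'])
    have h4 := HasFDerivAt.comp (g := fun y => P (e'.symm y)) y
      (h3.differentiableAt (by simp)).hasFDerivAt
      ((contDiffAt_transition he he' hy hy').differentiableAt (by simp)).hasFDerivAt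
    refine h4.congr_of_eventuallyEq ?_
    filter_upwards [(isOpen_transition_source e e').mem_nhds
      (mem_transition_source.2 ⟨hy, hy'⟩)] with z hz
    simp only [Function.comp_apply]
    rw [e'.left_inv (mem_transition_source.1 hz).2]
  rw [h2.fderiv]
  rfl

/-- The differential equation of a flow line may be checked in one chart. -/
theorem hasDerivWithinAt_of_chart (h : MoserData Ω β D P) {γ : ℝ → X} {S : Set ℝ} {r : ℝ}
    (hr : r ∈ Ioo (-1 : ℝ) 2) (hγ : ContinuousWithinAt γ S r) (hD : γ r ∉ D)
    (he : e ∈ holAtlas n X) (he' : e' ∈ holAtlas n X) (hs : γ r ∈ e.source)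
    (hs' : γ r ∈ e'.source)
    (hd : HasDerivWithinAt (fun r => e (γ r)) (chartField Ω β P e (r, e (γ r))) S r) :
    HasDerivWithinAt (fun r => e' (γ r)) (chartField Ω β P e' (r, e' (γ r))) S r := by
  have hl := e.left_inv hs
  have hy := e.map_source hs
  have hτ : HasFDerivAt (fun y => e' (e.symm y)) (fderiv ℝ (fun y => e' (e.symm y)) (e (γ r)))
      (e (γ r)) :=
    ((contDiffAt_transition he he' hy (by rwa [hl])).differentiableAt (by simp)).hasFDerivAt
  have h1 := HasFDerivAt.comp_hasDerivWithinAt (l := fun y => e' (e.symm y)) r hτ hd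
  rw [h.chartField_transition he he' hr hy (by rwa [hl]) (by rwa [hl]), hl] at h1
  refine h1.congr_of_eventuallyEq ?_ ?_
  · filter_upwards [hγ.eventually (e.open_source.mem_nhds hs)] with z hz
    simp only [Function.comp_apply]
    rw [e.left_inv hz]
  · simp only [Function.comp_apply]
    rw [hl]

end MoserData

end FlowLines

/-! ### Local existence and uniqueness of flow lines -/

section FlowLineExistence

open Set

variable {n : ℕ} {X : Type*} [TopologicalSpace X] [ChartedSpace (CSpace n) X]

variable {Ω β : TwoForm n X} {D : Set X} {P : X → ℝ} {e e' : OpenPartialHomeomorph X (CSpace n)}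

theorem PullsBackAt.comp {Θ Θ' Θ'' : TwoForm n X} {φ φ' : X → X} {x : X}
    (h : PullsBackAt Θ Θ' φ x) (h' : PullsBackAt Θ' Θ'' φ' (φ x))
    (hφ : MDifferentiableAt 𝓘(ℝ, CSpace n) 𝓘(ℝ, CSpace n) φ x)
    (hφ' : MDifferentiableAt 𝓘(ℝ, CSpace n) 𝓘(ℝ, CSpace n) φ' (φ x)) :
    PullsBackAt Θ Θ'' (φ' ∘ φ) x := by
  intro u v
  have hc : realDeriv (CSpace n) (CSpace n) (φ' ∘ φ) x
      = realDeriv (CSpace n) (CSpace n) φ' (φ x) ∘L realDeriv (CSpace n) (CSpace n) φ x :=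
    mfderiv_comp x hφ' hφ
  rw [hc, ← h u v, ← h']
  rfl

theorem IsFlowLine.congr {γ γ' : ℝ → X} {s t : ℝ} (h : IsFlowLine Ω β D P γ s t)
    (he : EqOn γ' γ (Icc s t)) : IsFlowLine Ω β D P γ' s t where
  continuousOn := h.continuousOn.congr he
  notMem r hr := by rw [he hr]; exact h.notMem r hr
  hasDerivWithinAt r hr e hea her := by
    rw [he hr] at her ⊢
    exact (h.hasDerivWithinAt r hr e hea her).congr (fun r' hr' => by rw [he hr'])
      (by rw [he hr])

/-- Concatenation of flow lines. -/
theorem IsFlowLine.trans {γ γ' : ℝ → X} {s t r : ℝ} (h : IsFlowLine Ω β D P γ s t)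
    (h' : IsFlowLine Ω β D P γ' t r) (hst : s ≤ t) (htr : t ≤ r) (heq : γ t = γ' t) :
    IsFlowLine Ω β D P (fun x => if x ≤ t then γ x else γ' x) s r := by
  set γ'' : ℝ → X := fun x => if x ≤ t then γ x else γ' x with hγ''
  have e1 : EqOn γ'' γ (Icc s t) := fun x hx => if_pos hx.2
  have e2 : EqOn γ'' γ' (Icc t r) := fun x hx => by
    rcases hx.1.eq_or_lt with rfl | hlt
    · simp [hγ'', heq]
    · exact if_neg (not_le.2 hlt)
  have h1 := h.congr e1
  have h2 := h'.congr e2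
  have hU : Icc s t ∪ Icc t r = Icc s r := Icc_union_Icc_eq_Icc hst htr
  refine ⟨?_, ?_, ?_⟩
  · rw [← hU]
    exact h1.continuousOn.union_of_isClosed h2.continuousOn isClosed_Icc isClosed_Icc
  · intro x hx
    rw [← hU] at hx
    exact hx.elim (h1.notMem x) (h2.notMem x)
  · intro x hx e he hxe
    rw [← hU] at hx ⊢
    refine HasDerivWithinAt.union ?_ ?_
    · by_cases hx1 : x ∈ Icc s t
      · exact h1.hasDerivWithinAt x hx1 e he hxe
      -- Outside the closed interval the derivative within it is an empty condition.
      · exact HasFDerivWithinAt.of_notMem_closure (by rwa [isClosed_Icc.closure_eq])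
    · by_cases hx1 : x ∈ Icc t r
      · exact h2.hasDerivWithinAt x hx1 e he hxe
      · exact HasFDerivWithinAt.of_notMem_closure (by rwa [isClosed_Icc.closure_eq])

/-- The local flow of the Moser field near the time `t₀` and the point `p`. -/
theorem MoserData.exists_local_flow [IsManifold 𝓘(ℂ, CSpace n) ω X] (h : MoserData Ω β D P) {t₀ : ℝ}
    (ht₀ : t₀ ∈ Ioo (-1 : ℝ) 2) {p : X} (hp : p ∉ D) (m : ℕ) :
    ∃ δ > 0, ∃ V ∈ 𝓝 p, ∀ s ∈ Metric.ball t₀ δ, ∀ t ∈ Metric.ball t₀ δ, ∃ φ : X → X,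
      ∀ x ∈ V, ContMDiffAt 𝓘(ℝ, CSpace n) 𝓘(ℝ, CSpace n) m φ x ∧
        PullsBackAt (Ω.path β s) (Ω.path β t) φ x ∧
        ∃ γ : ℝ → X, IsFlowLine Ω β D P γ s t ∧ γ s = x ∧ γ t = φ x := by
  set e : OpenPartialHomeomorph X (CSpace n) := chartAt (CSpace n) p with he_def
  have hea : e ∈ atlas (CSpace n) X := chart_mem_atlas _ p
  have he : e ∈ holAtlas n X := IsManifold.subset_maximalAtlas hea
  have hpe : p ∈ e.source := mem_chart_source _ p
  have h0 : (t₀, e p) ∈ flowDomain D e :=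
    ⟨ht₀, e.map_source hpe, by simpa [e.left_inv hpe] using hp⟩
  -- Moser's computation differentiates the flow twice; class `m + 2` allows this for every `m`.
  obtain ⟨δ, hδ, Φ, hΦ⟩ := exists_local_flow_timeDependent (h.isOpen_flowDomain e)
    (h.contDiffOn_chartField hea) h0 (m + 2)
  have hVo : IsOpen (e.source ∩ e ⁻¹' Metric.ball (e p) δ) :=
    e.isOpen_inter_preimage Metric.isOpen_ball
  refine ⟨δ, hδ, _, hVo.mem_nhds ⟨hpe, Metric.mem_ball_self hδ⟩, fun s hs t ht =>
    ⟨fun x => e.symm (Φ (s, t, e x)), ?_⟩⟩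
  rintro x ⟨hxe, hxb⟩
  have hxb' : e x ∈ Metric.ball (e p) δ := hxb
  obtain ⟨hΦs, hΦO, -, -⟩ := hΦ s hs t ht _ hxb
  have hss := (hΦ s hs s hs _ hxb).2.2.1
  have hfl : ∀ r, ContDiffAt ℝ 2 Φ (s, r, e x) →
      ContDiffAt ℝ 2 (fun q : ℝ × CSpace n => Φ (s, q.1, q.2)) (r, e x) := fun r hr =>
    ContDiffAt.comp (g := Φ) (r, e x) hr
      (by fun_prop : ContDiffAt ℝ 2 (fun q : ℝ × CSpace n => (s, q.1, q.2)) (r, e x))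
  have hm2 : (2 : WithTop ℕ∞) ≤ ((m + 2 : ℕ) : WithTop ℕ∞) := by
    exact_mod_cast Nat.le_add_left 2 m
  have hmm : ((m : ℕ) : WithTop ℕ∞) ≤ ((m + 2 : ℕ) : WithTop ℕ∞) := by
    exact_mod_cast Nat.le_add_right m 2
  have hslice : ContDiffAt ℝ (m + 2 : ℕ) (fun y => Φ (s, t, y)) (e x) :=
    ContDiffAt.comp (g := Φ) (e x) hΦs
      (by fun_prop : ContDiffAt ℝ (m + 2 : ℕ) (fun y : CSpace n => (s, t, y)) (e x))
  have hcm : ∀ {k : WithTop ℕ∞}, k ≤ ((m + 2 : ℕ) : WithTop ℕ∞) →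
      ContMDiffAt 𝓘(ℝ, CSpace n) 𝓘(ℝ, CSpace n) k (fun x => Φ (s, t, e x)) x := fun {k} hk => by
    have h1 : ContMDiffAt 𝓘(ℝ, CSpace n) 𝓘(ℝ, CSpace n) k e x :=
      (contMDiffAt_holChart he hxe).of_le (hk.trans (by
        generalize m + 2 = k; exact_mod_cast le_top))
    exact ContMDiffAt.comp (g := fun y => Φ (s, t, y)) x (hslice.of_le hk).contMDiffAt h1
  have hsy : ContMDiffAt 𝓘(ℝ, CSpace n) 𝓘(ℝ, CSpace n) ∞ e.symm (Φ (s, t, e x)) :=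
    contMDiffAt_holChart_symm he hΦO.2.1
  refine ⟨(hsy.of_le (by exact_mod_cast le_top)).comp x (hcm hmm), ?_, ?_⟩
  · -- the pull-back of the path of forms is constant in time
    intro u v
    set u' := realDeriv (CSpace n) (CSpace n) e x u
    set v' := realDeriv (CSpace n) (CSpace n) e x v
    have hd1 : HasMFDerivAt 𝓘(ℝ, CSpace n) 𝓘(ℝ, CSpace n) (fun y => Φ (s, t, y)) (e x)
        (fderiv ℝ (fun y => Φ (s, t, y)) (e x)) :=
      (hslice.differentiableAt (by simp)).hasFDerivAt.hasMFDerivAt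
    have hd2 := HasMFDerivAt.comp x hd1
      ((contMDiffAt_holChart he hxe).mdifferentiableAt (by simp)).hasMFDerivAt
    have hd3 := (HasMFDerivAt.comp x (hsy.mdifferentiableAt (by simp)).hasMFDerivAt hd2).mfderiv
    have hd4 : ∀ w, realDeriv (CSpace n) (CSpace n) (fun x => e.symm (Φ (s, t, e x))) x w
        = realDeriv (CSpace n) (CSpace n) e.symm (Φ (s, t, e x))
          (fderiv ℝ (fun y => Φ (s, t, y)) (e x) (realDeriv (CSpace n) (CSpace n) e x w)) :=
      fun w => congrArg (fun L : CSpace n →L[ℝ] CSpace n => L w) hd3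
    rw [hd4, hd4, ← TwoForm.inChart_apply, TwoForm.inChart_path]
    have hder : ∀ r ∈ Metric.ball t₀ δ, HasDerivAt (fun r =>
        (Ω.inChart e (Φ (s, r, e x)) + r • β.inChart e (Φ (s, r, e x)))
          ![fderiv ℝ (fun y => Φ (s, r, y)) (e x) u', fderiv ℝ (fun y => Φ (s, r, y)) (e x) v'])
        0 r := by
      intro r hr
      have hr' := hΦ s hs r hr _ hxb
      refine hasDerivAt_pullback_moserField (I := Ioo (-1 : ℝ) 2)
        (O := e.target ∩ e.symm ⁻¹' Dᶜ) (J := stdJ n) (a := Ω.inChart e) (b := β.inChart e)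
        (p := fun y => P (e.symm y)) (φ := fun q => Φ (s, q.1, q.2))
        (h.isOpen_chart_compl e) (fun y hy => (h.contDiffAt_form hea hy.1).contDiffWithinAt)
        (fun y hy => (h.locallyDdc.contDiffAt he hy.1).contDiffWithinAt)
        (fun y hy => (h.contDiffAt_potential he hy.1 hy.2).contDiffWithinAt)
        (fun y hy => h.kaehler.closed e hea y hy.1) (fun y hy => h.eq_ddc e he y hy.1 hy.2)
        (fun t ht y hy => h.tame t ht e he y hy.1) hr'.2.1.1 hr'.2.1.2
        (hfl r (hr'.1.of_le hm2)) ?_ u' v'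
      have hN : Metric.ball t₀ δ ×ˢ Metric.ball (e p) δ ∈ 𝓝 (r, e x) :=
        (Metric.isOpen_ball.prod Metric.isOpen_ball).mem_nhds ⟨hr, hxb⟩
      filter_upwards [hN] with q hq
      exact (hΦ s hs q.1 hq.1 q.2 hq.2).2.2.2
    have hconst := (convex_ball t₀ δ).is_const_of_fderivWithin_eq_zero (𝕜 := ℝ)
      (fun r hr => (hder r hr).differentiableAt.differentiableWithinAt)
      (fun r hr => by
        rw [fderivWithin_of_isOpen Metric.isOpen_ball hr]
        simpa using (hder r hr).hasFDerivAt.fderiv) ht hs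
    rw [hconst]
    have hid : fderiv ℝ (fun y => Φ (s, s, y)) (e x) = ContinuousLinearMap.id ℝ _ := by
      have : (fun y => Φ (s, s, y)) =ᶠ[𝓝 (e x)] id := by
        filter_upwards [Metric.isOpen_ball.mem_nhds hxb'] with y hy
        exact (hΦ s hs s hs y hy).2.2.1
      rw [this.fderiv_eq, fderiv_id]
    rw [hid, hss, ← TwoForm.inChart_path, TwoForm.inChart_apply]
    simp only [ContinuousLinearMap.id_apply, u', v']
    rw [realDeriv_symm_apply he hxe, realDeriv_symm_apply he hxe, e.left_inv hxe]
  · have hsub : Icc s t ⊆ Metric.ball t₀ δ := by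
      intro r hr
      simp only [Metric.mem_ball, Real.dist_eq, abs_lt] at hs ht ⊢
      constructor <;> linarith [hr.1, hr.2, hs.1, hs.2, ht.1, ht.2]
    have hcont : ∀ r ∈ Icc s t, ContinuousAt (fun r => e.symm (Φ (s, r, e x))) r := fun r hr => by
      have hr' := hΦ s hs r (hsub hr) _ hxb
      exact ContinuousAt.comp (g := e.symm) (e.continuousAt_symm hr'.2.1.2.1)
        hr'.2.2.2.continuousAt
    refine ⟨fun r => e.symm (Φ (s, r, e x)), ⟨fun r hr => (hcont r hr).continuousWithinAt,
      fun r hr => (hΦ s hs r (hsub hr) _ hxb).2.1.2.2, ?_⟩, ?_, rfl⟩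
    · intro r hr e' he' hre'
      have hr' := hΦ s hs r (hsub hr) _ hxb
      refine h.hasDerivWithinAt_of_chart hr'.2.1.1 (hcont r hr).continuousWithinAt hr'.2.1.2.2 he
        (IsManifold.subset_maximalAtlas he') (e.map_target hr'.2.1.2.1) hre' ?_
      rw [e.right_inv hr'.2.1.2.1]
      refine hr'.2.2.2.hasDerivWithinAt.congr (fun r₁ hr₁ => ?_) (e.right_inv hr'.2.1.2.1)
      exact e.right_inv (hΦ s hs r₁ (hsub hr₁) _ hxb).2.1.2.1
    · simp only [hss, e.left_inv hxe]

/-- Two flow lines that meet agree. -/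
theorem MoserData.flowLine_unique [IsManifold 𝓘(ℂ, CSpace n) ω X] [T2Space X]
    (h : MoserData Ω β D P) {γ γ' : ℝ → X} {s t : ℝ} (hst : Icc s t ⊆ Ioo (-1 : ℝ) 2)
    (hγ : IsFlowLine Ω β D P γ s t) (hγ' : IsFlowLine Ω β D P γ' s t) {r₀ : ℝ}
    (hr₀ : r₀ ∈ Icc s t) (heq : γ r₀ = γ' r₀) : EqOn γ γ' (Icc s t) := by
  -- Agreement at one time spreads to nearby times in both directions, by uniqueness for ordinary
  -- differential equations in a chart. The backward direction later gives injectivity of the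
  -- time-one map.
  have hloc : ∀ r ∈ Icc s t, γ r = γ' r → ∃ η > 0, ∀ r' ∈ Icc s t, |r' - r| < η →
      γ r' = γ' r' := by
    intro r hr hrr
    set e : OpenPartialHomeomorph X (CSpace n) := chartAt (CSpace n) (γ r) with he_def
    have hea : e ∈ atlas (CSpace n) X := chart_mem_atlas _ _
    have hpe : γ r ∈ e.source := mem_chart_source _ _
    have hpe' : γ' r ∈ e.source := hrr ▸ hpe
    have h0 : (r, e (γ r)) ∈ flowDomain D e :=
      ⟨hst hr, e.map_source hpe, by simpa [e.left_inv hpe] using hγ.notMem r hr⟩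
    have hsm : ContDiffAt ℝ 1 (chartField Ω β P e) (r, e (γ r)) :=
      ((h.contDiffOn_chartField hea).contDiffAt ((h.isOpen_flowDomain e).mem_nhds h0)).of_le
        (by simp)
    -- The field is jointly `C¹` in time and space, so near the point it is Lipschitz in space with
    -- a constant uniform in time.
    obtain ⟨K, S, hS, hlip⟩ := hsm.exists_lipschitzOnWith
    obtain ⟨ρ, hρ, hρS⟩ := Metric.mem_nhds_iff.1 hS
    have hlip' : ∀ r' ∈ Metric.ball r ρ,
        LipschitzOnWith K (fun y => chartField Ω β P e (r', y)) (Metric.ball (e (γ r)) ρ) := by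
      intro r' hr'
      have hin : ∀ y ∈ Metric.ball (e (γ r)) ρ, (r', y) ∈ S := fun y hy => hρS (by
        rw [Metric.mem_ball, Prod.dist_eq, max_lt_iff]
        exact ⟨hr', hy⟩)
      intro y hy z hz
      have := hlip (hin y hy) (hin z hz)
      simpa [Prod.edist_eq] using this
    have hnear : ∀ γ : ℝ → X, IsFlowLine Ω β D P γ s t → ∀ p, γ r = p → p ∈ e.source →
        ∀ᶠ r' in 𝓝[Icc s t] r, γ r' ∈ e.source ∧ e (γ r') ∈ Metric.ball (e p) ρ := by
      rintro γ hγ p rfl hp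
      have hc := hγ.continuousOn r hr
      exact (hc.eventually (e.open_source.mem_nhds hp)).and
        (((e.continuousAt hp).comp_continuousWithinAt hc).eventually (Metric.ball_mem_nhds _ hρ))
    have hev := (hnear γ hγ _ rfl hpe).and (hnear γ' hγ' _ hrr.symm hpe)
    rw [Filter.Eventually, mem_nhdsWithin_iff_exists_mem_nhds_inter] at hev
    obtain ⟨N, hN, hNsub⟩ := hev
    obtain ⟨η, hη, hηN⟩ := Metric.mem_nhds_iff.1 (Filter.inter_mem hN (Metric.ball_mem_nhds r hρ))
    have hgood : ∀ r' ∈ Icc s t, |r' - r| < η →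
        ((γ r' ∈ e.source ∧ e (γ r') ∈ Metric.ball (e (γ r)) ρ) ∧
        (γ' r' ∈ e.source ∧ e (γ' r') ∈ Metric.ball (e (γ r)) ρ)) ∧ r' ∈ Metric.ball r ρ :=
      fun r' hr' hd => ⟨hNsub ⟨(hηN hd).1, hr'⟩, (hηN hd).2⟩
    have hcon : ∀ γ : ℝ → X, IsFlowLine Ω β D P γ s t → ∀ r' ∈ Icc s t, γ r' ∈ e.source →
        ContinuousWithinAt (fun r => e (γ r)) (Icc s t) r' := fun γ hγ r' hr' hs' =>
      (hγ.hasDerivWithinAt r' hr' e hea hs').continuousWithinAt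
    refine ⟨η, hη, fun r' hr' hd => ?_⟩
    have hkey : e (γ r') = e (γ' r') := by
      rcases le_total r r' with hle | hle
      · have hsub : Icc r r' ⊆ Icc s t := Icc_subset_Icc hr.1 hr'.2
        have habs : ∀ x ∈ Icc r r', |x - r| < η := fun x hx => by
          rw [abs_lt] at hd ⊢
          constructor <;> linarith [hx.1, hx.2]
        have hnb : ∀ x ∈ Ico r r', Icc s t ∈ 𝓝[Ici x] x := fun x hx =>
          Filter.mem_of_superset (Icc_mem_nhdsGE (hx.2.trans_le hr'.2))
            (Icc_subset_Icc_left (hr.1.trans hx.1))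
        exact ODE_solution_unique_of_mem_Icc_right (K := K)
          (v := fun r' y => chartField Ω β P e (r', y)) (s := fun _ => Metric.ball (e (γ r)) ρ)
          (a := r) (b := r') (f := fun x => e (γ x)) (g := fun x => e (γ' x))
          (fun x hx => hlip' x (hgood x (hsub (Ico_subset_Icc_self hx))
            (habs x (Ico_subset_Icc_self hx))).2)
          (fun x hx => (hcon γ hγ x (hsub hx) (hgood x (hsub hx) (habs x hx)).1.1.1).mono hsub)
          (fun x hx => (hγ.hasDerivWithinAt x (hsub (Ico_subset_Icc_self hx)) e hea
            (hgood x (hsub (Ico_subset_Icc_self hx))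
              (habs x (Ico_subset_Icc_self hx))).1.1.1).mono_of_mem_nhdsWithin (hnb x hx))
          (fun x hx => (hgood x (hsub (Ico_subset_Icc_self hx))
            (habs x (Ico_subset_Icc_self hx))).1.1.2)
          (fun x hx => (hcon γ' hγ' x (hsub hx) (hgood x (hsub hx) (habs x hx)).1.2.1).mono hsub)
          (fun x hx => (hγ'.hasDerivWithinAt x (hsub (Ico_subset_Icc_self hx)) e hea
            (hgood x (hsub (Ico_subset_Icc_self hx))
              (habs x (Ico_subset_Icc_self hx))).1.2.1).mono_of_mem_nhdsWithin (hnb x hx))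
          (fun x hx => (hgood x (hsub (Ico_subset_Icc_self hx))
            (habs x (Ico_subset_Icc_self hx))).1.2.2)
          (by simp only [hrr]) (right_mem_Icc.2 hle)
      · have hsub : Icc r' r ⊆ Icc s t := Icc_subset_Icc hr'.1 hr.2
        have habs : ∀ x ∈ Icc r' r, |x - r| < η := fun x hx => by
          rw [abs_lt] at hd ⊢
          constructor <;> linarith [hx.1, hx.2]
        have hnb : ∀ x ∈ Ioc r' r, Icc s t ∈ 𝓝[Iic x] x := fun x hx =>
          Filter.mem_of_superset (Icc_mem_nhdsLE (hr'.1.trans_lt hx.1))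
            (Icc_subset_Icc_right (hx.2.trans hr.2))
        exact ODE_solution_unique_of_mem_Icc_left (K := K)
          (v := fun r' y => chartField Ω β P e (r', y)) (s := fun _ => Metric.ball (e (γ r)) ρ)
          (a := r') (b := r) (f := fun x => e (γ x)) (g := fun x => e (γ' x))
          (fun x hx => hlip' x (hgood x (hsub (Ioc_subset_Icc_self hx))
            (habs x (Ioc_subset_Icc_self hx))).2)
          (fun x hx => (hcon γ hγ x (hsub hx) (hgood x (hsub hx) (habs x hx)).1.1.1).mono hsub)
          (fun x hx => (hγ.hasDerivWithinAt x (hsub (Ioc_subset_Icc_self hx)) e hea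
            (hgood x (hsub (Ioc_subset_Icc_self hx))
              (habs x (Ioc_subset_Icc_self hx))).1.1.1).mono_of_mem_nhdsWithin (hnb x hx))
          (fun x hx => (hgood x (hsub (Ioc_subset_Icc_self hx))
            (habs x (Ioc_subset_Icc_self hx))).1.1.2)
          (fun x hx => (hcon γ' hγ' x (hsub hx) (hgood x (hsub hx) (habs x hx)).1.2.1).mono hsub)
          (fun x hx => (hγ'.hasDerivWithinAt x (hsub (Ioc_subset_Icc_self hx)) e hea
            (hgood x (hsub (Ioc_subset_Icc_self hx))
              (habs x (Ioc_subset_Icc_self hx))).1.2.1).mono_of_mem_nhdsWithin (hnb x hx))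
          (fun x hx => (hgood x (hsub (Ioc_subset_Icc_self hx))
            (habs x (Ioc_subset_Icc_self hx))).1.2.2)
          (by simp only [hrr]) (left_mem_Icc.2 hle)
    exact e.injOn (hgood r' hr' hd).1.1.1 (hgood r' hr' hd).1.2.1 hkey
  -- the coincidence set is open and closed in the interval
  have hpre : IsPreconnected (Icc s t) := isPreconnected_Icc
  let A : Set (Icc s t) := {r | γ r = γ' r}
  have hAo : IsOpen A := by
    rw [Metric.isOpen_iff]
    intro r hr
    obtain ⟨η, hη, hηA⟩ := hloc r r.2 hr
    exact ⟨η, hη, fun r' hr' => hηA r' r'.2 hr'⟩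
  have hAc : IsClosed A :=
    isClosed_eq (continuousOn_iff_continuous_domRestrict.1 hγ.continuousOn)
      (continuousOn_iff_continuous_domRestrict.1 hγ'.continuousOn)
  have : PreconnectedSpace (Icc s t) := Subtype.preconnectedSpace hpre
  have hA : A = univ := IsClopen.eq_univ ⟨hAc, hAo⟩ ⟨⟨r₀, hr₀⟩, heq⟩
  intro r hr
  have : (⟨r, hr⟩ : Icc s t) ∈ A := hA ▸ mem_univ _
  exact this

end FlowLineExistence

/-! ### Existence up to time one and the symplectic embedding -/

section GlobalFlow

open Set

variable {n : ℕ} {X : Type*} [TopologicalSpace X] [ChartedSpace (CSpace n) X]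

variable {Ω β : TwoForm n X} {D : Set X} {P : X → ℝ} {e e' : OpenPartialHomeomorph X (CSpace n)}

/-- The path of forms is tame on an open interval around [0,1], so the endpoints are interior times,
as the local flow requires. -/
theorem Ioo_of_Icc_zero_one {r : ℝ} (hr : r ∈ Icc (0 : ℝ) 1) : r ∈ Ioo (-1 : ℝ) 2 :=
  ⟨by linarith [hr.1], by linarith [hr.2]⟩

theorem MoserData.path_map_stdJ (h : MoserData Ω β D P) (t : ℝ) (he : e ∈ holAtlas n X)
    {y : CSpace n} (hy : y ∈ e.target) (u v : CSpace n) :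
    (Ω.inChart e y + t • β.inChart e y) ![stdJ n u, stdJ n v]
      = (Ω.inChart e y + t • β.inChart e y) ![u, v] := by
  have h1 := h.kaehler.map_stdJ he hy u v
  have h2 := h.locallyDdc.map_stdJ he hy u v
  change Ω.inChart e y _ + t * β.inChart e y _ = Ω.inChart e y _ + t * β.inChart e y _
  rw [h1, h2]

/-- The potential decreases along flow lines, at a rate bounded below by its differential. -/
theorem MoserData.exists_hasDerivWithinAt_potential [IsManifold 𝓘(ℂ, CSpace n) ω X]
    (h : MoserData Ω β D P) {γ : ℝ → X} {s t r : ℝ}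
    (hγ : IsFlowLine Ω β D P γ s t) (hr : r ∈ Icc s t) (hr' : r ∈ Ioo (-1 : ℝ) 2)
    (he : e ∈ holAtlas n X) (hre : γ r ∈ e.source) :
    ∃ d ≤ 0, HasDerivWithinAt (fun r => P (γ r)) d (Icc s t) r ∧ ∀ u : CSpace n,
      fderiv ℝ (fun y => P (e.symm y)) (e (γ r)) u ^ 2 ≤ (-d) *
        (Ω.inChart e (e (γ r)) + r • β.inChart e (e (γ r))) ![u, stdJ n u] := by
  have hy := e.map_source hre
  have hl := e.left_inv hre
  have hD := hγ.notMem r hr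
  have htame := h.tame r hr' e he _ hy
  have hd : HasDerivWithinAt (fun r => e (γ r)) (chartField Ω β P e (r, e (γ r))) (Icc s t) r :=
    h.hasDerivWithinAt_of_chart hr' (hγ.continuousOn r hr) hD
      (IsManifold.chart_mem_maximalAtlas (γ r)) he (mem_chart_source _ _) hre
      (hγ.hasDerivWithinAt r hr _ (chart_mem_atlas _ _) (mem_chart_source _ _))
  have hspec := fun u => h.chartField_spec he hr' hy u
  refine ⟨fderiv ℝ (fun y => P (e.symm y)) (e (γ r)) (chartField Ω β P e (r, e (γ r))), ?_, ?_,
    fun u => htame.sq_le stdJ_stdJ (h.path_map_stdJ r he hy) hspec u⟩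
  · have h1 := htame.nonneg (chartField Ω β P e (r, e (γ r)))
    rw [hspec, stdJ_stdJ, map_neg] at h1
    linarith
  · have h1 := HasFDerivAt.comp_hasDerivWithinAt (l := fun y => P (e.symm y)) r
      ((h.contDiffAt_potential he hy (by rwa [hl])).differentiableAt (by simp)).hasFDerivAt hd
    refine h1.congr_of_eventuallyEq ?_ ?_
    · filter_upwards [(hγ.continuousOn r hr).eventually (e.open_source.mem_nhds hre)] with z hz
      simp only [Function.comp_apply]
      rw [e.left_inv hz]
    · simp only [Function.comp_apply, hl]

theorem MoserData.antitoneOn_potential [IsManifold 𝓘(ℂ, CSpace n) ω X]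
    (h : MoserData Ω β D P) {γ : ℝ → X} {s t : ℝ} (hst : Icc s t ⊆ Ioo (-1 : ℝ) 2)
    (hγ : IsFlowLine Ω β D P γ s t) : AntitoneOn (fun r => P (γ r)) (Icc s t) := by
  have hd : ∀ r ∈ Icc s t, ∃ d ≤ 0, HasDerivWithinAt (fun r => P (γ r)) d (Icc s t) r :=
    fun r hr => by
      obtain ⟨d, hd, hd', -⟩ := h.exists_hasDerivWithinAt_potential hγ hr (hst hr)
        (IsManifold.chart_mem_maximalAtlas (γ r)) (mem_chart_source _ _)
      exact ⟨d, hd, hd'⟩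
  choose! d hd0 hd1 using hd
  refine antitoneOn_of_hasDerivWithinAt_nonpos (f' := d) (convex_Icc s t)
    (fun r hr => (hd1 r hr).continuousWithinAt)
    (fun r hr => (hd1 r (interior_subset hr)).mono interior_subset)
    (fun r hr => hd0 r (interior_subset hr))

/-- Where the potential is locally constant, constant curves are flow lines. -/
theorem isFlowLine_const {K : Set X} (hK : IsClosed K)
    (hP : ∀ x ∉ K, P x = 0) {x : X} (hx : x ∉ K) (hxD : x ∉ D) (s t : ℝ) :
    IsFlowLine Ω β D P (fun _ => x) s t where
  continuousOn := continuousOn_const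
  notMem _ _ := hxD
  hasDerivWithinAt r _ e _ hxe := by
    have h1 : (fun y => P (e.symm y)) =ᶠ[𝓝 (e x)] fun _ => 0 := by
      have hc := (e.continuousAt_symm (e.map_source hxe)).eventually
        (hK.isOpen_compl.mem_nhds (by rwa [e.left_inv hxe]))
      exact hc.mono fun y hy => hP _ hy
    have h2 : chartField Ω β P e (r, e x) = 0 := by
      rw [chartField, moserField, h1.fderiv_eq]
      simp
    rw [h2]
    exact hasDerivWithinAt_const _ _ _

/-- The local properties of the flow from time `s` to time `t`. -/
def IsFlowMapAt (Ω β : TwoForm n X) (D : Set X) (P : X → ℝ) (m : ℕ) (s t : ℝ) (φ : X → X)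
    (x : X) : Prop :=
  ContMDiffAt 𝓘(ℝ, CSpace n) 𝓘(ℝ, CSpace n) m φ x ∧
    PullsBackAt (Ω.path β s) (Ω.path β t) φ x ∧
    ∃ γ : ℝ → X, IsFlowLine Ω β D P γ s t ∧ γ s = x ∧ γ t = φ x

theorem IsFlowMapAt.comp {m : ℕ} (hm : 1 ≤ m) {s t r : ℝ} (hst : s ≤ t) (htr : t ≤ r)
    {φ φ' : X → X} {x : X} (h : IsFlowMapAt Ω β D P m s t φ x)
    (h' : IsFlowMapAt Ω β D P m t r φ' (φ x)) : IsFlowMapAt Ω β D P m s r (φ' ∘ φ) x := by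
  obtain ⟨h1, h2, γ, hγ, hγs, hγt⟩ := h
  obtain ⟨h1', h2', γ', hγ', hγt', hγr⟩ := h'
  have hm' : (m : WithTop ℕ∞) ≠ 0 := by exact_mod_cast (by omega : m ≠ 0)
  refine ⟨h1'.comp x h1, h2.comp h2' (h1.mdifferentiableAt hm') (h1'.mdifferentiableAt hm'),
    _, hγ.trans hγ' hst htr (hγt.trans hγt'.symm), ?_, ?_⟩
  · simp [hst, hγs]
  · simp only [Function.comp_apply]
    split_ifs with hrt
    -- If the second piece has length zero, the concatenated curve still takes the first branch at
    -- its endpoint.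
    · obtain rfl : r = t := le_antisymm hrt htr
      exact (hγt.trans hγt'.symm).trans hγr
    · exact hγr

/-- A smooth map that pulls a two-form back to a Kähler form is open. -/
theorem nhds_le_map_of_pullsBackAt {Θ : TwoForm n X} (hΩ : Ω.IsKaehler) {ψ : X → X} {x : X}
    (hψ : ContMDiffAt 𝓘(ℝ, CSpace n) 𝓘(ℝ, CSpace n) ∞ ψ x) (hp : PullsBackAt Ω Θ ψ x) :
    𝓝 (ψ x) ≤ Filter.map ψ (𝓝 x) := by
  set e := chartAt (CSpace n) x
  set e' := chartAt (CSpace n) (ψ x)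
  have hxe : x ∈ e.source := mem_chart_source _ x
  have hxe' : ψ x ∈ e'.source := mem_chart_source _ (ψ x)
  set f : CSpace n → CSpace n := fun y => e' (ψ (e.symm y)) with hf
  have hfs : ContDiffAt ℝ ∞ f (e x) := by
    have := (contMDiffAt_iff.1 hψ).2
    simp only [mfld_simps, contDiffWithinAt_univ] at this
    exact this
  have hfd : fderiv ℝ f (e x) = realDeriv (CSpace n) (CSpace n) ψ x := by
    have h1 := (hψ.mdifferentiableAt (by simp)).hasMFDerivAt
    have h2 : HasFDerivWithinAt f (realDeriv (CSpace n) (CSpace n) ψ x) (range id) (e x) := h1.2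
    rw [range_id, hasFDerivWithinAt_univ] at h2
    exact h2.fderiv
  -- A vector killed by the differential would be killed by the pulled-back form, which is positive
  -- on `(v, Jv)`. Injectivity in equal dimensions allows the inverse function theorem.
  have hinj : Function.Injective (fderiv ℝ f (e x)) := by
    rw [injective_iff_map_eq_zero]
    intro v hv
    rw [hfd] at hv
    by_contra hne
    have h1 := hΩ.pos x v hne
    have h2 := hp v (complexStructure n x v)
    rw [hv] at h2
    have h3 : Θ (ψ x) ![(0 : CSpace n), realDeriv (CSpace n) (CSpace n) ψ x
        (complexStructure n x v)] = 0 :=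
      (Θ (ψ x)).map_coord_zero (m := ![(0 : CSpace n), realDeriv (CSpace n) (CSpace n) ψ x
        (complexStructure n x v)]) 0 rfl
    have h4 : Ω x ![v, complexStructure n x v] = 0 := h2.symm.trans h3
    exact absurd h4 h1.ne'
  let L : CSpace n ≃L[ℝ] CSpace n :=
    (LinearEquiv.ofInjectiveEndo (fderiv ℝ f (e x) : CSpace n →ₗ[ℝ] CSpace n)
      hinj).toContinuousLinearEquiv
  have hL : HasStrictFDerivAt f (L : CSpace n →L[ℝ] CSpace n) (e x) :=
    hfs.hasStrictFDerivAt (by simp)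
  have hmap : Filter.map f (𝓝 (e x)) = 𝓝 (f (e x)) := hL.map_nhds_eq_of_equiv
  have hfx : f (e x) = e' (ψ x) := by simp only [hf]; rw [e.left_inv hxe]
  have hev : ψ =ᶠ[𝓝 x] fun z => e'.symm (f (e z)) := by
    filter_upwards [e.open_source.mem_nhds hxe,
      hψ.continuousAt.eventually (e'.open_source.mem_nhds hxe')] with z hz hz'
    simp only [hf]
    rw [e.left_inv hz, e'.left_inv hz']
  rw [Filter.map_congr hev]
  have h1 : Filter.map (fun z => e'.symm (f (e z))) (𝓝 x)
      = Filter.map e'.symm (Filter.map f (Filter.map e (𝓝 x))) := by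
    rw [Filter.map_map, Filter.map_map]; rfl
  rw [h1, e.map_nhds_eq hxe, hmap, hfx, e'.symm.map_nhds_eq (e'.map_source hxe'),
    e'.left_inv hxe']

variable [IsManifold 𝓘(ℂ, CSpace n) ω X]

/-- Near a compact set disjoint from `D` the flow exists for a uniform time. -/
theorem MoserData.exists_uniform_flow (h : MoserData Ω β D P) {C : Set X} (hC : IsCompact C)
    (hCD : Disjoint C D) (m : ℕ) :
    ∃ δ > 0, ∀ q ∈ Icc (0 : ℝ) 1 ×ˢ C, ∀ t, q.1 ≤ t → t ≤ q.1 + δ →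
      ∃ φ : X → X, ∀ᶠ x in 𝓝 q.2, IsFlowMapAt Ω β D P m q.1 t φ x := by
  refine (isCompact_Icc.prod hC).induction_on (p := fun S : Set (ℝ × X) => ∃ δ > 0, ∀ q ∈ S,
    ∀ t, q.1 ≤ t → t ≤ q.1 + δ → ∃ φ : X → X, ∀ᶠ x in 𝓝 q.2, IsFlowMapAt Ω β D P m q.1 t φ x)
    ⟨1, one_pos, by simp⟩ ?_ ?_ ?_
  · rintro S S' hSS ⟨δ, hδ, hS⟩
    exact ⟨δ, hδ, fun q hq => hS q (hSS hq)⟩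
  · rintro S S' ⟨δ, hδ, hS⟩ ⟨δ', hδ', hS'⟩
    refine ⟨min δ δ', lt_min hδ hδ', fun q hq t ht ht' => ?_⟩
    rcases hq with hq | hq
    · exact hS q hq t ht (ht'.trans (by linarith [min_le_left δ δ']))
    · exact hS' q hq t ht (ht'.trans (by linarith [min_le_right δ δ']))
  · rintro ⟨t₀, p⟩ ⟨ht₀, hp⟩
    obtain ⟨δ, hδ, V, hV, hflow⟩ := h.exists_local_flow (Ioo_of_Icc_zero_one ht₀)
      (Set.disjoint_left.1 hCD hp) m
    -- Half of `δ` for the starting time and half for the duration keep both times in the ball of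
    -- radius `δ`.
    refine ⟨Metric.ball t₀ (δ / 2) ×ˢ interior V, mem_nhdsWithin_of_mem_nhds
      ((Metric.isOpen_ball.prod isOpen_interior).mem_nhds
        ⟨Metric.mem_ball_self (by linarith), mem_interior_iff_mem_nhds.2 hV⟩), δ / 2,
      by linarith, ?_⟩
    rintro ⟨s, x⟩ ⟨hs, hx⟩ t hst hts
    simp only [Metric.mem_ball, Real.dist_eq, abs_lt] at hs hst hts
    obtain ⟨φ, hφ⟩ := hflow s (by
        simp only [Metric.mem_ball, Real.dist_eq, abs_lt]; constructor <;> linarith [hs.1, hs.2]) t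
      (by simp only [Metric.mem_ball, Real.dist_eq, abs_lt]; constructor <;> linarith [hs.1, hs.2])
    exact ⟨φ, Filter.eventually_of_mem (mem_interior_iff_mem_nhds.1 hx) hφ⟩

variable [T2Space X]

/-- A flow line starting at `x₀` stays in a compact subset of the complement of `D`. -/
theorem MoserData.flowLine_mem (h : MoserData Ω β D P) {K : Set X} (hK : IsClosed K)
    (hP : ∀ x ∉ K, P x = 0) {γ : ℝ → X} {t : ℝ} (ht : t ∈ Icc (0 : ℝ) 1)
    (hγ : IsFlowLine Ω β D P γ 0 t) : γ t ∈ insert (γ 0) (K ∩ {x | x ∉ D ∧ P x ≤ P (γ 0)}) := by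
  have hsub : Icc 0 t ⊆ Ioo (-1 : ℝ) 2 := fun r hr =>
    Ioo_of_Icc_zero_one ⟨hr.1, hr.2.trans ht.2⟩
  have h0 : (0 : ℝ) ∈ Icc 0 t := left_mem_Icc.2 ht.1
  have h1 : t ∈ Icc 0 t := right_mem_Icc.2 ht.1
  by_cases hx : γ t ∈ K
  · exact Or.inr ⟨hx, hγ.notMem t h1, h.antitoneOn_potential hsub hγ h0 h1 ht.1⟩
  -- The field vanishes off `K`, so the constant curve at the endpoint is a flow line; by uniqueness
  -- the given flow line was constant all along.
  · refine Or.inl ?_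
    exact (h.flowLine_unique hsub hγ (isFlowLine_const hK hP hx (hγ.notMem t h1) 0 t) h1 rfl
      h0).symm

/-- The Moser flow exists up to time one. -/
theorem MoserData.exists_flow (h : MoserData Ω β D P) {K : Set X} (hK : IsCompact K)
    (hP : ∀ x ∉ K, P x = 0) (hopen : ∀ c : ℝ, IsOpen (D ∪ {x | c < P x})) {x₀ : X} (hx₀ : x₀ ∉ D)
    {m : ℕ} (hm : 1 ≤ m) :
    ∃ φ : X → X, ∀ᶠ x in 𝓝 x₀, IsFlowMapAt Ω β D P m 0 1 φ x := by
  -- This set traps the flow line through `x₀` by `flowLine_mem`. It is compact because sublevel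
  -- sets of `P` off `D` are closed in X, which is where the blow-up of `P` along `D` enters.
  set C : Set X := insert x₀ (K ∩ {x | x ∉ D ∧ P x ≤ P x₀}) with hCdef
  have hCcl : IsClosed {x | x ∉ D ∧ P x ≤ P x₀} := by
    have := (hopen (P x₀)).isClosed_compl
    convert this using 1
    ext x
    simp
  have hC : IsCompact C := (hK.inter_right hCcl).insert x₀
  have hCD : Disjoint C D := by
    rw [Set.disjoint_left]
    rintro x (rfl | hx)
    · exact hx₀
    · exact hx.2.1
  obtain ⟨δ, hδ, hflow⟩ := h.exists_uniform_flow hC hCD m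
  -- Divide the unit interval into `N + 1` steps, each shorter than the uniform existence time.
  obtain ⟨N, hN⟩ := exists_nat_one_div_lt hδ
  have hN0 : (0 : ℝ) < N + 1 := by positivity
  have key : ∀ k : ℕ, k ≤ N + 1 → ∃ φ : X → X, ∀ᶠ x in 𝓝 x₀,
      IsFlowMapAt Ω β D P m 0 (k / (N + 1)) φ x := by
    intro k
    induction k with
    | zero =>
      intro _
      simpa using hflow (0, x₀) ⟨by simp, mem_insert _ _⟩ 0 le_rfl (by simpa using hδ.le)
    | succ k ih =>
      intro hk
      obtain ⟨φ, hφ⟩ := ih (by omega)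
      have hk' : (k : ℝ) + 1 ≤ N + 1 := by exact_mod_cast hk
      have hk01 : (k / (N + 1) : ℝ) ∈ Icc (0 : ℝ) 1 :=
        ⟨by positivity, (div_le_one hN0).2 (by linarith)⟩
      have hmemC : φ x₀ ∈ C := by
        obtain ⟨γ, hγ, h0, h1⟩ := hφ.self_of_nhds.2.2
        have := h.flowLine_mem hK.isClosed hP hk01 hγ
        rwa [h0, h1] at this
      have hstep : ((k + 1 : ℕ) / (N + 1) : ℝ) = k / (N + 1) + 1 / (N + 1) := by
        push_cast; ring
      obtain ⟨φ', hφ'⟩ := hflow (k / (N + 1), φ x₀) ⟨hk01, hmemC⟩ ((k + 1 : ℕ) / (N + 1))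
        (by simp only [hstep]; linarith [one_div_pos.2 hN0]) (by simp only [hstep]; linarith)
      refine ⟨φ' ∘ φ, ?_⟩
      filter_upwards [hφ, hφ.self_of_nhds.1.continuousAt.eventually hφ'] with x hx hx'
      exact hx.comp hm hk01.1 (by rw [hstep]; linarith [one_div_pos.2 hN0]) hx'
  obtain ⟨φ, hφ⟩ := key (N + 1) le_rfl
  refine ⟨φ, ?_⟩
  have : (((N + 1 : ℕ) : ℝ) / (N + 1)) = 1 := by push_cast; exact div_self hN0.ne'
  rwa [this] at hφ

/-- The time-one map of the Moser flow is a symplectic embedding. -/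
theorem MoserData.exists_symplecticEmbedding (h : MoserData Ω β D P) {K : Set X}
    (hK : IsCompact K) (hP : ∀ x ∉ K, P x = 0) (hopen : ∀ c : ℝ, IsOpen (D ∪ {x | c < P x})) :
    ∃ ψ : X → X, IsSymplecticEmbedding Ω (Ω.path β 1) Dᶜ Dᶜ ψ ∧
      (∀ x ∉ D, ∃ γ : ℝ → X, IsFlowLine Ω β D P γ 0 1 ∧ γ 0 = x ∧ γ 1 = ψ x) ∧
      ∀ x ∉ D, x ∉ K → ψ x = x := by
  have hex : ∀ x, ∃ γ : ℝ → X, x ∉ D → IsFlowLine Ω β D P γ 0 1 ∧ γ 0 = x := by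
    intro x
    by_cases hx : x ∈ D
    · exact ⟨fun _ => x, fun h' => absurd hx h'⟩
    · obtain ⟨φ, hφ⟩ := h.exists_flow hK hP hopen hx (m := 1) le_rfl
      obtain ⟨γ, hγ, h0, -⟩ := hφ.self_of_nhds.2.2
      exact ⟨γ, fun _ => ⟨hγ, h0⟩⟩
  choose Γ hΓ using hex
  -- The flow lines are chosen point by point; uniqueness (`hend`) shows that `ψ` agrees locally
  -- with the regular flow maps of every class `C^m`.
  set ψ : X → X := fun x => Γ x 1 with hψdef
  have hsub : Icc (0 : ℝ) 1 ⊆ Ioo (-1 : ℝ) 2 := fun r hr => Ioo_of_Icc_zero_one hr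
  have h0mem : (0 : ℝ) ∈ Icc (0 : ℝ) 1 := by simp
  have h1mem : (1 : ℝ) ∈ Icc (0 : ℝ) 1 := by simp
  have hDo : IsOpen Dᶜ := h.isClosed.isOpen_compl
  have hend : ∀ x ∉ D, ∀ γ, IsFlowLine Ω β D P γ 0 1 → γ 0 = x → γ 1 = ψ x := by
    intro x hx γ hγ h0
    exact h.flowLine_unique hsub hγ (hΓ x hx).1 h0mem (h0.trans (hΓ x hx).2.symm) h1mem
  have hloc : ∀ x ∉ D, ∀ m : ℕ, 1 ≤ m → ∃ φ : X → X, ψ =ᶠ[𝓝 x] φ ∧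
      IsFlowMapAt Ω β D P m 0 1 φ x := by
    intro x hx m hm
    obtain ⟨φ, hφ⟩ := h.exists_flow hK hP hopen hx hm
    refine ⟨φ, ?_, hφ.self_of_nhds⟩
    filter_upwards [hφ, hDo.mem_nhds hx] with z hz hzD
    obtain ⟨γ, hγ, h0, h1⟩ := hz.2.2
    rw [← hend z hzD γ hγ h0, h1]
  have hsmooth : ∀ x ∉ D, ContMDiffAt 𝓘(ℝ, CSpace n) 𝓘(ℝ, CSpace n) ∞ ψ x := by
    intro x hx
    refine contMDiffAt_infty.2 fun m => ?_
    obtain ⟨φ, hφ, hf⟩ := hloc x hx (m + 1) (by omega)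
    exact (hf.1.congr_of_eventuallyEq hφ).of_le (by exact_mod_cast Nat.le_succ m)
  have hpull : ∀ x ∉ D, PullsBackAt Ω (Ω.path β 1) ψ x := by
    intro x hx u v
    obtain ⟨φ, hφ, hf⟩ := hloc x hx 1 le_rfl
    have h1 : realDeriv (CSpace n) (CSpace n) ψ x = realDeriv (CSpace n) (CSpace n) φ x :=
      hφ.mfderiv_eq
    rw [h1, hφ.self_of_nhds, hf.2.1 u v]
    change Ω x ![u, v] + 0 * β x ![u, v] = Ω x ![u, v]
    rw [zero_mul, add_zero]
  refine ⟨ψ, ⟨fun x hx => (hsmooth x hx).contMDiffWithinAt, ?_, ?_, fun x hx u v => hpull x hx u v⟩,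
    fun x hx => ⟨Γ x, (hΓ x hx).1, (hΓ x hx).2, rfl⟩, ?_⟩
  · exact fun x hx => (hΓ x hx).1.notMem 1 h1mem
  · refine (Topology.IsOpenEmbedding.of_continuous_injective_isOpenMap ?_ ?_ ?_).isEmbedding
    · exact continuousOn_iff_continuous_domRestrict.1 fun x hx =>
        (hsmooth x hx).continuousAt.continuousWithinAt
    · rintro ⟨x, hx⟩ ⟨y, hy⟩ hxy
      have hxy' : Γ x 1 = Γ y 1 := hxy
      -- Flow lines that meet at time one coincide at time zero.
      have := h.flowLine_unique hsub (hΓ x hx).1 (hΓ y hy).1 h1mem hxy' h0mem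
      rw [(hΓ x hx).2, (hΓ y hy).2] at this
      exact Subtype.ext this
    · rw [isOpenMap_iff_nhds_le]
      rintro ⟨x, hx⟩
      have h1 : Filter.map (Dᶜ.domRestrict ψ) (𝓝 ⟨x, hx⟩) = Filter.map ψ (𝓝 x) := by
        have := hDo.isOpenEmbedding_subtypeVal.map_nhds_eq ⟨x, hx⟩
        rw [← this, Filter.map_map]
        rfl
      rw [h1]
      exact nhds_le_map_of_pullsBackAt h.kaehler (hsmooth x hx) (hpull x hx)
  · intro x hx hxK
    exact (hend x hx _ (isFlowLine_const hK.isClosed hP hxK hx 0 1) rfl).symm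

end GlobalFlow

/-! ### Sums of logarithms of coordinates -/

section LogSum

open Finset

theorem ddc_sum_eq_zero {E ι : Type*} [NormedAddCommGroup E] [NormedSpace ℝ E] {J : E →L[ℝ] E}
    {y : E} {f : ι → E → ℝ} (s : Finset ι) (hf : ∀ i ∈ s, ContDiffAt ℝ 2 (f i) y)
    (h : ∀ i ∈ s, ddc J (f i) y = 0) : ddc J (fun z => ∑ i ∈ s, f i z) y = 0 := by
  classical
  induction s using Finset.induction_on with
  | empty => simpa using ddc_const_mul (J := J) (y := y) (f := fun _ => 0) 0 contDiffAt_const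
  | insert i s hi ih =>
    have hi' := hf i (mem_insert_self i s)
    have h1 := ih (fun j hj => hf j (mem_insert_of_mem hj)) fun j hj => h j (mem_insert_of_mem hj)
    -- The sum is written as a difference, so that `ddc_sub` and `ddc_const_mul` suffice.
    have h2 : (fun z => ∑ j ∈ insert i s, f j z)
        = fun z => (∑ j ∈ s, f j z) - (-1) * f i z := by
      ext z
      rw [sum_insert hi]
      ring
    rw [h2, ddc_sub (ContDiffAt.sum fun j hj => hf j (mem_insert_of_mem hj))
      (contDiffAt_const.mul hi'), h1, ddc_const_mul _ hi', h i (mem_insert_self i s)]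
    simp

variable {n : ℕ}

/-- The weighted sum of the logarithms of the coordinates. -/
def logSum (a : Fin n → ℝ) (y : CSpace n) : ℝ := ∑ k, a k * Real.log ‖y k‖

theorem logSum_const_mul (c : ℝ) (a : Fin n → ℝ) (y : CSpace n) :
    logSum (fun k => c * a k) y = c * logSum a y := by
  simp only [logSum, mul_sum, mul_assoc]

variable {a : Fin n → ℝ} {y : CSpace n}

theorem contDiffAt_logSum_term (hy : ∀ k, a k ≠ 0 → y k ≠ 0) (k : Fin n) :
    ContDiffAt ℝ ∞ (fun y : CSpace n => a k * Real.log ‖y k‖) y := by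
  by_cases hk : a k = 0
  · exact (contDiffAt_const (c := (0 : ℝ))).congr_of_eventuallyEq
      (Filter.Eventually.of_forall fun z => by simp [hk])
  · exact contDiffAt_const.mul (contDiffAt_log_coord (hy k hk))

theorem contDiffAt_logSum (hy : ∀ k, a k ≠ 0 → y k ≠ 0) : ContDiffAt ℝ ∞ (logSum a) y :=
  ContDiffAt.sum fun k _ => contDiffAt_logSum_term hy k

theorem ddc_logSum (hy : ∀ k, a k ≠ 0 → y k ≠ 0) : ddc (stdJ n) (logSum a) y = 0 := by
  have h1 : logSum a = fun y => ∑ k, a k * Real.log ‖y k‖ := rfl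
  rw [h1]
  refine ddc_sum_eq_zero (y := y) (f := fun k (y : CSpace n) => a k * Real.log ‖y k‖) univ
    (fun k _ => (contDiffAt_logSum_term hy k).of_le two_le_infty) fun k _ => ?_
  by_cases hk : a k = 0
  · simpa [hk] using ddc_const_mul (J := stdJ n) (y := y) (f := fun _ => 0) 0 contDiffAt_const
  · rw [ddc_const_mul _ ((contDiffAt_log_coord (hy k hk)).of_le two_le_infty),
      ddc_log_coord (hy k hk), smul_zero]

theorem fderiv_logSum (hy : ∀ k, a k ≠ 0 → y k ≠ 0) (u : CSpace n) :
    fderiv ℝ (logSum a) y u = ∑ k, a k * (u k * (y k)⁻¹).re := by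
  have h1 : logSum a = fun y => ∑ k, a k * Real.log ‖y k‖ := rfl
  rw [h1, fderiv_fun_sum fun k _ => (contDiffAt_logSum_term hy k).differentiableAt (by simp),
    _root_.sum_apply]
  refine sum_congr rfl fun k _ => ?_
  by_cases hk : a k = 0
  · simp [hk]
  · rw [fderiv_const_mul ((contDiffAt_log_coord (hy k hk)).differentiableAt (by simp)),
      _root_.smul_apply, fderiv_log_coord (hy k hk), smul_eq_mul]

theorem norm_coord_le (y : CSpace n) (k : Fin n) : ‖y k‖ ≤ ‖y‖ := PiLp.norm_apply_le y k

/-- In the unit ball every term is at most zero, so the sum is bounded above by any single one. This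
makes the potential blow up as soon as one weighted coordinate tends to zero. -/
theorem logSum_le (ha : ∀ k, 0 ≤ a k) (hy : ‖y‖ ≤ 1) (k : Fin n) :
    logSum a y ≤ a k * Real.log ‖y k‖ := by
  have h : ∀ j, a j * Real.log ‖y j‖ ≤ 0 := fun j => mul_nonpos_of_nonneg_of_nonpos (ha j)
    (Real.log_nonpos (norm_nonneg _) ((norm_coord_le y j).trans hy))
  rw [logSum, ← add_sum_erase univ (fun j => a j * Real.log ‖y j‖) (mem_univ k)]
  have := sum_nonpos fun j (_ : j ∈ univ.erase k) => h j
  linarith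

/-- The smallest coordinate of positive weight has the largest logarithm in absolute value, and `r
|log r| ≤ 1` for `0 < r ≤ 1`. -/
theorem abs_logSum_mul_le (ha : ∀ k, 0 ≤ a k) (hy : ‖y‖ ≤ 1) {k : Fin n} (hk : y k ≠ 0)
    (hmin : ∀ j, 0 < a j → ‖y k‖ ≤ ‖y j‖) : |logSum a y| * ‖y k‖ ≤ ∑ j, a j := by
  have hk0 : 0 < ‖y k‖ := norm_pos_iff.2 hk
  have h1 : |logSum a y| ≤ ∑ j, a j * |Real.log ‖y k‖| := by
    refine (abs_sum_le_sum_abs _ _).trans (sum_le_sum fun j _ => ?_)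
    rw [abs_mul, abs_of_nonneg (ha j)]
    rcases (ha j).eq_or_lt with hj | hj
    · simp [← hj]
    · refine mul_le_mul_of_nonneg_left ?_ (ha j)
      rw [abs_of_nonpos (Real.log_nonpos (norm_nonneg _) ((norm_coord_le y j).trans hy)),
        abs_of_nonpos (Real.log_nonpos (norm_nonneg _) ((norm_coord_le y k).trans hy))]
      exact neg_le_neg (Real.log_le_log hk0 (hmin j hj))
  have h2 := (Real.abs_log_mul_self_lt ‖y k‖ hk0 ((norm_coord_le y k).trans hy)).le
  rw [abs_mul, abs_of_pos hk0] at h2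
  calc |logSum a y| * ‖y k‖ ≤ (∑ j, a j * |Real.log ‖y k‖|) * ‖y k‖ :=
        mul_le_mul_of_nonneg_right h1 hk0.le
    _ = (∑ j, a j) * (|Real.log ‖y k‖| * ‖y k‖) := by rw [← sum_mul]; ring
    _ ≤ (∑ j, a j) * 1 := mul_le_mul_of_nonneg_left h2 (sum_nonneg fun j _ => ha j)
    _ = _ := mul_one _

/-- Near the coordinate hyperplanes, a smooth function minus a sum of logarithms has a large
derivative in the direction of the smallest coordinate. -/
theorem exists_steep_direction (ha : ∀ k, 0 ≤ a k) {m : ℝ} (hm : 0 < m)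
    (hma : ∀ k, 0 < a k → m ≤ a k) (hex : ∃ k, 0 < a k) (hy : ∀ k, a k ≠ 0 → y k ≠ 0)
    (hy1 : ‖y‖ ≤ 1) {s S L : ℝ} {l : CSpace n →L[ℝ] ℝ} (hs : |s| ≤ S) (hl : ‖l‖ ≤ L)
    (hLy : L * ‖y‖ ≤ m / 2) :
    ∃ u : CSpace n, u ≠ 0 ∧ ∀ M b : ℝ, 0 ≤ M → b ≤ M * ‖u‖ ^ 2 →
      m ^ 2 * ((s - logSum a y) ^ 2 * b) ≤
        4 * ((S + ∑ k, a k) ^ 2 * M) * (l u - fderiv ℝ (logSum a) y u) ^ 2 := by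
  obtain ⟨k₀, hk₀⟩ := hex
  obtain ⟨k, hk, hmin⟩ := exists_min_image (univ.filter fun k => 0 < a k) (fun k => ‖y k‖)
    ⟨k₀, by simpa using hk₀⟩
  simp only [mem_filter, Finset.mem_univ, true_and] at hk hmin
  have hyk : y k ≠ 0 := hy k hk.ne'
  have hu : ‖(EuclideanSpace.single k (y k) : CSpace n)‖ = ‖y k‖ := by simp
  -- For `u = y_k e_k` the derivative of `log |y_k|` is `1`, so that of the log sum is the weight `a
  -- k`. Meanwhile `‖u‖ = |y_k|` is so small that `P² ‖u‖²` stays bounded.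
  refine ⟨EuclideanSpace.single k (y k), fun h => hyk (by simpa using h), fun M b hM hb => ?_⟩
  have h1 : fderiv ℝ (logSum a) y (EuclideanSpace.single k (y k)) = a k := by
    rw [fderiv_logSum hy, sum_eq_single k]
    · simp [hyk]
    · intro j _ hj
      simp [hj]
    · simp
  rw [h1]
  rw [hu] at hb
  set l₀ := l (EuclideanSpace.single k (y k)) with hl₀
  have h2 : |l₀| ≤ m / 2 := by
    have := l.le_opNorm (EuclideanSpace.single k (y k))
    rw [hu, Real.norm_eq_abs] at this
    refine this.trans ((mul_le_mul hl (norm_coord_le y k) (norm_nonneg _)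
      ((norm_nonneg l).trans hl)).trans hLy)
  have h3 : (m / 2) ^ 2 ≤ (l₀ - a k) ^ 2 := by
    -- The smooth part contributes at most `m / 2`, and the weight is at least `m`; the factor `4`
    -- in the statement comes from `(m / 2)²`.
    have := hma k hk
    have := (abs_le.1 h2).2
    nlinarith
  have hA : 0 ≤ ∑ j, a j := sum_nonneg fun j _ => ha j
  have h4 : |s - logSum a y| * ‖y k‖ ≤ S + ∑ j, a j := by
    have h5 := abs_logSum_mul_le ha hy1 hyk hmin
    have h6 : |s - logSum a y| ≤ |s| + |logSum a y| := abs_sub _ _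
    have h7 : ‖y k‖ ≤ 1 := (norm_coord_le y k).trans hy1
    nlinarith [norm_nonneg (y k), abs_nonneg s]
  have h5 : (s - logSum a y) ^ 2 * ‖y k‖ ^ 2 ≤ (S + ∑ j, a j) ^ 2 := by
    rw [← sq_abs (s - logSum a y), ← mul_pow]
    exact pow_le_pow_left₀ (by positivity) h4 2
  have h6 : (s - logSum a y) ^ 2 * b ≤ (S + ∑ j, a j) ^ 2 * M :=
    calc (s - logSum a y) ^ 2 * b ≤ (s - logSum a y) ^ 2 * (M * ‖y k‖ ^ 2) :=
          mul_le_mul_of_nonneg_left hb (sq_nonneg _)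
      _ = M * ((s - logSum a y) ^ 2 * ‖y k‖ ^ 2) := by ring
      _ ≤ M * (S + ∑ j, a j) ^ 2 := mul_le_mul_of_nonneg_left h5 hM
      _ = _ := mul_comm _ _
  have h7 : 0 ≤ (S + ∑ j, a j) ^ 2 * M := by positivity
  calc m ^ 2 * ((s - logSum a y) ^ 2 * b) ≤ m ^ 2 * ((S + ∑ j, a j) ^ 2 * M) :=
        mul_le_mul_of_nonneg_left h6 (sq_nonneg _)
    _ = 4 * ((S + ∑ k, a k) ^ 2 * M) * (m / 2) ^ 2 := by ring
    _ ≤ _ := mul_le_mul_of_nonneg_left h3 (by positivity)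

end LogSum

/-! ### Functions with logarithmic poles -/

section LogPoles

open Set

variable {n : ℕ} {X : Type*} [TopologicalSpace X] [ChartedSpace (CSpace n) X]

/-- On the open set `W`, the function `P` is a smooth function minus a sum of logarithms of the
coordinates of the chart `z`, with poles exactly along `D`. -/
structure IsLogChart (D : Set X) (P : X → ℝ) (z : OpenPartialHomeomorph X (CSpace n))
    (a : Fin n → ℝ) (W : Set X) (s : X → ℝ) : Prop where
  mem_holAtlas : z ∈ holAtlas n X
  nonneg : ∀ k, 0 ≤ a k
  isOpen : IsOpen W
  subset_source : W ⊆ z.source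
  smooth : ContMDiffOn 𝓘(ℝ, CSpace n) 𝓘(ℝ) ∞ s W
  mem_iff : ∀ x ∈ W, x ∈ D ↔ ∃ k, 0 < a k ∧ z x k = 0
  eq_sub : ∀ x ∈ W, x ∉ D → P x = s x - logSum a (z x)

variable (n) in
/-- A function that is smooth off `D`, with logarithmic poles along `D`. -/
structure HasLogPoles (D : Set X) (P : X → ℝ) : Prop where
  smooth : ContMDiffOn 𝓘(ℝ, CSpace n) 𝓘(ℝ) ∞ P Dᶜ
  exists_chart : ∀ q ∈ D, ∃ (z : OpenPartialHomeomorph X (CSpace n)) (a : Fin n → ℝ) (W : Set X)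
    (s : X → ℝ), IsLogChart D P z a W s ∧ q ∈ W ∧ z q = 0

variable {D : Set X} {P : X → ℝ} {z : OpenPartialHomeomorph X (CSpace n)} {a : Fin n → ℝ}
  {W : Set X} {s : X → ℝ}

namespace IsLogChart

theorem coord_ne_zero (h : IsLogChart D P z a W s) {x : X} (hx : x ∈ W) (hxD : x ∉ D) (k : Fin n)
    (hk : a k ≠ 0) : z x k ≠ 0 := fun h0 =>
  hxD ((h.mem_iff x hx).2 ⟨k, lt_of_le_of_ne (h.nonneg k) hk.symm, h0⟩)

theorem const_mul (h : IsLogChart D P z a W s) {c : ℝ} (hc : 0 < c) :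
    IsLogChart D (fun x => c * P x) z (fun k => c * a k) W (fun x => c * s x) where
  mem_holAtlas := h.mem_holAtlas
  nonneg k := mul_nonneg hc.le (h.nonneg k)
  isOpen := h.isOpen
  subset_source := h.subset_source
  smooth := contMDiffOn_const.mul h.smooth
  mem_iff x hx := by
    rw [h.mem_iff x hx]
    simp [hc]
  eq_sub x hx hxD := by
    rw [h.eq_sub x hx hxD, logSum_const_mul]
    ring

theorem eventuallyEq (h : IsLogChart D P z a W s) (hD : IsClosed D) {x : X} (hx : x ∈ W)
    (hxD : x ∉ D) : (fun y => P (z.symm y)) =ᶠ[𝓝 (z x)] fun y => s (z.symm y) - logSum a y := by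
  have hxz := h.subset_source hx
  have hW : W ∩ Dᶜ ∈ 𝓝 (z.symm (z x)) := by
    rw [z.left_inv hxz]
    exact (h.isOpen.inter hD.isOpen_compl).mem_nhds ⟨hx, hxD⟩
  filter_upwards [(z.continuousAt_symm (z.map_source hxz)).eventually hW,
    z.open_target.mem_nhds (z.map_source hxz)] with y hy hyt
  rw [h.eq_sub _ hy.1 hy.2, z.right_inv hyt]

theorem contDiffAt (h : IsLogChart D P z a W s) {x : X} (hx : x ∈ W) :
    ContDiffAt ℝ ∞ (fun y => s (z.symm y)) (z x) := by
  have hxz := h.subset_source hx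
  exact contDiffAt_comp_symm h.mem_holAtlas (z.map_source hxz)
    (by rw [z.left_inv hxz]; exact h.smooth.contMDiffAt (h.isOpen.mem_nhds hx))

theorem ddc_eq (h : IsLogChart D P z a W s) (hD : IsClosed D) {x : X} (hx : x ∈ W)
    (hxD : x ∉ D) : ddc (stdJ n) (fun y => P (z.symm y)) (z x)
      = ddc (stdJ n) (fun y => s (z.symm y)) (z x) := by
  have h1 := h.coord_ne_zero hx hxD
  rw [ddc_congr (h.eventuallyEq hD hx hxD), ddc_sub ((h.contDiffAt hx).of_le two_le_infty)
    ((contDiffAt_logSum h1).of_le two_le_infty), ddc_logSum h1, sub_zero]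

theorem fderiv_eq (h : IsLogChart D P z a W s) (hD : IsClosed D) {x : X} (hx : x ∈ W)
    (hxD : x ∉ D) (u : CSpace n) : fderiv ℝ (fun y => P (z.symm y)) (z x) u
      = fderiv ℝ (fun y => s (z.symm y)) (z x) u - fderiv ℝ (logSum a) (z x) u := by
  have h1 := h.coord_ne_zero hx hxD
  rw [(h.eventuallyEq hD hx hxD).fderiv_eq, fderiv_fun_sub
    ((h.contDiffAt hx).differentiableAt (by simp))
    ((contDiffAt_logSum h1).differentiableAt (by simp)), _root_.sub_apply]

end IsLogChart

theorem abs_apply_vec2_le (σ : (CSpace n) [⋀^Fin 2]→L[ℝ] ℝ) (v : CSpace n) :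
    |σ ![v, stdJ n v]| ≤ ‖σ‖ * ‖v‖ ^ 2 := by
  have h := σ.le_opNorm ![v, stdJ n v]
  have h5 : ‖stdJ n v‖ = ‖v‖ := by
    rw [stdJ_apply, norm_smul]
    simp
  rwa [Fin.prod_univ_two, Matrix.cons_val_zero, Matrix.cons_val_one, Matrix.cons_val_zero, h5,
    Real.norm_eq_abs, ← sq] at h

/-- A smooth two-form is locally bounded in every holomorphic chart. -/
theorem TwoForm.IsSmooth.exists_abs_le_inChart [IsManifold 𝓘(ℂ, CSpace n) ω X] {Ω : TwoForm n X}
    (hΩ : Ω.IsSmooth) {e : OpenPartialHomeomorph X (CSpace n)} (he : e ∈ holAtlas n X)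
    {y₀ : CSpace n} (hy₀ : y₀ ∈ e.target) :
    ∃ M : ℝ, ∀ᶠ y in 𝓝 y₀, ∀ u, |Ω.inChart e y ![u, stdJ n u]| ≤ M * ‖u‖ ^ 2 := by
  -- Smoothness of a form is required only in charts of the atlas, whereas `e` is any holomorphic
  -- chart; hence the passage to an atlas chart.
  set e' := chartAt (CSpace n) (e.symm y₀)
  have he'a : e' ∈ atlas (CSpace n) X := chart_mem_atlas _ _
  have he' : e' ∈ holAtlas n X := IsManifold.chart_mem_maximalAtlas _
  have hy' : e.symm y₀ ∈ e'.source := mem_chart_source _ _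
  have hτ := contDiffAt_transition he he' hy₀ hy'
  have h1 : ContinuousAt (fun y => ‖Ω.inChart e' (e' (e.symm y))‖
      * ‖fderiv ℝ (fun y => e' (e.symm y)) y‖ ^ 2) y₀ := by
    have h2 : ContinuousAt (Ω.inChart e') (e' (e.symm y₀)) :=
      ((hΩ e' he'a).contDiffAt (e'.open_target.mem_nhds (e'.map_source hy'))).continuousAt
    have h3 : ContinuousAt (fun y => Ω.inChart e' (e' (e.symm y))) y₀ :=
      ContinuousAt.comp (g := Ω.inChart e') (f := fun y => e' (e.symm y)) h2 hτ.continuousAt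
    exact h3.norm.mul ((hτ.fderiv_right (m := 0) (by simp)).continuousAt.norm.pow 2)
  refine ⟨‖Ω.inChart e' (e' (e.symm y₀))‖ * ‖fderiv ℝ (fun y => e' (e.symm y)) y₀‖ ^ 2 + 1, ?_⟩
  filter_upwards [h1.eventually_lt continuousAt_const (lt_add_one _),
    (isOpen_transition_source e e').mem_nhds (mem_transition_source.2 ⟨hy₀, hy'⟩)] with y hy hys u
  obtain ⟨hyt, hys⟩ := mem_transition_source.1 hys
  rw [Ω.inChart_transition he he' hyt hys, fderiv_transition_stdJ he he' hyt hys]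
  refine le_trans ?_ (mul_le_mul_of_nonneg_right hy.le (sq_nonneg _))
  refine (abs_apply_vec2_le _ _).trans ?_
  rw [mul_assoc]
  refine mul_le_mul_of_nonneg_left ?_ (norm_nonneg _)
  rw [← mul_pow]
  exact pow_le_pow_left₀ (norm_nonneg _) (ContinuousLinearMap.le_opNorm _ _) 2

theorem HasLogPoles.const_mul (h : HasLogPoles n D P) {c : ℝ} (hc : 0 < c) :
    HasLogPoles n D (fun x => c * P x) where
  smooth := contMDiffOn_const.mul h.smooth
  exists_chart q hq := by
    obtain ⟨z, a, W, s, hz, hqW, hz0⟩ := h.exists_chart q hq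
    exact ⟨z, _, W, _, hz.const_mul hc, hqW, hz0⟩

theorem HasLogPoles.hasLocalPotentials (h : HasLogPoles n D P) (hD : IsClosed D) :
    HasLocalPotentials (n := n) D P := by
  intro q
  by_cases hq : q ∈ D
  · obtain ⟨z, a, W, s, hz, hqW, -⟩ := h.exists_chart q hq
    refine ⟨W, hz.isOpen, hqW, s, hz.smooth, fun e he y hy hyW hyD => ?_⟩
    have hys := hz.subset_source hyW
    rw [ddc_transition he hz.mem_holAtlas hy hys
        (h.smooth.contMDiffAt (hD.isOpen_compl.mem_nhds hyD)),
      ddc_transition he hz.mem_holAtlas hy hys (hz.smooth.contMDiffAt (hz.isOpen.mem_nhds hyW)),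
      hz.ddc_eq hD hyW hyD]
  · exact ⟨Dᶜ, hD.isOpen_compl, hq, P, h.smooth, fun _ _ _ _ _ _ => rfl⟩

/-- A function with logarithmic poles tends to infinity along them. -/
theorem HasLogPoles.isOpen_union (h : HasLogPoles n D P) (hD : IsClosed D) (c : ℝ) :
    IsOpen (D ∪ {x | c < P x}) := by
  rw [isOpen_iff_mem_nhds]
  intro q hq
  by_cases hqD : q ∈ D
  · obtain ⟨z, a, W, s, hz, hqW, hz0⟩ := h.exists_chart q hqD
    obtain ⟨k, hk, -⟩ := (hz.mem_iff q hqW).1 hqD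
    have hzc : ContinuousAt z q := z.continuousAt (hz.subset_source hqW)
    have hs : ContinuousAt s q := (hz.smooth.contMDiffAt (hz.isOpen.mem_nhds hqW)).continuousAt
    -- The radius is chosen so that `a_k log |z_k| < s q - 1 - c`; combined with `s x > s q - 1`
    -- this gives `P x > c`.
    have hz1 : ∀ᶠ x in 𝓝 q, ‖z x‖ < min 1 (Real.exp ((s q - 1 - c) / a k)) :=
      hzc.norm.eventually_lt continuousAt_const (by
        rw [hz0, norm_zero]; exact lt_min one_pos (Real.exp_pos _))
    filter_upwards [hz1, hz.isOpen.mem_nhds hqW,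
      continuousAt_const.eventually_lt hs (sub_one_lt (s q))] with x hx hxW hxs
    by_cases hxD : x ∈ D
    · exact Or.inl hxD
    · refine Or.inr ?_
      have h1 := logSum_le hz.nonneg (hx.le.trans (min_le_left _ _)) k
      have h2 : Real.log ‖z x k‖ < (s q - 1 - c) / a k := by
        rw [Real.log_lt_iff_lt_exp (norm_pos_iff.2 (hz.coord_ne_zero hxW hxD k hk.ne'))]
        exact (norm_coord_le _ _).trans_lt (hx.trans_le (min_le_right _ _))
      rw [lt_div_iff₀ hk] at h2
      change c < P x
      rw [hz.eq_sub x hxW hxD]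
      linarith
  · have h1 : ContinuousAt P q :=
      (h.smooth.contMDiffAt (hD.isOpen_compl.mem_nhds hqD)).continuousAt
    have h2 : c < P q := hq.resolve_left hqD
    filter_upwards [continuousAt_const.eventually_lt h1 h2] with x hx
    exact Or.inr hx

/-- A direction in which the differential of the potential is large at the point `x`, compared with
its square times the forms `Ω + t β`. -/
def HasSteepDirection (Ω β : TwoForm n X) (P : X → ℝ) (c : ℝ) (x : X) : Prop :=
  ∃ z ∈ holAtlas n X, x ∈ z.source ∧ ∃ u : CSpace n, u ≠ 0 ∧ ∀ r ∈ Icc (0 : ℝ) 1,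
    c * P x ^ 2 * (Ω.inChart z (z x) + r • β.inChart z (z x)) ![u, stdJ n u] ≤
      fderiv ℝ (fun y => P (z.symm y)) (z x) u ^ 2

variable {Ω β : TwoForm n X}

theorem HasLogPoles.eventually_hasSteepDirection [IsManifold 𝓘(ℂ, CSpace n) ω X]
    (h : HasLogPoles n D P) (hD : IsClosed D) (hΩ : Ω.IsSmooth) (hβ : β.IsSmooth) {q : X}
    (hq : q ∈ D) : ∃ c > 0, ∀ᶠ x in 𝓝 q, x ∉ D → HasSteepDirection Ω β P c x := by
  obtain ⟨z, a, W, s, hz, hqW, hz0⟩ := h.exists_chart q hq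
  obtain ⟨k₀, hk₀, -⟩ := (hz.mem_iff q hqW).1 hq
  have hqz := hz.subset_source hqW
  have hzc : ContinuousAt z q := z.continuousAt hqz
  obtain ⟨k₁, hk₁, hmin⟩ := Finset.exists_min_image (Finset.univ.filter fun k => 0 < a k) a
    ⟨k₀, by simpa using hk₀⟩
  simp only [Finset.mem_filter, Finset.mem_univ, true_and] at hk₁ hmin
  obtain ⟨M₁, hM₁⟩ := hΩ.exists_abs_le_inChart hz.mem_holAtlas (z.map_source hqz)
  obtain ⟨M₂, hM₂⟩ := hβ.exists_abs_le_inChart hz.mem_holAtlas (z.map_source hqz)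
  have hs : ContinuousAt s q := (hz.smooth.contMDiffAt (hz.isOpen.mem_nhds hqW)).continuousAt
  have hds : ContinuousAt (fun x => ‖fderiv ℝ (fun y => s (z.symm y)) (z x)‖) q :=
    (ContinuousAt.comp (g := fderiv ℝ (fun y => s (z.symm y))) (f := z)
      ((hz.contDiffAt hqW).fderiv_right (m := 0) (by simp)).continuousAt hzc).norm
  set S := |s q| + 1 with hS
  set L := ‖fderiv ℝ (fun y => s (z.symm y)) (z q)‖ + 1 with hL
  set M := |M₁| + |M₂| with hM
  have hMnn : 0 ≤ M := by positivity
  have hA : 0 ≤ ∑ k, a k := Finset.sum_nonneg fun k _ => hz.nonneg k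
  have hSpos : 0 < S := by positivity
  set Q := 4 * ((S + ∑ k, a k) ^ 2 * M) with hQ
  have hQnn : 0 ≤ Q := by positivity
  -- `a k₁` is the smallest positive weight; the summand `1` guards against `Q = 0`, since `M` may
  -- vanish.
  refine ⟨a k₁ ^ 2 / (Q + 1), by positivity, ?_⟩
  -- In this ball the differential of the smooth part, bounded by `L`, contributes at most half of
  -- the smallest weight.
  have e1 : ∀ᶠ x in 𝓝 q, ‖z x‖ < min 1 (a k₁ / 2 / L) :=
    hzc.norm.eventually_lt continuousAt_const (by
      rw [hz0, norm_zero]; exact lt_min one_pos (by positivity))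
  filter_upwards [e1, hz.isOpen.mem_nhds hqW, hzc.eventually hM₁, hzc.eventually hM₂,
    hs.abs.eventually_lt continuousAt_const (lt_add_one _),
    hds.eventually_lt continuousAt_const (lt_add_one _)] with x hx1 hxW hx2 hx3 hx4 hx5 hxD
  have hLpos : 0 < L := by positivity
  obtain ⟨u, hu, hest⟩ := exists_steep_direction hz.nonneg hk₁ (fun k hk => hmin k hk) ⟨k₀, hk₀⟩
    (hz.coord_ne_zero hxW hxD) (hx1.le.trans (min_le_left _ _)) hx4.le hx5.le (by
      have := hx1.le.trans (min_le_right _ _)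
      rw [le_div_iff₀ hLpos] at this
      rwa [mul_comm])
  refine ⟨z, hz.mem_holAtlas, hz.subset_source hxW, u, hu, fun r hr => ?_⟩
  have hb : (Ω.inChart z (z x) + r • β.inChart z (z x)) ![u, stdJ n u] ≤ M * ‖u‖ ^ 2 := by
    change Ω.inChart z (z x) ![u, stdJ n u] + r * β.inChart z (z x) ![u, stdJ n u] ≤ _
    have i1 : Ω.inChart z (z x) ![u, stdJ n u] ≤ |M₁| * ‖u‖ ^ 2 :=
      ((le_abs_self _).trans (hx2 u)).trans
        (mul_le_mul_of_nonneg_right (le_abs_self _) (sq_nonneg _))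
    have i2 : β.inChart z (z x) ![u, stdJ n u] ≤ |M₂| * ‖u‖ ^ 2 :=
      ((le_abs_self _).trans (hx3 u)).trans
        (mul_le_mul_of_nonneg_right (le_abs_self _) (sq_nonneg _))
    have i3 : 0 ≤ |M₂| * ‖u‖ ^ 2 := by positivity
    have i4 : r * β.inChart z (z x) ![u, stdJ n u] ≤ |M₂| * ‖u‖ ^ 2 :=
      (mul_le_mul_of_nonneg_left i2 hr.1).trans (mul_le_of_le_one_left i3 hr.2)
    rw [hM, add_mul]
    exact add_le_add i1 i4
  have h1 := hest M _ hMnn hb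
  rw [← hz.fderiv_eq hD hxW hxD, ← hz.eq_sub x hxW hxD] at h1
  rw [div_mul_eq_mul_div, div_mul_eq_mul_div, div_le_iff₀ (by positivity), mul_assoc]
  refine h1.trans ?_
  rw [mul_comm _ (Q + 1)]
  exact mul_le_mul_of_nonneg_right (by linarith) (sq_nonneg _)

end LogPoles

section Bounds

open Set

variable {n : ℕ} {X : Type*} [TopologicalSpace X] [ChartedSpace (CSpace n) X]
  {D : Set X} {P : X → ℝ} {Ω β : TwoForm n X}

theorem HasSteepDirection.mono (hm : MoserData Ω β D P) {c c' : ℝ} (hc : c' ≤ c) {x : X}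
    (h : HasSteepDirection Ω β P c x) : HasSteepDirection Ω β P c' x := by
  obtain ⟨z, hz, hxz, u, hu, hu'⟩ := h
  refine ⟨z, hz, hxz, u, hu, fun r hr => le_trans ?_ (hu' r hr)⟩
  exact mul_le_mul_of_nonneg_right (mul_le_mul_of_nonneg_right hc (sq_nonneg _))
    ((hm.tame r (Ioo_of_Icc_zero_one hr) z hz _ (z.map_source hxz)).nonneg u)

/-- The potential decreases at a definite rate along flow lines where there is a steep direction. -/
theorem MoserData.exists_hasDerivWithinAt_le [IsManifold 𝓘(ℂ, CSpace n) ω X]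
    (hm : MoserData Ω β D P) {γ : ℝ → X} (hγ : IsFlowLine Ω β D P γ 0 1) {c r : ℝ}
    (hr : r ∈ Icc (0 : ℝ) 1) (h : HasSteepDirection Ω β P c (γ r)) :
    ∃ d, HasDerivWithinAt (fun r => P (γ r)) d (Icc 0 1) r ∧ c * P (γ r) ^ 2 ≤ -d := by
  obtain ⟨z, hz, hxz, u, hu, hu'⟩ := h
  have hr' := Ioo_of_Icc_zero_one hr
  obtain ⟨d, -, hd, hd'⟩ := hm.exists_hasDerivWithinAt_potential hγ hr hr' hz hxz
  -- Chain the steep direction estimate with the Cauchy–Schwarz estimate and cancel the positive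
  -- number `σ(u, Ju)`, where `σ` is the form at time `r`.
  exact ⟨d, hd, le_of_mul_le_mul_right ((hu' r hr).trans (hd' u))
    (hm.tame r hr' z hz _ (z.map_source hxz) u hu)⟩

theorem HasLogPoles.eventually_nhdsSet_hasSteepDirection [IsManifold 𝓘(ℂ, CSpace n) ω X]
    (h : HasLogPoles n D P) (hm : MoserData Ω β D P) (hβ : β.IsSmooth) (hDc : IsCompact D) :
    ∃ c > 0, ∀ᶠ x in 𝓝ˢ D, x ∉ D → HasSteepDirection Ω β P c x := by
  refine hDc.induction_on (p := fun S => ∃ c > 0, ∀ᶠ x in 𝓝ˢ S, x ∉ D →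
    HasSteepDirection Ω β P c x) ⟨1, one_pos, by simp⟩ ?_ ?_ ?_
  · rintro S S' hSS ⟨c, hc, hS⟩
    exact ⟨c, hc, hS.filter_mono (nhdsSet_mono hSS)⟩
  · rintro S S' ⟨c, hc, hS⟩ ⟨c', hc', hS'⟩
    refine ⟨min c c', lt_min hc hc', ?_⟩
    rw [nhdsSet_union, Filter.eventually_sup]
    exact ⟨hS.mono fun x hx hxD => (hx hxD).mono hm (min_le_left _ _),
      hS'.mono fun x hx hxD => (hx hxD).mono hm (min_le_right _ _)⟩
  · intro q hq
    obtain ⟨c, hc, hx⟩ := h.eventually_hasSteepDirection hm.isClosed hm.kaehler.smooth hβ hq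
    obtain ⟨V, hV, hVo, hqV⟩ := eventually_nhds_iff.1 hx
    exact ⟨V, mem_nhdsWithin_of_mem_nhds (hVo.mem_nhds hqV), c, hc,
      Filter.eventually_of_mem hVo.mem_nhdsSet_self hV⟩

/-- The potential is bounded on the image of the time-one flow. -/
theorem HasLogPoles.exists_flow_bound [IsManifold 𝓘(ℂ, CSpace n) ω X]
    (h : HasLogPoles n D P) (hm : MoserData Ω β D P) (hβ : β.IsSmooth) (hDc : IsCompact D)
    {K : Set X} (hK : IsCompact K) (hP : ∀ x ∉ K, P x = 0) :
    ∃ C, ∀ γ, IsFlowLine Ω β D P γ 0 1 → P (γ 1) ≤ C := by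
  obtain ⟨c, hc, hst⟩ := h.eventually_nhdsSet_hasSteepDirection hm hβ hDc
  obtain ⟨N, hN, hDN, hst⟩ := (eventually_nhdsSet_iff_exists (p := fun x => x ∉ D →
    HasSteepDirection Ω β P c x)).1 hst
  obtain ⟨A, hA⟩ := (hK.diff hN).exists_bound_of_continuousOn (f := P)
    (h.smooth.continuousOn.mono fun x hx hxD => hx.2 (hDN hxD))
  -- Since `|P| ≤ A` on the compact set `K \ N` and `P = 0` off `K`, a value above `|A|` forces the
  -- point into the region `N` with steep directions.
  have hbig : ∀ x ∉ D, |A| < P x → HasSteepDirection Ω β P c x := by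
    intro x hxD hx
    refine hst x ?_ hxD
    by_contra hxN
    by_cases hxK : x ∈ K
    · have := hA x ⟨hxK, hxN⟩
      rw [Real.norm_eq_abs] at this
      linarith [le_abs_self (P x), le_abs_self A]
    · rw [hP x hxK] at hx
      linarith [abs_nonneg A]
  refine ⟨max |A| c⁻¹, fun γ hγ => ?_⟩
  by_contra! hlt
  obtain ⟨hA1, hc1⟩ := max_lt_iff.1 hlt
  have h0 : (0 : ℝ) ∈ Icc (0 : ℝ) 1 := by simp
  have h1 : (1 : ℝ) ∈ Icc (0 : ℝ) 1 := by simp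
  have hsub : Icc (0 : ℝ) 1 ⊆ Ioo (-1 : ℝ) 2 := fun r hr => Ioo_of_Icc_zero_one hr
  have hlarge : ∀ r ∈ Icc (0 : ℝ) 1, |A| < P (γ r) := fun r hr =>
    hA1.trans_le (hm.antitoneOn_potential hsub hγ hr h1 hr.2)
  have hpos : ∀ r ∈ Icc (0 : ℝ) 1, 0 < P (γ r) := fun r hr =>
    (abs_nonneg A).trans_lt (hlarge r hr)
  have hd : ∀ r ∈ Icc (0 : ℝ) 1, ∃ d, HasDerivWithinAt (fun r => P (γ r)) d (Icc 0 1) r ∧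
      c * P (γ r) ^ 2 ≤ -d := fun r hr =>
    hm.exists_hasDerivWithinAt_le hγ hr (hbig _ (hγ.notMem r hr) (hlarge r hr))
  choose! d hd hd' using hd
  -- If `P` ends above the bound, it exceeds `|A|` throughout, since it decreases. Then `P' ≤ -c P²`
  -- makes `1/P - c r` monotone, so `1/P > c` at time one, contrary to `P > 1/c`.
  have hg : ∀ r ∈ Icc (0 : ℝ) 1, HasDerivWithinAt (fun r => (P (γ r))⁻¹ - c * r)
      (-d r / P (γ r) ^ 2 - c * 1) (Icc 0 1) r := fun r hr =>
    ((hd r hr).fun_inv (hpos r hr).ne').fun_sub ((hasDerivWithinAt_id r _).const_mul c)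
  have hmono := monotoneOn_of_hasDerivWithinAt_nonneg (f' := fun r => -d r / P (γ r) ^ 2 - c * 1)
    (convex_Icc (0 : ℝ) 1) (fun r hr => (hg r hr).continuousWithinAt)
    (fun r hr => (hg r (interior_subset hr)).mono interior_subset) (fun r hr => by
      have hr' := interior_subset hr
      rw [mul_one, sub_nonneg, le_div_iff₀ (pow_pos (hpos r hr') 2)]
      exact hd' r hr')
  have h2 := hmono h0 h1 zero_le_one
  simp only [mul_zero, sub_zero, mul_one] at h2
  have h3 : c < (P (γ 1))⁻¹ := by
    linarith [inv_pos.2 (hpos 0 h0)]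
  exact absurd hc1 (not_lt.2 ((le_inv_comm₀ hc (hpos 1 h1)).1 h3.le))

/-- A tame form is bounded below. -/
theorem IsTame.exists_le {E : Type*} [NormedAddCommGroup E] [NormedSpace ℝ E]
    [FiniteDimensional ℝ E] {J : E →L[ℝ] E} {σ : E [⋀^Fin 2]→L[ℝ] ℝ} (h : IsTame J σ) :
    ∃ m > 0, ∀ v, m * ‖v‖ ^ 2 ≤ σ ![v, J v] := by
  have hcont : Continuous fun v => σ ![v, J v] := by
    simp only [← bilinCLM_apply]
    fun_prop
  obtain ⟨m, hm, hm'⟩ := (isCompact_sphere (0 : E) 1).exists_forall_le' hcont.continuousOn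
    (a := 0) fun v hv => h v (by
      rintro rfl
      simp at hv)
  refine ⟨m, hm, fun v => ?_⟩
  rcases eq_or_ne v 0 with rfl | hv
  · simpa using h.nonneg 0
  · have hv' : 0 < ‖v‖ := norm_pos_iff.2 hv
    have h1 := hm' (‖v‖⁻¹ • v) (by simp [norm_smul, hv'.ne'])
    rw [map_smul, ← bilinCLM_apply, map_smul, map_smul, _root_.smul_apply, bilinCLM_apply,
      smul_eq_mul, smul_eq_mul] at h1
    calc m * ‖v‖ ^ 2 ≤ ‖v‖⁻¹ * (‖v‖⁻¹ * σ ![v, J v]) * ‖v‖ ^ 2 :=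
          mul_le_mul_of_nonneg_right h1 (sq_nonneg _)
      _ = σ ![v, J v] := by field_simp

/-- At the point `x`, the form `β` is bounded by `C` times `Ω`. -/
def IsDominatedAt (Ω β : TwoForm n X) (C : ℝ) (x : X) : Prop :=
  ∃ e ∈ holAtlas n X, x ∈ e.source ∧ ∀ v,
    |β.inChart e (e x) ![v, stdJ n v]| ≤ C * Ω.inChart e (e x) ![v, stdJ n v]

theorem IsDominatedAt.abs_le {C : ℝ} {x : X} (h : IsDominatedAt Ω β C x)
    {e : OpenPartialHomeomorph X (CSpace n)} (he : e ∈ holAtlas n X) {y : CSpace n}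
    (hy : y ∈ e.target) (hx : e.symm y = x) (v : CSpace n) :
    |β.inChart e y ![v, stdJ n v]| ≤ C * Ω.inChart e y ![v, stdJ n v] := by
  obtain ⟨e', he', hxe', h'⟩ := h
  subst hx
  rw [β.inChart_transition he he' hy hxe', Ω.inChart_transition he he' hy hxe',
    fderiv_transition_stdJ he he' hy hxe']
  exact h' _

theorem IsDominatedAt.mono (hΩ : Ω.IsKaehler) {C C' : ℝ} (hC : C ≤ C') {x : X}
    (h : IsDominatedAt Ω β C x) : IsDominatedAt Ω β C' x := by
  obtain ⟨e, he, hx, h⟩ := h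
  exact ⟨e, he, hx, fun v => (h v).trans (mul_le_mul_of_nonneg_right hC
    ((hΩ.isTame_inChart he (e.map_source hx)).nonneg v))⟩

/-- The multiple of a two-form. -/
def TwoForm.constSmul (c : ℝ) (β : TwoForm n X) : TwoForm n X :=
  fun x => c • (β x : (CSpace n) [⋀^Fin 2]→L[ℝ] ℝ)

theorem TwoForm.inChart_constSmul (c : ℝ) (β : TwoForm n X)
    (e : OpenPartialHomeomorph X (CSpace n)) (y : CSpace n) :
    (β.constSmul c).inChart e y = c • β.inChart e y := by
  ext v
  rfl

theorem TwoForm.IsLocallyDdc.constSmul (hβ : β.IsLocallyDdc) (c : ℝ) :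
    (β.constSmul c).IsLocallyDdc := by
  intro q
  obtain ⟨W, hW, hqW, f, hf, h⟩ := hβ q
  refine ⟨W, hW, hqW, fun x => c * f x, contMDiffOn_const.mul hf, fun e he y hy hyW => ?_⟩
  rw [TwoForm.inChart_constSmul, h e he y hy hyW, ddc_const_mul _
    ((contDiffAt_comp_symm he hy (hf.contMDiffAt (hW.mem_nhds hyW))).of_le two_le_infty)]

variable [IsManifold 𝓘(ℂ, CSpace n) ω X]

/-- In a chart `Ω(v, Jv)` is at least `m ‖v‖²` at `q`, hence at least half of that nearby, while `β`
is continuous and so locally bounded in norm. -/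
theorem TwoForm.IsKaehler.eventually_isDominatedAt (hΩ : Ω.IsKaehler) (hβ : β.IsLocallyDdc)
    (q : X) : ∃ C > 0, ∀ᶠ x in 𝓝 q, IsDominatedAt Ω β C x := by
  set e := chartAt (CSpace n) q
  have hea : e ∈ atlas (CSpace n) X := chart_mem_atlas _ _
  have he : e ∈ holAtlas n X := IsManifold.chart_mem_maximalAtlas _
  have hq : q ∈ e.source := mem_chart_source _ _
  have hec : ContinuousAt e q := e.continuousAt hq
  obtain ⟨m, hm, hm'⟩ := (hΩ.isTame_inChart he (e.map_source hq)).exists_le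
  have hΩc : ContinuousAt (fun x => Ω.inChart e (e x)) q :=
    ContinuousAt.comp (g := Ω.inChart e) ((hΩ.smooth e hea).contDiffAt
      (e.open_target.mem_nhds (e.map_source hq))).continuousAt hec
  have hβc : ContinuousAt (fun x => β.inChart e (e x)) q :=
    ContinuousAt.comp (g := β.inChart e) (hβ.contDiffAt he (e.map_source hq)).continuousAt hec
  refine ⟨(‖β.inChart e (e q)‖ + 1) / (m / 2), by positivity, ?_⟩
  have h1 : ∀ᶠ x in 𝓝 q, ‖Ω.inChart e (e x) - Ω.inChart e (e q)‖ < m / 2 :=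
    (hΩc.sub continuousAt_const).norm.eventually_lt continuousAt_const (by simpa using hm)
  filter_upwards [h1, hβc.norm.eventually_lt continuousAt_const (lt_add_one _),
    e.open_source.mem_nhds hq] with x hx1 hx2 hxs
  refine ⟨e, he, hxs, fun v => ?_⟩
  have h2 := abs_apply_vec2_le (Ω.inChart e (e x) - Ω.inChart e (e q)) v
  have h3 : (Ω.inChart e (e x) - Ω.inChart e (e q)) ![v, stdJ n v]
      = Ω.inChart e (e x) ![v, stdJ n v] - Ω.inChart e (e q) ![v, stdJ n v] := rfl
  have h4 := (abs_le.1 (h2.trans (mul_le_mul_of_nonneg_right hx1.le (sq_nonneg _)))).1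
  have h5 : m / 2 * ‖v‖ ^ 2 ≤ Ω.inChart e (e x) ![v, stdJ n v] := by
    have := hm' v
    rw [h3] at h4
    linarith
  calc |β.inChart e (e x) ![v, stdJ n v]| ≤ ‖β.inChart e (e x)‖ * ‖v‖ ^ 2 := abs_apply_vec2_le _ v
    _ ≤ (‖β.inChart e (e q)‖ + 1) * ‖v‖ ^ 2 :=
        mul_le_mul_of_nonneg_right hx2.le (sq_nonneg _)
    _ = (‖β.inChart e (e q)‖ + 1) / (m / 2) * (m / 2 * ‖v‖ ^ 2) := by field_simp
    _ ≤ _ := mul_le_mul_of_nonneg_left h5 (by positivity)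

theorem TwoForm.IsKaehler.exists_isDominatedAt (hΩ : Ω.IsKaehler) (hβ : β.IsLocallyDdc)
    {K : Set X} (hK : IsCompact K) : ∃ C > 0, ∀ x ∈ K, IsDominatedAt Ω β C x := by
  refine hK.induction_on (p := fun S => ∃ C > 0, ∀ x ∈ S, IsDominatedAt Ω β C x)
    ⟨1, one_pos, by simp⟩ ?_ ?_ ?_
  · rintro S S' hSS ⟨C, hC, hS⟩
    exact ⟨C, hC, fun x hx => hS x (hSS hx)⟩
  · rintro S S' ⟨C, hC, hS⟩ ⟨C', hC', hS'⟩
    exact ⟨max C C', lt_max_of_lt_left hC, fun x hx => hx.elim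
      (fun hx => (hS x hx).mono hΩ (le_max_left _ _))
      fun hx => (hS' x hx).mono hΩ (le_max_right _ _)⟩
  · intro q _
    obtain ⟨C, hC, h⟩ := hΩ.eventually_isDominatedAt hβ q
    exact ⟨_, mem_nhdsWithin_of_mem_nhds h, C, hC, fun x hx => hx⟩

/-- A function with logarithmic poles and compact support yields, after scaling, the data of the
Moser argument. -/
theorem HasLogPoles.exists_moserData (h : HasLogPoles n D P) (hD : IsClosed D)
    (hDd : Dense Dᶜ) (hΩ : Ω.IsKaehler) {K : Set X} (hK : IsCompact K) (hKc : IsClosed K)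
    (hDK : D ⊆ K) (hP : ∀ x ∉ K, P x = 0) :
    ∃ c > 0, ∃ β, MoserData Ω β D (fun x => c * P x) := by
  obtain ⟨β, hβ, hβP⟩ := exists_ddc_form hDd (h.hasLocalPotentials hD)
  obtain ⟨C, hC, hdom⟩ := hΩ.exists_isDominatedAt hβ hK
  have hβ0 : ∀ e ∈ holAtlas n X, ∀ y ∈ e.target, e.symm y ∉ K → β.inChart e y = 0 := by
    intro e he y hy hyK
    rw [hβP e he y hy fun hD => hyK (hDK hD)]
    have hev : (fun y => P (e.symm y)) =ᶠ[𝓝 y] fun y => 0 * (fun _ => (0 : ℝ)) y := by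
      filter_upwards [(e.continuousAt_symm hy).eventually (hKc.isOpen_compl.mem_nhds hyK)]
        with z hz
      simp [hP _ hz]
    rw [ddc_congr hev, ddc_const_mul _ contDiffAt_const, zero_smul]
  have hc : 0 < (4 * C)⁻¹ := by positivity
  -- With `|t| ≤ 2` and `|β(v, Jv)| ≤ C Ω(v, Jv)`, the factor `1 / (4C)` keeps the perturbation
  -- below half of `Ω`. Off `K` the form `β` vanishes, so a bound on `K` is enough.
  refine ⟨(4 * C)⁻¹, hc, β.constSmul (4 * C)⁻¹, hD, contMDiffOn_const.mul h.smooth, hΩ,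
    hβ.constSmul _, ?_, ?_⟩
  · intro e he y hy hyD
    rw [TwoForm.inChart_constSmul, hβP e he y hy hyD, ddc_const_mul]
    exact (contDiffAt_comp_symm he hy (h.smooth.contMDiffAt
      (hD.isOpen_compl.mem_nhds hyD))).of_le two_le_infty
  · intro t ht e he y hy v hv
    have hpos := hΩ.isTame_inChart he hy v hv
    rw [TwoForm.inChart_constSmul]
    change 0 < Ω.inChart e y ![v, stdJ n v] + t * ((4 * C)⁻¹ * β.inChart e y ![v, stdJ n v])
    have hb : |β.inChart e y ![v, stdJ n v]| ≤ C * Ω.inChart e y ![v, stdJ n v] := by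
      by_cases hyK : e.symm y ∈ K
      · exact (hdom _ hyK).abs_le he hy rfl v
      · rw [hβ0 e he y hy hyK]
        simpa using mul_nonneg hC.le hpos.le
    have ht2 : |t| ≤ 2 := abs_le.2 ⟨by linarith [ht.1], ht.2.le⟩
    have h1 : |t * ((4 * C)⁻¹ * β.inChart e y ![v, stdJ n v])|
        ≤ 2 * ((4 * C)⁻¹ * (C * Ω.inChart e y ![v, stdJ n v])) := by
      rw [abs_mul, abs_mul, abs_of_pos hc]
      exact mul_le_mul ht2 (mul_le_mul_of_nonneg_left hb hc.le) (by positivity) zero_le_two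
    have h2 : 2 * ((4 * C)⁻¹ * (C * Ω.inChart e y ![v, stdJ n v]))
        = Ω.inChart e y ![v, stdJ n v] / 2 := by field_simp; norm_num
    rw [h2] at h1
    linarith [(abs_le.1 h1).1]

theorem TwoForm.IsLocallyDdc.isSmooth (hβ : β.IsLocallyDdc) : β.IsSmooth :=
  fun _ he _ hy => (hβ.contDiffAt (IsManifold.subset_maximalAtlas he) hy).contDiffWithinAt

/-- The endpoint of the path of forms is Kähler. -/
theorem MoserData.isKaehler_path (h : MoserData Ω β D P) : (Ω.path β 1).IsKaehler := by
  have h1 : (1 : ℝ) ∈ Ioo (-1 : ℝ) 2 := by norm_num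
  refine TwoForm.isKaehler_of_inChart ?_ ?_ ?_ ?_
  · intro e he y hy
    rw [TwoForm.inChart_path_eq]
    exact (h.contDiffAt_form he hy).add
      (contDiffAt_const.smul (h.locallyDdc.contDiffAt (IsManifold.subset_maximalAtlas he) hy))
  · intro e he y hy
    have he' : e ∈ holAtlas n X := IsManifold.subset_maximalAtlas he
    have h2 := (h.contDiffAt_form he hy).differentiableAt (by simp)
    have h3 := (h.locallyDdc.contDiffAt he' hy).differentiableAt (by simp)
    rw [TwoForm.inChart_path_eq, one_smul, extDeriv_add h2 h3, h.kaehler.closed e he y hy,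
      h.locallyDdc.extDeriv_eq_zero he' hy, add_zero]
  · intro e he y hy u v
    rw [TwoForm.inChart_path]
    exact h.path_map_stdJ 1 he hy u v
  · intro e he y hy
    rw [TwoForm.inChart_path]
    exact h.tame 1 h1 e he y hy

/-- A function with logarithmic poles along `D` yields a symplectic embedding away from `D`. -/
theorem HasLogPoles.exists_symplecticEmbedding [T2Space X] (h : HasLogPoles n D P)
    (hDc : IsCompact D) (hDd : Dense Dᶜ) (hΩ : Ω.IsKaehler) {K : Set X} (hK : IsCompact K)
    (hDK : D ⊆ K) (hP : ∀ x ∉ K, P x = 0) :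
    ∃ Ω' : TwoForm n X, Ω'.IsKaehler ∧ ∃ ψ : X → X, IsSymplecticEmbedding Ω Ω' Dᶜ Dᶜ ψ ∧
      (∃ N : Set X, IsOpen N ∧ D ⊆ N ∧ ψ '' Dᶜ ⊆ Nᶜ) ∧ ∀ x ∉ D, x ∉ K → ψ x = x := by
  obtain ⟨c, hc, β, hm⟩ := h.exists_moserData hDc.isClosed hDd hΩ hK hK.isClosed hDK hP
  have h' := h.const_mul hc
  have hP' : ∀ x ∉ K, c * P x = 0 := fun x hx => by rw [hP x hx, mul_zero]
  obtain ⟨ψ, hψ, hγ, hfix⟩ := hm.exists_symplecticEmbedding hK hP' (h'.isOpen_union hDc.isClosed)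
  obtain ⟨C, hC⟩ := h'.exists_flow_bound hm hm.locallyDdc.isSmooth hDc hK hP'
  -- The neighbourhood of `D` consists of `D` and the points where the rescaled potential exceeds
  -- its bound at time one.
  refine ⟨_, hm.isKaehler_path, ψ, hψ, ⟨_, h'.isOpen_union hDc.isClosed C, subset_union_left, ?_⟩,
    hfix⟩
  rintro _ ⟨x, hx, rfl⟩ hN
  obtain ⟨γ, hγ, -, h1⟩ := hγ x hx
  rcases hN with hN | hN
  · exact hψ.mapsTo hx hN
  · have := hC γ hγ
    rw [h1] at this
    exact absurd hN (not_lt.2 this)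

end Bounds

/-! ### The logarithmic potential of a divisor -/

section DivisorPotential

open Set

variable {n : ℕ} {X : Type*} [TopologicalSpace X] [ChartedSpace (CSpace n) X]

theorem ContMDiffAt.log_norm {f : X → ℂ} {x : X}
    (hf : ContMDiffAt 𝓘(ℂ, CSpace n) 𝓘(ℂ) ω f x) (h0 : f x ≠ 0) :
    ContMDiffAt 𝓘(ℝ, CSpace n) 𝓘(ℝ) ∞ (fun x => Real.log ‖f x‖) x := by
  have h1 : ContDiffAt ℝ ∞ (fun w : ℂ => Real.log ‖w‖) (f x) :=
    (contDiffAt_id.norm ℝ h0).log (norm_ne_zero_iff.2 h0)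
  exact h1.contMDiffAt.comp x (hf.restrictScalars_real.of_le le_top)

namespace EffectiveDivisor

variable (D : EffectiveDivisor n X)

theorem dense_compl_support : Dense D.supportᶜ := by
  rw [← interior_eq_empty_iff_dense_compl, Set.eq_empty_iff_forall_notMem]
  intro x hx
  have h1 : interior D.support ∩ D.dom x ⊆ {y ∈ D.dom x | D.eqn x y = 0} := fun y hy =>
    ⟨hy.2, (D.mem_support_iff hy.2).1 (interior_subset hy.1)⟩
  have h2 : x ∈ interior {y ∈ D.dom x | D.eqn x y = 0} :=
    interior_maximal h1 (isOpen_interior.inter (D.isOpen_dom x)) ⟨hx, D.mem_dom x⟩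
  rw [D.nonzero x] at h2
  exact h2

variable {D}

theorem contMDiffAt_log_eqn {p x : X} (hx : x ∈ D.dom p) (hxD : x ∉ D.support) :
    ContMDiffAt 𝓘(ℝ, CSpace n) 𝓘(ℝ) ∞ (fun x => Real.log ‖D.eqn p x‖) x :=
  ((D.holomorphic p).contMDiffAt ((D.isOpen_dom p).mem_nhds hx)).log_norm
    fun h0 => hxD ((D.mem_support_iff hx).2 h0)

/-- The glued potential `-∑ ρ_p log |f_p|` has logarithmic poles along the support. -/
theorem IsNormalCrossings.hasLogPoles [IsManifold 𝓘(ℂ, CSpace n) ω X] (hD : D.IsNormalCrossings)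
    {s : Set X} (hs : D.support ⊆ interior s)
    (ρ : SmoothPartitionOfUnity X 𝓘(ℝ, CSpace n) X s) (hρ : ρ.IsSubordinate D.dom) :
    HasLogPoles n D.support fun x => -∑ᶠ p, ρ p x • Real.log ‖D.eqn p x‖ where
  smooth x hx := (ρ.contMDiffAt_finsum fun p hp =>
    contMDiffAt_log_eqn (hρ p hp) hx).neg.contMDiffWithinAt
  exists_chart q hq := by
    obtain ⟨z, hz, hqz, hz0, α, u, hu, hu0, hev⟩ := hD q hq
    -- Near `q` every local equation factors as `f_p = g_p f_q`, with `g_p` a unit and `f_q` a unit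
    -- times the monomial.
    choose g hg hg' using fun p => D.compatible p q
    have hu' := (contMDiffAt_iff_contMDiffAt_nhds (by simp)).1 hu
    have e1 : ∀ᶠ x in 𝓝 q, x ∈ z.source := z.open_source.mem_nhds hqz
    have e2 : ∀ᶠ x in 𝓝 q, x ∈ D.dom q := (D.isOpen_dom q).mem_nhds (D.mem_dom q)
    have e3 : ∀ᶠ x in 𝓝 q, x ∈ interior s := isOpen_interior.mem_nhds (hs hq)
    obtain ⟨W, hW, hWo, hqW⟩ := eventually_nhds_iff.1
      (hev.and (hu'.and ((hu.continuousAt.eventually_ne hu0).and (e1.and (e2.and e3)))))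
    -- The exponents become the weights, and the logarithms of the units `g p` and `u` make up the
    -- smooth part.
    refine ⟨z, fun k => α k, W,
      fun x => -∑ᶠ p, ρ p x • (Real.log ‖g p x‖ + Real.log ‖u x‖), ⟨hz, fun k => by positivity,
        hWo, fun x hx => (hW x hx).2.2.2.1, fun x hx => ?_, fun x hx => ?_, fun x hx hxD => ?_⟩,
      hqW, hz0⟩
    · obtain ⟨-, hux, hux0, -, hxq, -⟩ := hW x hx
      refine (ρ.contMDiffAt_finsum fun p hp => ?_).neg.contMDiffWithinAt
      have hxp := hρ p hp
      exact (((hg p).contMDiffAt (((D.isOpen_dom p).inter (D.isOpen_dom q)).mem_nhds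
        ⟨hxp, hxq⟩)).log_norm (hg' p x ⟨hxp, hxq⟩).1).add (hux.log_norm hux0)
    · obtain ⟨hxe, -, hux0, -, hxq, -⟩ := hW x hx
      rw [D.mem_support_iff hxq, hxe]
      simp [hux0, Finset.prod_eq_zero_iff, pos_iff_ne_zero, and_comm]
    · obtain ⟨hxe, -, hux0, -, hxq, hxs⟩ := hW x hx
      -- Since the weights sum to one near `D`, the coefficients of the logarithms are exactly the
      -- `α k`, unaffected by the partition of unity.
      have hsum : ∑ᶠ p, ρ p x = 1 := ρ.sum_eq_one (interior_subset hxs)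
      have hfin : (Function.support fun p => ρ p x).Finite := ρ.locallyFinite.point_finite x
      have hq0 : D.eqn q x ≠ 0 := fun h0 => hxD ((D.mem_support_iff hxq).2 h0)
      have hlogq : Real.log ‖D.eqn q x‖ = Real.log ‖u x‖ + logSum (fun k => α k) (z x) := by
        rw [hxe] at hq0 ⊢
        have hprod := right_ne_zero_of_mul hq0
        rw [norm_mul, Real.log_mul (norm_ne_zero_iff.2 hux0) (norm_ne_zero_iff.2 hprod), norm_prod,
          Real.log_prod fun k hk => norm_ne_zero_iff.2 (Finset.prod_ne_zero_iff.1 hprod k hk)]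
        simp [logSum]
      have hterm : ∀ p, ρ p x • Real.log ‖D.eqn p x‖
          = ρ p x • (Real.log ‖g p x‖ + Real.log ‖u x‖)
            + ρ p x * logSum (fun k => α k) (z x) := by
        intro p
        by_cases hp : ρ p x = 0
        · simp [hp]
        · have hxp : x ∈ D.dom p := hρ p (subset_tsupport _ hp)
          obtain ⟨hg0, hgx⟩ := hg' p x ⟨hxp, hxq⟩
          rw [hgx, norm_mul, Real.log_mul (norm_ne_zero_iff.2 hg0) (norm_ne_zero_iff.2 hq0), hlogq,
            smul_eq_mul, smul_eq_mul]
          ring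
      rw [finsum_congr hterm, finsum_add_distrib, ← finsum_mul, hsum, one_mul]
      · ring
      · exact hfin.subset fun p hp h0 => hp (by simp only [h0, zero_smul])
      · exact hfin.subset fun p hp h0 => hp (by simp only [h0, zero_mul])

/-- A normal crossings divisor with compact support has a potential with logarithmic poles along
the support that vanishes off a given neighbourhood. -/
theorem IsNormalCrossings.exists_hasLogPoles [T2Space X] [SecondCountableTopology X]
    [IsManifold 𝓘(ℂ, CSpace n) ω X] (hD : D.IsNormalCrossings) (hDc : IsCompact D.support)
    {U : Set X} (hU : IsOpen U) (hDU : D.support ⊆ U) :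
    ∃ P K, HasLogPoles n D.support P ∧ IsCompact K ∧ D.support ⊆ K ∧ K ⊆ U ∧
      ∀ x ∉ K, P x = 0 := by
  have := isManifold_real n X
  have : LocallyCompactSpace X := ChartedSpace.locallyCompactSpace (CSpace n) X
  -- Two nested neighbourhoods: the partition of unity sums to one on the inner `V'`, and its
  -- supports lie in the outer `V`, so the potential vanishes off the compact closure of `V`.
  obtain ⟨V, hV, hDV, hVU, hVc⟩ := exists_open_between_and_isCompact_closure hDc hU hDU
  obtain ⟨V', hV', hDV', hVV', -⟩ := exists_open_between_and_isCompact_closure hDc hV hDV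
  obtain ⟨ρ, hρ⟩ := SmoothPartitionOfUnity.exists_isSubordinate 𝓘(ℝ, CSpace n)
    (isClosed_closure (s := V')) (fun p => D.dom p ∩ V) (fun p => (D.isOpen_dom p).inter hV)
    fun x hx => mem_iUnion.2 ⟨x, D.mem_dom x, hVV' hx⟩
  refine ⟨_, closure V, hD.hasLogPoles
    (hDV'.trans (interior_maximal subset_closure hV')) ρ fun p => (hρ p).trans inter_subset_left,
    hVc, hDV.trans subset_closure, hVU, fun x hx => ?_⟩
  rw [neg_eq_zero]
  refine finsum_eq_zero_of_forall_eq_zero fun p => ?_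
  have : ρ p x = 0 := by
    by_contra h0
    exact hx (subset_closure (hρ p (subset_tsupport _ h0)).2)
  rw [this, zero_smul]

end EffectiveDivisor

end DivisorPotential

theorem mainTheorem7 (n : ℕ) (X : Type*) [TopologicalSpace X] [T2Space X]
    [SecondCountableTopology X] [ChartedSpace (CSpace n) X] [IsManifold 𝓘(ℂ, CSpace n) ω X]
    (Ω : TwoForm n X) (hΩ : Ω.IsKaehler)
    (D : EffectiveDivisor n X) (hD : D.IsNormalCrossings) (hDc : IsCompact D.support)
    (U : Set X) (hU : IsOpen U) (hDU : D.support ⊆ U) :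
    ∃ Ω' : TwoForm n X, Ω'.IsKaehler ∧
      ∃ ψ : X → X, IsSymplecticEmbedding Ω Ω' D.supportᶜ D.supportᶜ ψ ∧
        (∃ N : Set X, IsOpen N ∧ D.support ⊆ N ∧ ψ '' D.supportᶜ ⊆ Nᶜ) ∧
        ∀ x ∈ D.supportᶜ, x ∉ U → ψ x = x := by
  obtain ⟨P, K, hP, hK, hDK, hKU, hPK⟩ := hD.exists_hasLogPoles hDc hU hDU
  obtain ⟨Ω', hΩ', ψ, hψ, hN, hfix⟩ :=
    hP.exists_symplecticEmbedding hDc D.dense_compl_support hΩ hK hDK hPK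
  exact ⟨Ω', hΩ', ψ, hψ, hN, fun x hx hxU => hfix x hx fun hxK => hxU (hKU hxK)⟩

end
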